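/- Manifolds are smooth, Hausdorff, $\sigma$-compact and without boundary. Let $(M,g)$ be a Riemannian $n$-manifold and let $\eta$ be a calibration $k$-form on $M$, i.e. a smooth $k$-form with $\mathrm{d}\eta=0$ and $\eta(e_1,\dots,e_k)\le 1$ for all unit tangent vectors $e_1,\dots,e_k$ at any point of $M$. Let $N$ be an oriented $k$-manifold and $\iota:N\to M$ an immersion (in particular, an oriented $k$-dimensional submanifold of $M$) which is calibrated by $\eta$: for every $p\in N$ there is an oriented basis $e_1,\dots,e_k$ of $T_pN$, orthonormal for $\iota^*g$, with $\eta(\iota_*e_1,\dots,\iota_*e_k)=1$. For a smooth map $f:N\to M$ and $A\subseteq N$ let $\mathrm{Vol}(f(A))=\int_A\sqrt{\det\big(g(\partial f/\partial x_i,\partial f/\partial x_j)\big)}\,\mathrm{d}x_1\cdots \mathrm{d}x_k$ (computed in local coordinates of $N$, so counted with multiplicity), and $\mathrm{Vol}(A)=\mathrm{Vol}(\iota(A))$. A variation of $N$ with compact support $\overline S$, where $S\subseteq N$ is open and $\overline S$ is compact, is a smooth map $F:N\times(-\epsilon,\epsilon)\to M$, $\epsilon>0$, with $F(p,0)=\iota(p)$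 for all $p\in N$ and such that $F(p,t)=\iota(p)$ for all $t$, for every $p\notin\overline S$ and for almost every $p\in\partial S$ (the latter is automatic if $\partial S$ is a null set, or if $S$ is the interior of $\overline S$). Then: 1. $N$ is minimal: for every variation $F$ with compact support $\overline S$, the volumes $\mathrm{Vol}(F(S,t))$ are finite and $\frac{\mathrm{d}}{\mathrm{d}t}\mathrm{Vol}(F(S,t))|_{t=0}$ exists and equals $0$. 2. $N$ is volume-minimizing: for every variation $F$ with compact support $\overline S$ and every $t\in(-\epsilon,\epsilon)$, $\mathrm{Vol}(F(S,t))\ge \mathrm{Vol}(S)$. 3. If $N$ is compact, then $N$ is volume-minimizing in its homology class: if $N'$ is a compact oriented $k$-manifold and $f':N'\to M$ a smooth map (in particular, a compact oriented submanifold) with $f'_*[N']=\iota_*[N]$ in the smooth singular homology $H_k(M;\mathbb{R})$, then $\mathrm{Vol}(N)\le\mathrm{Vol}(f'(N'))$. -/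

import Mathlib

open Set Bundle
open scoped Manifold ContDiff Topology

namespace Calibration

/-! Manifolds are smooth, without boundary, and modelled on `EuclideanSpace ℝ (Fin m)`. -/

/-- A smooth Riemannian metric on the `n`-manifold `M`. -/
abbrev Metric (n : ℕ) (M : Type*) [TopologicalSpace M]
    [ChartedSpace (EuclideanSpace ℝ (Fin n)) M] [IsManifold (𝓡 n) ∞ M] :=
  ContMDiffRiemannianMetric (𝓡 n) ∞ (EuclideanSpace ℝ (Fin n))
    (fun x : M ↦ TangentSpace (𝓡 n) x)

section Forms

/-- The expression of a field `η` of alternating `k`-linear forms on the tangent spaces of `M` in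
the preferred chart at `x₀`, that is, its pullback under the inverse of that chart. It is meaningful
on the target of the chart. -/
noncomputable def chartRep {n k : ℕ} {M : Type*} [TopologicalSpace M]
    [ChartedSpace (EuclideanSpace ℝ (Fin n)) M]
    (η : ∀ x : M, TangentSpace (𝓡 n) x [⋀^Fin k]→L[ℝ] ℝ) (x₀ : M)
    (y : EuclideanSpace ℝ (Fin n)) : EuclideanSpace ℝ (Fin n) [⋀^Fin k]→L[ℝ] ℝ :=
  (η ((chartAt (EuclideanSpace ℝ (Fin n)) x₀).symm y)).compContinuousLinearMap
    (mfderiv (𝓡 n) (𝓡 n) (chartAt (EuclideanSpace ℝ (Fin n)) x₀).symm y)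

/-- A smooth differential `k`-form on the `n`-manifold `M`. -/
structure DiffForm (n k : ℕ) (M : Type*) [TopologicalSpace M]
    [ChartedSpace (EuclideanSpace ℝ (Fin n)) M] where
  /-- The value of the form at a point. -/
  toFun : ∀ x : M, TangentSpace (𝓡 n) x [⋀^Fin k]→L[ℝ] ℝ
  /-- The form is smooth in charts. -/
  smooth' : ∀ x₀ : M, ContDiffOn ℝ ∞ (chartRep toFun x₀)
    (chartAt (EuclideanSpace ℝ (Fin n)) x₀).target

variable {n k : ℕ} {M : Type*} [TopologicalSpace M] [ChartedSpace (EuclideanSpace ℝ (Fin n)) M]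

/-- `dη = 0`, computed in charts. -/
def DiffForm.IsClosed (η : DiffForm n k M) : Prop :=
  ∀ x₀ : M, ∀ y ∈ (chartAt (EuclideanSpace ℝ (Fin n)) x₀).target,
    extDeriv (chartRep η.toFun x₀) y = 0

/-- A calibration: a closed form with `η(e₁, …, e_k) ≤ 1` for all unit tangent vectors. -/
structure IsCalibration [IsManifold (𝓡 n) ∞ M] (g : Metric n M) (η : DiffForm n k M) : Prop where
  closed : η.IsClosed
  le_one : ∀ (x : M) (e : Fin k → TangentSpace (𝓡 n) x),
    (∀ i, g.inner x (e i) (e i) = 1) → η.toFun x e ≤ 1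

end Forms

/-- An orientation of the `k`-manifold `N`, given by a nowhere vanishing smooth `k`-form: a frame
`e` at `p` is positively oriented when the value of the form on `e` is positive. -/
structure OrientationForm (k : ℕ) (N : Type*) [TopologicalSpace N]
    [ChartedSpace (EuclideanSpace ℝ (Fin k)) N] extends DiffForm k k N where
  ne_zero' : ∀ p : N, toFun p ≠ 0

section Volume

variable {n k : ℕ} {M : Type*} [TopologicalSpace M] [ChartedSpace (EuclideanSpace ℝ (Fin n)) M]
  [IsManifold (𝓡 n) ∞ M] {N : Type*} [TopologicalSpace N]

/-- `√det (g(∂f/∂xᵢ, ∂f/∂xⱼ))` in the preferred chart of `N` at `p₀`, at the point with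
coordinates `y`. -/
noncomputable def volDensity [ChartedSpace (EuclideanSpace ℝ (Fin k)) N]
    (g : Metric n M) (f : N → M) (p₀ : N)
    (y : EuclideanSpace ℝ (Fin k)) : ℝ :=
  √(Matrix.det (Matrix.of fun i j : Fin k ↦
    g.inner (f ((chartAt (EuclideanSpace ℝ (Fin k)) p₀).symm y))
      (mfderiv (𝓡 k) (𝓡 n) (f ∘ (chartAt (EuclideanSpace ℝ (Fin k)) p₀).symm) y
        (EuclideanSpace.single i (1 : ℝ)))
      (mfderiv (𝓡 k) (𝓡 n) (f ∘ (chartAt (EuclideanSpace ℝ (Fin k)) p₀).symm) y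
        (EuclideanSpace.single j (1 : ℝ)))))

/-- A smooth partition of unity on `N` subordinate to the preferred charts. -/
noncomputable def chartPartition (k : ℕ) (N : Type*) [TopologicalSpace N]
    [ChartedSpace (EuclideanSpace ℝ (Fin k)) N] [IsManifold (𝓡 k) ∞ N] [T2Space N]
    [SigmaCompactSpace N] : SmoothPartitionOfUnity N (𝓡 k) N univ :=
  (SmoothPartitionOfUnity.exists_isSubordinate_chartAt_source (𝓡 k) N).choose

/-- `Vol (f (A))`: the `k`-dimensional volume of `f` restricted to `A ⊆ N`, that is, the integral
over `A` of `√det (g(∂f/∂xᵢ, ∂f/∂xⱼ)) dx₁ ⋯ dx_k`, put together from charts by a partition of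
unity. By the change of variables formula the value depends neither on the charts nor on the
partition of unity. -/
noncomputable def vol (k : ℕ) [ChartedSpace (EuclideanSpace ℝ (Fin k)) N]
    [IsManifold (𝓡 k) ∞ N] [T2Space N] [SigmaCompactSpace N]
    (g : Metric n M) (f : N → M) (A : Set N) : ENNReal :=
  ∑' p₀ : N, ∫⁻ y in (chartAt (EuclideanSpace ℝ (Fin k)) p₀).target ∩
      (chartAt (EuclideanSpace ℝ (Fin k)) p₀).symm ⁻¹' A,
    ENNReal.ofReal (chartPartition k N p₀ ((chartAt (EuclideanSpace ℝ (Fin k)) p₀).symm y)) *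
      ENNReal.ofReal (volDensity g f p₀ y)

/-- The immersed submanifold `ι : N → M` with orientation `o` is calibrated by `η`: at every
`p : N` there is an oriented basis `e₁, …, e_k` of `T_p N` that is orthonormal for the induced
metric and satisfies `η(e₁, …, e_k) = 1`. -/
def IsCalibrated [ChartedSpace (EuclideanSpace ℝ (Fin k)) N]
    (g : Metric n M) (η : DiffForm n k M) (o : OrientationForm k N) (ι : N → M) : Prop :=
  ∀ p : N, ∃ e : Fin k → TangentSpace (𝓡 k) p,
    0 < o.toFun p e ∧
    (∀ i j, g.inner (ι p) (mfderiv (𝓡 k) (𝓡 n) ι p (e i)) (mfderiv (𝓡 k) (𝓡 n) ι p (e j)) =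
      if i = j then 1 else 0) ∧
    η.toFun (ι p) (fun i ↦ mfderiv (𝓡 k) (𝓡 n) ι p (e i)) = 1

/-- `F : N × (-ε, ε) → M` is a smooth variation of `ι : N → M` with compact support `closure S`,
where `S` is open. The last condition says that `F` fixes almost every point of the boundary of
`S`; it holds automatically when the boundary is a null set, and also when `S` is the interior of
its closure. -/
structure IsVariation (k : ℕ) [ChartedSpace (EuclideanSpace ℝ (Fin k)) N]
    [IsManifold (𝓡 k) ∞ N] [T2Space N] [SigmaCompactSpace N]
    (g : Metric n M) (ι : N → M) (ε : ℝ) (F : ℝ → N → M) (S : Set N) : Prop where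
  pos : 0 < ε
  smooth : ContMDiffOn ((𝓡 k).prod 𝓘(ℝ, ℝ)) (𝓡 n) ∞ (fun q : N × ℝ ↦ F q.2 q.1)
    (univ ×ˢ Ioo (-ε) ε)
  zero : ∀ p, F 0 p = ι p
  isOpen : IsOpen S
  isCompact : IsCompact (closure S)
  eq_outside : ∀ t ∈ Ioo (-ε) ε, ∀ p ∉ closure S, F t p = ι p
  eq_frontier : vol k g ι {p ∈ frontier S | ∃ t ∈ Ioo (-ε) ε, F t p ≠ ι p} = 0

/-- The immersed submanifold `ι : N → M` is minimal: for every compactly supported variation the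
volume (which is finite) has derivative zero at `t = 0`. -/
def IsMinimal (k : ℕ) [ChartedSpace (EuclideanSpace ℝ (Fin k)) N]
    [IsManifold (𝓡 k) ∞ N] [T2Space N] [SigmaCompactSpace N]
    (g : Metric n M) (ι : N → M) : Prop :=
  ∀ (ε : ℝ) (F : ℝ → N → M) (S : Set N), IsVariation k g ι ε F S →
    (∀ t ∈ Ioo (-ε) ε, vol k g (F t) S ≠ ⊤) ∧
    HasDerivAt (fun t ↦ (vol k g (F t) S).toReal) 0 0

end Volume

section Homology

/-- A smooth singular `j`-simplex in the `m`-manifold `X`: a map from the standard simplex that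
extends to a smooth map on a neighbourhood of the simplex in `ℝ^(j+1)`. -/
@[ext]
structure SmoothSimplex (m : ℕ) (X : Type*) [TopologicalSpace X]
    [ChartedSpace (EuclideanSpace ℝ (Fin m)) X] (j : ℕ) where
  /-- The underlying map. -/
  toFun : stdSimplex ℝ (Fin (j + 1)) → X
  smooth' : ∃ (U : Set (Fin (j + 1) → ℝ)) (s : (Fin (j + 1) → ℝ) → X), IsOpen U ∧
    stdSimplex ℝ (Fin (j + 1)) ⊆ U ∧ ContMDiffOn 𝓘(ℝ, Fin (j + 1) → ℝ) (𝓡 m) ∞ s U ∧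
    ∀ y : stdSimplex ℝ (Fin (j + 1)), s y = toFun y

variable {m m' : ℕ} {X : Type*} [TopologicalSpace X] [ChartedSpace (EuclideanSpace ℝ (Fin m)) X]
  {Y : Type*} [TopologicalSpace Y] [ChartedSpace (EuclideanSpace ℝ (Fin m')) Y] {j : ℕ}

/-- The `i`-th face of a smooth simplex. -/
noncomputable def SmoothSimplex.face (σ : SmoothSimplex m X (j + 1)) (i : Fin (j + 2)) :
    SmoothSimplex m X j where
  toFun y := σ.toFun (stdSimplex.map i.succAbove y)
  smooth' := by
    obtain ⟨U, s, hU, hsub, hs, heq⟩ := σ.smooth'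
    let L : (Fin (j + 1) → ℝ) →L[ℝ] (Fin (j + 2) → ℝ) :=
      LinearMap.toContinuousLinearMap (FunOnFinite.linearMap ℝ ℝ i.succAbove)
    refine ⟨L ⁻¹' U, s ∘ L, hU.preimage L.continuous, fun y hy ↦ ?_, ?_, fun y ↦ ?_⟩
    · exact hsub (stdSimplex.map i.succAbove ⟨y, hy⟩).2
    · exact hs.comp L.contDiff.contMDiff.contMDiffOn (fun y hy ↦ hy)
    · exact heq (stdSimplex.map i.succAbove y)

/-- The composition of a smooth simplex with a smooth map. -/
def SmoothSimplex.map (f : X → Y) (hf : ContMDiff (𝓡 m) (𝓡 m') ∞ f) (σ : SmoothSimplex m X j) :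
    SmoothSimplex m' Y j where
  toFun := f ∘ σ.toFun
  smooth' := by
    obtain ⟨U, s, hU, hsub, hs, heq⟩ := σ.smooth'
    exact ⟨U, f ∘ s, hU, hsub, hf.comp_contMDiffOn hs, fun y ↦ congrArg f (heq y)⟩

/-- Smooth singular `j`-chains with real coefficients. -/
abbrev Chain (m : ℕ) (X : Type*) [TopologicalSpace X]
    [ChartedSpace (EuclideanSpace ℝ (Fin m)) X] (j : ℕ) : Type _ :=
  SmoothSimplex m X j →₀ ℝ

/-- The singular boundary operator `∂σ = ∑ᵢ (-1)ⁱ σ ∘ δᵢ`. -/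
noncomputable def boundary : Chain m X (j + 1) →ₗ[ℝ] Chain m X j :=
  Finsupp.linearCombination ℝ fun σ : SmoothSimplex m X (j + 1) ↦
    ∑ i : Fin (j + 2), Finsupp.single (σ.face i) ((-1 : ℝ) ^ (i : ℕ))

/-- The push-forward of chains under a smooth map. -/
noncomputable def pushChain (f : X → Y) (hf : ContMDiff (𝓡 m) (𝓡 m') ∞ f) :
    Chain m X j →ₗ[ℝ] Chain m' Y j :=
  Finsupp.lmapDomain ℝ ℝ (SmoothSimplex.map f hf)

/-- `∂z = 0`, a void condition in degree zero. -/
def IsCycle : ∀ {j : ℕ}, Chain m X j → Prop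
  | 0, _ => True
  | _ + 1, z => boundary z = 0

/-- The smooth simplex in `N` that is affine with vertices `v₀, …, v_j` in the preferred chart
at `p`. -/
noncomputable def affineSimplex {k : ℕ} {N : Type*} [TopologicalSpace N]
    [ChartedSpace (EuclideanSpace ℝ (Fin k)) N] [IsManifold (𝓡 k) ∞ N] (p : N)
    (v : Fin (j + 1) → EuclideanSpace ℝ (Fin k))
    (hv : convexHull ℝ (range v) ⊆ (chartAt (EuclideanSpace ℝ (Fin k)) p).target) :
    SmoothSimplex k N j where
  toFun y := (chartAt (EuclideanSpace ℝ (Fin k)) p).symm (∑ i, y i • v i)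
  smooth' := by
    have hL : ContDiff ℝ ∞ (fun y : Fin (j + 1) → ℝ ↦ ∑ i, y i • v i) := by fun_prop
    refine ⟨(fun y : Fin (j + 1) → ℝ ↦ ∑ i, y i • v i) ⁻¹'
        (chartAt (EuclideanSpace ℝ (Fin k)) p).target,
      fun y ↦ (chartAt (EuclideanSpace ℝ (Fin k)) p).symm (∑ i, y i • v i),
      (chartAt (EuclideanSpace ℝ (Fin k)) p).open_target.preimage hL.continuous,
      fun y hy ↦ hv ?_, ?_, fun y ↦ rfl⟩
    · exact (convex_convexHull ℝ _).sum_mem (fun i _ ↦ hy.1 i) hy.2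
        (fun i _ ↦ subset_convexHull ℝ _ (mem_range_self i))
    · exact (contMDiffOn_chart_symm (I := 𝓡 k) (n := ∞)).comp hL.contMDiff.contMDiffOn
        (fun y hy ↦ hy)

/-- The chain `z` represents the fundamental class of the oriented `k`-manifold `N`: it is a cycle,
and for every `p` its class in `H_k(N, N ∖ {p})` is the local orientation at `p`, that is, the class
of `± σ` for a small affine simplex `σ` in a chart with `p` in its interior, the sign telling
whether `σ` is positively oriented. -/
def IsFundamentalCycle {k : ℕ} {N : Type*} [TopologicalSpace N]
    [ChartedSpace (EuclideanSpace ℝ (Fin k)) N] [IsManifold (𝓡 k) ∞ N]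
    (o : OrientationForm k N) (z : Chain k N k) : Prop :=
  IsCycle z ∧
  ∀ p : N, ∃ (v : Fin (k + 1) → EuclideanSpace ℝ (Fin k))
    (hv : convexHull ℝ (range v) ⊆ (chartAt (EuclideanSpace ℝ (Fin k)) p).target)
    (c : Chain k N (k + 1)) (w : Chain k N k),
    chartAt (EuclideanSpace ℝ (Fin k)) p p ∈ interior (convexHull ℝ (range v)) ∧
    (∀ σ ∈ w.support, p ∉ range σ.toFun) ∧
    z = Finsupp.single (affineSimplex p v hv)
          (Real.sign (chartRep o.toFun p (chartAt (EuclideanSpace ℝ (Fin k)) p p)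
            (fun i : Fin k ↦ v i.succ - v 0))) +
        boundary c + w

/-- The smooth maps `f : N → M` and `f' : N' → M` from compact oriented `k`-manifolds are
homologous: `f_* [N] = f'_* [N']` in the `k`-th smooth singular homology of `M` with real
coefficients. -/
def Homologous {n k : ℕ} {M : Type*} [TopologicalSpace M]
    [ChartedSpace (EuclideanSpace ℝ (Fin n)) M]
    {N : Type*} [TopologicalSpace N] [ChartedSpace (EuclideanSpace ℝ (Fin k)) N]
    [IsManifold (𝓡 k) ∞ N]
    {N' : Type*} [TopologicalSpace N'] [ChartedSpace (EuclideanSpace ℝ (Fin k)) N']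
    [IsManifold (𝓡 k) ∞ N']
    (o : OrientationForm k N) (f : N → M) (hf : ContMDiff (𝓡 k) (𝓡 n) ∞ f)
    (o' : OrientationForm k N') (f' : N' → M) (hf' : ContMDiff (𝓡 k) (𝓡 n) ∞ f') : Prop :=
  ∃ (z : Chain k N k) (z' : Chain k N' k) (c : Chain n M (k + 1)),
    IsFundamentalCycle o z ∧ IsFundamentalCycle o' z' ∧
    boundary c = pushChain f' hf' z' - pushChain f hf z

end Homology

end Calibration

/-!
The proof is the classical calibration argument, carried out with explicit integrals.

Fix the orientation form `o` of `N`. Its absolute value defines a measure `orientMeasure o` on `N`,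
and for a smooth map `f : N → M` both the volume density and the pullback of `η` are multiples of
`o`, with factors `relDensity g o f` and `relForm η o f`. Then `Vol (f (A))` is the integral of
`relDensity g o f` over `A` (`vol_eq_lintegral`). A `k`-form that is bounded by one on unit vectors
is bounded by the volume of the parallelepiped (`abs_le_sqrt_det_gram`), so `relForm ≤ relDensity`
for every map (`abs_relForm_le`), while the two factors agree and are positive for the calibrated
immersion (`relForm_eq_relDensity`). In degree zero, where `η` need not be bounded from below, it is
first replaced by the constant one (`exists_abs_le_one_isCalibrated`). It remains to see that the integral of `relForm η o f` is the
same for the maps that are compared.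

For variations this is homotopy invariance. In a chart, closedness writes the derivative in time of
the integrand as a sum of derivatives of compactly supported functions
(`setIntegral_eq_of_closed_homotopy`). A partition of unity cuts a variation into finitely many such
steps (`integral_relForm_family_sub_eq_zero`). On the boundary of `S`, maps that agree almost
everywhere have derivatives that agree almost everywhere (`ae_relForm_eq_of_eqOn`), so the integral
over `S` does not change either. The density is positive at time zero, hence it depends there
smoothly on time and one may differentiate under the integral sign; the derivative vanishes since the volume
has a minimum at time zero.

For homology classes this is Stokes' theorem on simplices (`chainIntegral_boundary`), together with
the fact that integration over a fundamental cycle is integration with respect to `orientMeasure o`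
(`IsFundamentalCycle.chainIntegral_eq`). The latter is local: for a function with support near `p`,
the description of the cycle near `p` reduces it to the integral over a single affine simplex, as
multiples of the orientation form are closed.
-/

namespace Calibration

open MeasureTheory

/-! ### Gram determinants -/

section LinearAlgebra

variable {k : ℕ} {V : Type*} [AddCommGroup V] [Module ℝ V]

theorem alternating_map_matrix_sum (θ : V [⋀^Fin k]→ₗ[ℝ] ℝ) (C : Matrix (Fin k) (Fin k) ℝ)
    (v : Fin k → V) : θ (fun i ↦ ∑ j, C i j • v j) = C.det * θ v := by
  let L : (Fin k → ℝ) →ₗ[ℝ] V := Fintype.linearCombination ℝ v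
  have h := (θ.compLinearMap L).eq_smul_basis_det (Pi.basisFun ℝ (Fin k))
  have h2 : (θ.compLinearMap L) (fun i ↦ C i) = (θ.compLinearMap L) (Pi.basisFun ℝ (Fin k)) *
      (Pi.basisFun ℝ (Fin k)).det (fun i ↦ C i) := by
    conv_lhs => rw [h]
    rfl
  have h5 : (Pi.basisFun ℝ (Fin k)).det (fun i ↦ C i) = C.det := Pi.basisFun_det_apply C
  rw [h5] at h2
  have h3 : (fun i ↦ L (C i)) = fun i ↦ ∑ j, C i j • v j := by
    funext i
    simp [L, Fintype.linearCombination_apply]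
  have h4 : (fun i ↦ L ((Pi.basisFun ℝ (Fin k)) i)) = v := by
    funext i
    simp [L]
  rw [← h3]
  conv_rhs => rw [← h4]
  exact h2.trans (mul_comm _ _)

variable [TopologicalSpace V]

/-- The Gram matrix of the vectors `v` for the bilinear form `B`. -/
noncomputable def gram (B : V →L[ℝ] V →L[ℝ] ℝ) (v : Fin k → V) : Matrix (Fin k) (Fin k) ℝ :=
  Matrix.of fun i j ↦ B (v i) (v j)

theorem gram_matrix_sum (B : V →L[ℝ] V →L[ℝ] ℝ) (C : Matrix (Fin k) (Fin k) ℝ)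
    (v : Fin k → V) :
    gram B (fun i ↦ ∑ j, C i j • v j) = C * gram B v * C.transpose := by
  ext i j
  simp only [gram, Matrix.of_apply, Matrix.mul_apply, map_sum, map_smul,
    sum_apply, smul_apply,
    smul_eq_mul, Matrix.transpose_apply, Finset.sum_mul, Finset.mul_sum]
  refine Finset.sum_congr rfl fun a _ ↦ Finset.sum_congr rfl fun b _ ↦ by ring

theorem det_gram_matrix_sum (B : V →L[ℝ] V →L[ℝ] ℝ) (C : Matrix (Fin k) (Fin k) ℝ)
    (v : Fin k → V) :
    (gram B (fun i ↦ ∑ j, C i j • v j)).det = C.det ^ 2 * (gram B v).det := by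
  rw [gram_matrix_sum, Matrix.det_mul, Matrix.det_mul, Matrix.det_transpose]
  ring

theorem gram_posSemidef (B : V →L[ℝ] V →L[ℝ] ℝ) (hsymm : ∀ v w, B v w = B w v)
    (hpos : ∀ v, v ≠ 0 → 0 < B v v) (v : Fin k → V) : (gram B v).PosSemidef := by
  refine Matrix.PosSemidef.of_dotProduct_mulVec_nonneg ?_ fun x ↦ ?_
  · ext i j
    simp [gram, hsymm (v j)]
  · have : star x ⬝ᵥ ((gram B v).mulVec x) = B (∑ i, x i • v i) (∑ i, x i • v i) := by
      simp only [dotProduct, Matrix.mulVec, gram, Matrix.of_apply, map_sum, map_smul,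
        sum_apply, smul_apply,
        smul_eq_mul, Finset.mul_sum, star_trivial]
      rw [Finset.sum_comm]
      refine Finset.sum_congr rfl fun a _ ↦ Finset.sum_congr rfl fun b _ ↦ ?_
      ring
    rw [this]
    by_cases h : ∑ i, x i • v i = 0
    · rw [h]; simp
    · exact (hpos _ h).le

open scoped MatrixOrder in
/-- Hadamard-type inequality: an alternating form that is at most one in absolute value on unit
vectors is bounded by the volume of the parallelepiped. Linearly independent vectors are a matrix
times an orthonormal family, and both sides scale with the determinant of that matrix. -/
theorem abs_le_sqrt_det_gram (B : V →L[ℝ] V →L[ℝ] ℝ) (hsymm : ∀ v w, B v w = B w v)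
    (hpos : ∀ v, v ≠ 0 → 0 < B v v) (θ : V [⋀^Fin k]→ₗ[ℝ] ℝ)
    (hθ : ∀ e : Fin k → V, (∀ i, B (e i) (e i) = 1) → |θ e| ≤ 1) (v : Fin k → V) :
    |θ v| ≤ √(gram B v).det := by
  by_cases hdet : (gram B v).det = 0
  -- a vector in the kernel of the Gram matrix is a linear relation among the `v i`
  · rw [hdet, Real.sqrt_zero]
    obtain ⟨x, hx, hGx⟩ := Matrix.exists_mulVec_eq_zero_iff.2 hdet
    have hzero : ∑ i, x i • v i = 0 := by
      by_contra h
      refine (hpos _ h).ne' ?_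
      have : B (∑ i, x i • v i) (∑ i, x i • v i) = x ⬝ᵥ ((gram B v).mulVec x) := by
        simp only [dotProduct, Matrix.mulVec, gram, Matrix.of_apply, map_sum, map_smul,
          sum_apply, smul_apply,
          smul_eq_mul, Finset.mul_sum]
        rw [Finset.sum_comm]
        refine Finset.sum_congr rfl fun a _ ↦ Finset.sum_congr rfl fun b _ ↦ ?_
        ring
      rw [this, hGx, dotProduct_zero]
    have hdep : ¬ LinearIndependent ℝ v := by
      rw [Fintype.linearIndependent_iff]
      push Not
      refine ⟨x, hzero, ?_⟩
      by_contra hne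
      push Not at hne
      exact hx (funext hne)
    rw [θ.map_linearDependent v hdep, abs_zero]
  -- otherwise the Gram matrix is `Aᵀ A`, and `A⁻ᵀ` makes an orthonormal family out of `v`
  · obtain ⟨A, hA⟩ := CStarAlgebra.nonneg_iff_eq_star_mul_self.mp
      (gram_posSemidef B hsymm hpos v).nonneg
    rw [Matrix.star_eq_conjTranspose, Matrix.conjTranspose_eq_transpose_of_trivial] at hA
    have hAdet : (gram B v).det = A.det ^ 2 := by
      rw [hA, Matrix.det_mul, Matrix.det_transpose, sq]
    have hA0 : A.det ≠ 0 := by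
      intro h
      rw [hAdet, h] at hdet
      simp at hdet
    have hAu : IsUnit A.det := isUnit_iff_ne_zero.2 hA0
    have hortho := gram_matrix_sum B (A⁻¹).transpose v
    rw [hA, Matrix.transpose_transpose, ← Matrix.mul_assoc, ← Matrix.transpose_mul,
      Matrix.mul_nonsing_inv _ hAu, Matrix.transpose_one, Matrix.one_mul,
      Matrix.mul_nonsing_inv _ hAu] at hortho
    have h1 := hθ (fun i ↦ ∑ j, (A⁻¹).transpose i j • v j) fun i ↦ by
      simpa [gram] using congrFun (congrFun hortho i) i
    rw [alternating_map_matrix_sum, Matrix.det_transpose, Matrix.det_nonsing_inv,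
      Ring.inverse_eq_inv', abs_mul, abs_inv] at h1
    rw [hAdet, Real.sqrt_sq_eq_abs]
    rwa [inv_mul_le_iff₀ (abs_pos.2 hA0), mul_one] at h1

end LinearAlgebra

/-! ### Pullbacks of forms under maps from a normed space -/

section Pullback

theorem contDiffAt_alternating_apply {E E' F : Type*} [NormedAddCommGroup E] [NormedSpace ℝ E]
    [NormedAddCommGroup E'] [NormedSpace ℝ E'] [NormedAddCommGroup F] [NormedSpace ℝ F] {k : ℕ}
    {r : WithTop ℕ∞} {α : E → F [⋀^Fin k]→L[ℝ] ℝ} {L : E → E' →L[ℝ] F} {z : E}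
    (hα : ContDiffAt ℝ r α z) (hL : ContDiffAt ℝ r L z) (v : Fin k → E') :
    ContDiffAt ℝ r (fun y ↦ (α y).compContinuousLinearMap (L y) v) z := by
  have h1 : ContDiffAt ℝ r (fun y ↦ (α y).toContinuousMultilinearMap) z :=
    (ContinuousAlternatingMap.toContinuousMultilinearMapCLM ℝ :
      (F [⋀^Fin k]→L[ℝ] ℝ) →L[ℝ] _).contDiff.contDiffAt.comp z hα
  have h2 : ContDiffAt ℝ r (fun y ↦
      ContinuousMultilinearMap.compContinuousLinearMapContinuousMultilinear ℝ
        (fun _ : Fin k ↦ E') (fun _ ↦ F) ℝ (fun _ ↦ L y)) z :=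
    (ContinuousMultilinearMap.contDiff _).contDiffAt.comp z (contDiffAt_pi.2 fun _ ↦ hL)
  have h3 := h2.clm_apply h1
  exact (ContinuousMultilinearMap.apply ℝ (fun _ : Fin k ↦ E') ℝ v).contDiff.contDiffAt.comp z h3

variable {n k : ℕ} {M : Type*} [TopologicalSpace M] [ChartedSpace (EuclideanSpace ℝ (Fin n)) M]
  {E : Type*} [NormedAddCommGroup E] [NormedSpace ℝ E]

/-- The pullback of a field of alternating forms on `M` under a map from a normed space. -/
noncomputable def pullback (θ : ∀ x : M, TangentSpace (𝓡 n) x [⋀^Fin k]→L[ℝ] ℝ) (G : E → M)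
    (z : E) : E [⋀^Fin k]→L[ℝ] ℝ :=
  (θ (G z)).compContinuousLinearMap (mfderiv 𝓘(ℝ, E) (𝓡 n) G z)

theorem pullback_congr_of_eventuallyEq
    (θ : ∀ x : M, TangentSpace (𝓡 n) x [⋀^Fin k]→L[ℝ] ℝ)
    {G G' : E → M} {z : E} (h : G =ᶠ[𝓝 z] G') : pullback θ G z = pullback θ G' z := by
  have hz : G z = G' z := h.self_of_nhds
  have hd : mfderiv 𝓘(ℝ, E) (𝓡 n) G z = mfderiv 𝓘(ℝ, E) (𝓡 n) G' z := h.mfderiv_eq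
  unfold pullback
  rw [hd, hz]

theorem chartRep_eq_pullback (θ : ∀ x : M, TangentSpace (𝓡 n) x [⋀^Fin k]→L[ℝ] ℝ) (x₀ : M) :
    chartRep θ x₀ = pullback θ (chartAt (EuclideanSpace ℝ (Fin n)) x₀).symm := rfl

theorem mdifferentiableAt_of_contMDiffOn {E H : Type*} [NormedAddCommGroup E] [NormedSpace ℝ E]
    [TopologicalSpace H] {I : ModelWithCorners ℝ E H} {X : Type*} [TopologicalSpace X]
    [ChartedSpace H X] {G : X → M} {U : Set X}
    (hU : IsOpen U) (hG : ContMDiffOn I (𝓡 n) ∞ G U) {z : X} (hz : z ∈ U) :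
    MDifferentiableAt I (𝓡 n) G z :=
  (hG.contMDiffAt (hU.mem_nhds hz)).mdifferentiableAt (by simp)

/-- The pullback of a form under a composition. -/
theorem pullback_comp {E' : Type*} [NormedAddCommGroup E'] [NormedSpace ℝ E']
    (θ : ∀ x : M, TangentSpace (𝓡 n) x [⋀^Fin k]→L[ℝ] ℝ) {G : E → M} {L : E' → E} {z : E'}
    (hG : MDifferentiableAt 𝓘(ℝ, E) (𝓡 n) G (L z)) (hL : DifferentiableAt ℝ L z) :
    pullback θ (G ∘ L) z = (pullback θ G (L z)).compContinuousLinearMap (fderiv ℝ L z) := by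
  have h := mfderiv_comp z hG hL.mdifferentiableAt
  rw [mfderiv_eq_fderiv] at h
  unfold pullback
  rw [h]
  rfl

theorem DiffForm.contDiffAt_chartRep (θ : DiffForm n k M) (x₀ : M) {y : EuclideanSpace ℝ (Fin n)}
    (hy : y ∈ (chartAt (EuclideanSpace ℝ (Fin n)) x₀).target) :
    ContDiffAt ℝ ∞ (chartRep θ.toFun x₀) y :=
  (θ.smooth' x₀).contDiffAt ((chartAt _ x₀).open_target.mem_nhds hy)

variable [IsManifold (𝓡 n) ∞ M]

theorem contDiffAt_chart_comp {G : E → M} {U : Set E} (hU : IsOpen U)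
    (hG : ContMDiffOn 𝓘(ℝ, E) (𝓡 n) ∞ G U) (x₀ : M) {z : E} (hz : z ∈ U)
    (hx₀ : G z ∈ (chartAt (EuclideanSpace ℝ (Fin n)) x₀).source) :
    ContDiffAt ℝ ∞ (chartAt (EuclideanSpace ℝ (Fin n)) x₀ ∘ G) z := by
  rw [← contMDiffAt_iff_contDiffAt]
  exact ((contMDiffOn_chart (I := 𝓡 n) (n := ∞) (x := x₀)).contMDiffAt
    ((chartAt _ x₀).open_source.mem_nhds hx₀)).comp z (hG.contMDiffAt (hU.mem_nhds hz))

/-- Near a point the pullback of a form under a map into a manifold is the pullback of its chart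
expression under the chart expression of the map. -/
theorem pullback_eventuallyEq (θ : ∀ x : M, TangentSpace (𝓡 n) x [⋀^Fin k]→L[ℝ] ℝ) {G : E → M}
    {U : Set E} (hU : IsOpen U) (hG : ContMDiffOn 𝓘(ℝ, E) (𝓡 n) ∞ G U) (x₀ : M) {z₀ : E}
    (hz₀ : z₀ ∈ U) (hx₀ : G z₀ ∈ (chartAt (EuclideanSpace ℝ (Fin n)) x₀).source) :
    pullback θ G =ᶠ[𝓝 z₀] fun z ↦
      (chartRep θ x₀ ((chartAt (EuclideanSpace ℝ (Fin n)) x₀ ∘ G) z)).compContinuousLinearMap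
        (fderiv ℝ (chartAt (EuclideanSpace ℝ (Fin n)) x₀ ∘ G) z) := by
  set ψ := chartAt (EuclideanSpace ℝ (Fin n)) x₀ with hψ
  have hcont : ContinuousOn G U := hG.continuousOn
  have hopen : IsOpen (U ∩ G ⁻¹' ψ.source) := hcont.isOpen_inter_preimage hU ψ.open_source
  filter_upwards [hopen.mem_nhds ⟨hz₀, hx₀⟩] with z hz
  have hG' : G =ᶠ[𝓝 z] ψ.symm ∘ (ψ ∘ G) := by
    filter_upwards [hopen.mem_nhds hz] with y hy
    exact (ψ.left_inv hy.2).symm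
  rw [pullback_congr_of_eventuallyEq θ hG', chartRep_eq_pullback]
  refine pullback_comp θ ?_ ((contDiffAt_chart_comp hU hG x₀ hz.1 hz.2).differentiableAt (by simp))
  exact mdifferentiableAt_atlas_symm (I := 𝓡 n) (chart_mem_atlas _ x₀) (ψ.map_source hz.2)

variable (θ : DiffForm n k M) {G : E → M} {U : Set E}

theorem differentiableAt_pullback (hU : IsOpen U) (hG : ContMDiffOn 𝓘(ℝ, E) (𝓡 n) ∞ G U) {z : E}
    (hz : z ∈ U) : DifferentiableAt ℝ (pullback θ.toFun G) z := by
  have hx : G z ∈ (chartAt (EuclideanSpace ℝ (Fin n)) (G z)).source := mem_chart_source _ _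
  have hψ := contDiffAt_chart_comp hU hG (G z) hz hx
  refine DifferentiableAt.congr_of_eventuallyEq ?_ (pullback_eventuallyEq θ.toFun hU hG _ hz hx)
  refine DifferentiableAt.continuousAlternatingMapCompContinuousLinearMap ?_ ?_
  · exact ((θ.contDiffAt_chartRep (G z) ((chartAt _ _).map_source hx)).comp z hψ).differentiableAt
      (by simp)
  · exact (hψ.fderiv_right (m := ∞) (by simp)).differentiableAt (by simp)

theorem contDiffAt_pullback_apply (hU : IsOpen U) (hG : ContMDiffOn 𝓘(ℝ, E) (𝓡 n) ∞ G U) {z : E}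
    (hz : z ∈ U) (v : Fin k → E) : ContDiffAt ℝ ∞ (fun y ↦ pullback θ.toFun G y v) z := by
  have hx : G z ∈ (chartAt (EuclideanSpace ℝ (Fin n)) (G z)).source := mem_chart_source _ _
  have hψ := contDiffAt_chart_comp hU hG (G z) hz hx
  refine (contDiffAt_alternating_apply
    ((θ.contDiffAt_chartRep (G z) ((chartAt _ _).map_source hx)).comp z hψ)
    (hψ.fderiv_right (m := ∞) (by simp)) v).congr_of_eventuallyEq ?_
  filter_upwards [pullback_eventuallyEq θ.toFun hU hG _ hz hx] with y hy
  rw [hy]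
  rfl

theorem extDeriv_pullback_eq_zero (hθ : θ.IsClosed) (hU : IsOpen U)
    (hG : ContMDiffOn 𝓘(ℝ, E) (𝓡 n) ∞ G U) {z : E} (hz : z ∈ U) :
    extDeriv (pullback θ.toFun G) z = 0 := by
  have hx : G z ∈ (chartAt (EuclideanSpace ℝ (Fin n)) (G z)).source := mem_chart_source _ _
  have hψ := contDiffAt_chart_comp hU hG (G z) hz hx
  have hy := (chartAt (EuclideanSpace ℝ (Fin n)) (G z)).map_source hx
  rw [(pullback_eventuallyEq θ.toFun hU hG _ hz hx).extDeriv_eq,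
    extDeriv_pullback (r := ∞) (f := chartAt (EuclideanSpace ℝ (Fin n)) (G z) ∘ G)
      ((θ.contDiffAt_chartRep (G z) hy).differentiableAt (by simp)) hψ
      (by
        rw [minSmoothness_of_isRCLikeNormedField]
        exact WithTop.coe_le_coe.2 le_top)]
  rw [show extDeriv (chartRep θ.toFun (G z))
    ((chartAt (EuclideanSpace ℝ (Fin n)) (G z) ∘ G) z) = 0 from hθ (G z) _ hy]
  rfl

/-- A smooth metric, evaluated on the images of two fixed vectors under the derivative of a smooth
map from a normed space, is a smooth function. -/
theorem contDiffAt_metric_mfderiv (g : Metric n M) (hU : IsOpen U)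
    (hG : ContMDiffOn 𝓘(ℝ, E) (𝓡 n) ∞ G U) {z : E} (hz : z ∈ U) (a b : E) :
    ContDiffAt ℝ ∞ (fun y ↦ g.inner (G y) (mfderiv 𝓘(ℝ, E) (𝓡 n) G y a)
      (mfderiv 𝓘(ℝ, E) (𝓡 n) G y b)) z := by
  have hvec : ∀ c : E, ContMDiffOn 𝓘(ℝ, E) (𝓡 n).tangent ∞
      (fun y ↦ (TotalSpace.mk' (EuclideanSpace ℝ (Fin n)) (G y)
        (mfderiv 𝓘(ℝ, E) (𝓡 n) G y c) : TangentBundle (𝓡 n) M)) U := by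
    intro c
    have h1 := hG.contMDiffOn_tangentMapWithin (m := ∞) (by simp) hU.uniqueMDiffOn
    have h2 : ContMDiff 𝓘(ℝ, E) 𝓘(ℝ, E).tangent ∞
        (fun y : E ↦ (⟨y, c⟩ : TangentBundle 𝓘(ℝ, E) E)) :=
      (contMDiff_vectorSpace_iff_contDiff (V := fun y : E ↦ (c : TangentSpace 𝓘(ℝ, E) y))).2
        contDiff_const
    refine (h1.comp h2.contMDiffOn (fun y hy ↦ hy)).congr fun y hy ↦ ?_
    have := tangentMapWithin_eq_tangentMap (p := (⟨y, c⟩ : TangentBundle 𝓘(ℝ, E) E))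
      (hU.uniqueMDiffOn y hy) (mdifferentiableAt_of_contMDiffOn hU hG hy)
    exact this.symm
  have hg := g.contMDiff.comp_contMDiffOn hG
  have h := ContMDiffOn.clm_bundle_apply₂ (F₁ := EuclideanSpace ℝ (Fin n))
    (F₂ := EuclideanSpace ℝ (Fin n)) (F₃ := ℝ) (E₃ := Bundle.Trivial M ℝ)
    (ψ := fun y ↦ g.inner (G y)) hg (hvec a) (hvec b)
  rw [← contMDiffAt_iff_contDiffAt]
  have h' := (h.contMDiffAt (hU.mem_nhds hz))
  rw [Bundle.contMDiffAt_totalSpace] at h'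
  exact h'.2

end Pullback

/-! ### Closed forms and homotopies in a normed space -/

section CompactlySupported

variable {E : Type*} [NormedAddCommGroup E] [NormedSpace ℝ E] [FiniteDimensional ℝ E]
  [MeasurableSpace E] [BorelSpace E] (μ : Measure E) [μ.IsAddHaarMeasure]

/-- The integral of a directional derivative of a compactly supported function vanishes. The
function is only assumed to be smooth near the compact set `C`, and to vanish there outside `C`. -/
theorem setIntegral_fderiv_eq_zero {C V : Set E} (hC : IsCompact C) (hV : IsOpen V) (hCV : C ⊆ V)
    {b : E → ℝ} (hb : ∀ y ∈ V, ContDiffAt ℝ 1 b y) (hb0 : ∀ y ∈ V, y ∉ C → b y = 0) (v : E) :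
    ∫ y in C, fderiv ℝ b y v ∂μ = 0 := by
  set b' : E → ℝ := C.indicator b with hb'
  have hV' : ∀ y ∈ V, b' =ᶠ[𝓝 y] b := by
    intro y hy
    filter_upwards [hV.mem_nhds hy] with x hx
    by_cases hxC : x ∈ C
    · simp [hb', hxC]
    · simp [hb', hxC, hb0 x hx hxC]
  have hC' : ∀ y, y ∉ C → b' =ᶠ[𝓝 y] fun _ ↦ 0 := by
    intro y hy
    filter_upwards [hC.isClosed.isOpen_compl.mem_nhds hy] with x hx
    simp [hb', notMem_of_mem_compl hx]
  have hsm : ContDiff ℝ 1 b' := by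
    rw [contDiff_iff_contDiffAt]
    intro y
    by_cases hy : y ∈ C
    · exact (hb y (hCV hy)).congr_of_eventuallyEq (hV' y (hCV hy))
    · exact contDiffAt_const.congr_of_eventuallyEq (hC' y hy)
  have hsupp : HasCompactSupport b' :=
    HasCompactSupport.intro hC fun x hx ↦ by simp [hb', hx]
  have hcd : Continuous fun y ↦ fderiv ℝ b' y v :=
    (hsm.continuous_fderiv (by simp)).clm_apply continuous_const
  have hint : Integrable (fun y ↦ fderiv ℝ b' y v) μ :=
    hcd.integrable_of_hasCompactSupport (hsupp.fderiv_apply (𝕜 := ℝ) v)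
  have h0 := integral_mul_fderiv_eq_neg_fderiv_mul_of_integrable (μ := μ) (f := fun _ : E ↦ (1 : ℝ))
    (g := b') (v := v) (by simp) (by simpa using hint)
    (by simpa using hsm.continuous.integrable_of_hasCompactSupport hsupp)
    (fun x _ ↦ differentiableAt_const _) (fun x _ ↦ (hsm.differentiable (by simp)) x)
  simp only [one_mul, fderiv_fun_const, Pi.zero_apply, zero_apply, zero_mul,
    integral_zero, neg_zero] at h0
  rw [← h0, ← integral_indicator hC.measurableSet]
  refine integral_congr_ae (Filter.Eventually.of_forall fun y ↦ ?_)
  by_cases hy : y ∈ C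
  · simp only [hy, indicator_of_mem]
    rw [(hV' y (hCV hy)).fderiv_eq]
  · simp only [hy, not_false_eq_true, indicator_of_notMem]
    rw [(hC' y hy).fderiv_eq]
    simp

/-- Homotopy invariance of the integral of a closed form: `θ` is a closed `k`-form near `C × [0, 1]`
whose contraction with the direction of the second factor vanishes outside the compact set `C`. Then
the integrals over the two ends agree. Closedness writes the derivative in the second variable as a
sum of derivatives of compactly supported functions. -/
theorem setIntegral_eq_of_closed_homotopy {k : ℕ} (e : Fin k → E) {Ω : Set (E × ℝ)}
    (hΩ : IsOpen Ω) {C : Set E} (hC : IsCompact C) (hCΩ : C ×ˢ Icc (0 : ℝ) 1 ⊆ Ω)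
    {θ : E × ℝ → (E × ℝ) [⋀^Fin k]→L[ℝ] ℝ} (hd : ∀ z ∈ Ω, DifferentiableAt ℝ θ z)
    (hs : ∀ v, ∀ z ∈ Ω, ContDiffAt ℝ 1 (fun z ↦ θ z v) z) (hcl : ∀ z ∈ Ω, extDeriv θ z = 0)
    (h0 : ∀ z ∈ Ω, z.1 ∉ C → ∀ v, (∃ i, v i = (0, 1)) → θ z v = 0) :
    ∫ y in C, θ (y, 1) (fun i ↦ (e i, 0)) ∂μ = ∫ y in C, θ (y, 0) (fun i ↦ (e i, 0)) ∂μ := by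
  set w : Fin (k + 1) → E × ℝ := Fin.cons (0, 1) (fun i ↦ (e i, 0)) with hw
  -- the coefficients of `θ` on the faces of the frame `w`
  set a : E × ℝ → ℝ := fun z ↦ θ z (fun i ↦ (e i, 0)) with ha
  set b : Fin k → E × ℝ → ℝ := fun i z ↦ θ z (i.succ.removeNth w) with hb
  have hcont : ∀ (f : E × ℝ → ℝ) (u : E × ℝ), (∀ z ∈ Ω, ContDiffAt ℝ 1 f z) →
      ContinuousOn (fun z ↦ fderiv ℝ f z u) Ω := by
    intro f u hf z hz
    have := ((hf z hz).fderiv_right (m := 0) (by simp)).continuousAt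
    exact (this.clm_apply continuousAt_const).continuousWithinAt
  -- the equation `dθ = 0` on the frame `w`, solved for the derivative in the second variable
  have hclosed : ∀ z ∈ Ω, fderiv ℝ a z (0, 1) =
      ∑ i : Fin k, (-1 : ℝ) ^ (i : ℕ) * fderiv ℝ (b i) z (e i, 0) := by
    intro z hz
    have h := extDeriv_apply (hd z hz) w
    rw [hcl z hz, Fin.sum_univ_succ] at h
    have h1 : Fin.removeNth 0 w = fun i ↦ (e i, (0 : ℝ)) := by
      funext i; simp [hw, Fin.removeNth]
    simp only [Fin.val_zero, pow_zero, one_smul, h1,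
      Fin.val_succ, pow_succ] at h
    have h2 : w 0 = (0, 1) := rfl
    have h3 : ∀ i : Fin k, w i.succ = (e i, 0) := fun i ↦ rfl
    simp only [h2, h3] at h
    have h4 := eq_neg_of_add_eq_zero_left h.symm
    rw [ha, h4, ← Finset.sum_neg_distrib]
    refine Finset.sum_congr rfl fun i _ ↦ ?_
    simp [hb]
  have hline : ∀ y ∈ C, ∀ s ∈ Icc (0 : ℝ) 1, HasDerivAt (fun s ↦ a (y, s))
      (fderiv ℝ a (y, s) (0, 1)) s := by
    intro y hy s hs'
    have h1 : HasFDerivAt a (fderiv ℝ a (y, s)) (y, s) :=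
      ((hs _ _ (hCΩ ⟨hy, hs'⟩)).differentiableAt (by simp)).hasFDerivAt
    exact h1.comp_hasDerivAt s ((hasDerivAt_const s y).prodMk (hasDerivAt_id s))
  have hslice : ∀ y ∈ C, ∀ f : E × ℝ → ℝ, ContinuousOn f Ω →
      IntervalIntegrable (fun s ↦ f (y, s)) volume 0 1 := by
    intro y hy f hf
    refine ContinuousOn.intervalIntegrable ?_
    rw [uIcc_of_le zero_le_one]
    exact hf.comp (by fun_prop) fun s hs' ↦ hCΩ ⟨hy, hs'⟩
  have hftc : ∀ y ∈ C, a (y, 1) - a (y, 0) =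
      ∑ i : Fin k, (-1 : ℝ) ^ (i : ℕ) * ∫ s in Ioc (0 : ℝ) 1, fderiv ℝ (b i) (y, s) (e i, 0) := by
    intro y hy
    rw [← intervalIntegral.integral_eq_sub_of_hasDerivAt (f := fun s ↦ a (y, s))
      (f' := fun s ↦ fderiv ℝ a (y, s) (0, 1))
      (fun s hs' ↦ hline y hy s (by rwa [uIcc_of_le zero_le_one] at hs'))
      (hslice y hy _ (hcont a _ (hs _)))]
    rw [intervalIntegral.integral_congr (g := fun s ↦
      ∑ i : Fin k, (-1 : ℝ) ^ (i : ℕ) * fderiv ℝ (b i) (y, s) (e i, 0))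
      (fun s hs' ↦ hclosed _ (hCΩ ⟨hy, by rwa [uIcc_of_le zero_le_one] at hs'⟩)),
      intervalIntegral.integral_finsetSum fun i _ ↦
        (hslice y hy _ (hcont (b i) (e i, 0) (hs _))).const_mul _]
    refine Finset.sum_congr rfl fun i _ ↦ ?_
    rw [intervalIntegral.integral_const_mul, intervalIntegral.integral_of_le zero_le_one]
  have hint : ∀ s ∈ Icc (0 : ℝ) 1, IntegrableOn (fun y ↦ a (y, s)) C μ := by
    intro s hs'
    refine ContinuousOn.integrableOn_compact hC fun y hy ↦ ?_
    exact ((hs _ _ (hCΩ ⟨hy, hs'⟩)).continuousAt.comp (f := fun y ↦ (y, s))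
      (by fun_prop)).continuousWithinAt
  have hprod : ∀ i : Fin k, Integrable
      (Function.uncurry fun y s ↦ fderiv ℝ (b i) (y, s) (e i, 0))
      ((μ.restrict C).prod (volume.restrict (Ioc (0 : ℝ) 1))) := by
    intro i
    rw [Measure.prod_restrict]
    refine IntegrableOn.mono_set ?_ (prod_mono_right Ioc_subset_Icc_self)
    exact ((hcont (b i) (e i, 0) (hs _)).mono hCΩ).integrableOn_compact (hC.prod isCompact_Icc)
  -- the face of `w` opposite to `e i` contains the direction `(0, 1)`, so its coefficient is
  -- compactly supported
  have hvanish : ∀ i : Fin k, ∫ y in C, (∫ s in Ioc (0 : ℝ) 1, fderiv ℝ (b i) (y, s) (e i, 0)) ∂μ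
      = 0 := by
    intro i
    rw [integral_integral_swap (hprod i)]
    refine setIntegral_eq_zero_of_forall_eq_zero fun s hs' ↦ ?_
    have hsI : s ∈ Icc (0 : ℝ) 1 := Ioc_subset_Icc_self hs'
    have hVo : IsOpen {y : E | (y, s) ∈ Ω} := hΩ.preimage (by fun_prop)
    have hsub : C ⊆ {y : E | (y, s) ∈ Ω} := fun y hy ↦ hCΩ ⟨hy, hsI⟩
    refine Eq.trans ?_ (setIntegral_fderiv_eq_zero μ hC hVo hsub (b := fun y ↦ b i (y, s))
      (fun y hy ↦ (hs _ (y, s) hy).comp y (contDiffAt_id.prodMk contDiffAt_const))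
      (fun y hy hyC ↦ h0 _ hy hyC _ ?_) (e i))
    · refine setIntegral_congr_fun hC.measurableSet fun y hy ↦ ?_
      have h1 : HasFDerivAt (b i) (fderiv ℝ (b i) (y, s)) (y, s) :=
        ((hs _ _ (hsub hy)).differentiableAt (by simp)).hasFDerivAt
      have h2 := h1.comp y ((hasFDerivAt_id (𝕜 := ℝ) y).prodMk (hasFDerivAt_const s y))
      have h3 := h2.fderiv
      simp only [Function.comp_def, id] at h3
      simp only [h3]
      simp
    · refine ⟨⟨0, i.pos⟩, ?_⟩
      have : i.succ.succAbove ⟨0, i.pos⟩ = 0 := by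
        rw [Fin.succAbove_of_castSucc_lt _ _ (by simp [Fin.lt_def])]
        rfl
      simp [Fin.removeNth, this, hw]
  have hone : (1 : ℝ) ∈ Icc (0 : ℝ) 1 := by simp
  have hzero : (0 : ℝ) ∈ Icc (0 : ℝ) 1 := by simp
  rw [← sub_eq_zero, ← integral_sub (hint 1 hone) (hint 0 hzero),
    setIntegral_congr_fun hC.measurableSet hftc, integral_finsetSum]
  · refine Finset.sum_eq_zero fun i _ ↦ ?_
    rw [integral_const_mul, hvanish i, mul_zero]
  · intro i _
    exact ((hprod i).integral_prod_left).const_mul _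

end CompactlySupported

/-! ### The ordered simplex -/

section OrderedSimplex

variable {j : ℕ}

/-- The differences of consecutive terms of the sequence `c, t₀, …, t_{j-1}, 0`. For `c = 1` these
are the barycentric coordinates of the point `t` of the ordered simplex. -/
def steps (c : ℝ) (t : Fin j → ℝ) (m : Fin (j + 1)) : ℝ :=
  (Fin.cons c t : Fin (j + 1) → ℝ) m - (Fin.snoc t 0 : Fin (j + 1) → ℝ) m

/-- The partial sums from the end, inverse to `steps`. -/
def tailSum (y : Fin (j + 1) → ℝ) (i : Fin j) : ℝ := ∑ m, if i.castSucc < m then y m else 0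

/-- The ordered simplex `{1 ≥ t₀ ≥ … ≥ t_{j-1} ≥ 0}`. It parametrizes the standard simplex in such
a way that the standard basis vectors are the edges joining consecutive vertices. -/
def orderedSimplex (j : ℕ) : Set (Fin j → ℝ) := {t | ∀ m, 0 ≤ steps 1 t m}

theorem steps_eq (c : ℝ) (t : Fin j → ℝ) :
    steps c t = c • steps 1 (0 : Fin j → ℝ) + steps 0 t := by
  funext m
  have h : steps (1 : ℝ) (0 : Fin j → ℝ) m = if m = 0 then 1 else 0 := by
    unfold steps
    have h1 : (Fin.snoc (0 : Fin j → ℝ) 0 : Fin (j + 1) → ℝ) m = 0 := by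
      refine Fin.lastCases ?_ (fun i ↦ ?_) m <;> simp
    rw [h1]
    refine Fin.cases ?_ (fun i ↦ ?_) m <;> simp
  simp only [Pi.add_apply, Pi.smul_apply, h]
  unfold steps
  refine Fin.cases ?_ (fun i ↦ ?_) m <;> simp [sub_eq_add_neg]

theorem sum_steps (c : ℝ) (t : Fin j → ℝ) : ∑ m, steps c t m = c := by
  simp only [steps, Finset.sum_sub_distrib]
  rw [Fin.sum_univ_succ, Fin.sum_univ_castSucc (fun m ↦ (Fin.snoc t 0 : Fin (j + 1) → ℝ) m)]
  simp

theorem tailSum_steps (c : ℝ) (t : Fin j → ℝ) : tailSum (steps c t) = t := by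
  funext i
  have : ∀ m, (if i.castSucc < m then steps c t m else 0) =
      (if i.castSucc < m then (Fin.cons c t : Fin (j + 1) → ℝ) m else 0) -
      (if i.castSucc < m then (Fin.snoc t 0 : Fin (j + 1) → ℝ) m else 0) := by
    intro m
    split_ifs <;> simp [steps]
  simp only [tailSum, this, Finset.sum_sub_distrib]
  rw [Fin.sum_univ_succ, Fin.sum_univ_castSucc (fun m ↦ if i.castSucc < m then
    (Fin.snoc t 0 : Fin (j + 1) → ℝ) m else 0)]
  simp only [Fin.cons_succ, Fin.snoc_castSucc, Fin.snoc_last, ite_self, add_zero, Fin.cons_zero,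
    Fin.not_lt_zero, if_false, zero_add, Fin.castSucc_lt_succ_iff, Fin.castSucc_lt_castSucc_iff,
    ← Finset.sum_sub_distrib]
  rw [Finset.sum_eq_single i]
  · simp
  · intro b _ hb
    by_cases h : i < b
    · simp [h, h.le]
    · have h' : ¬ i ≤ b := fun hle ↦ h (lt_of_le_of_ne hle (Ne.symm hb))
      simp [h, h']
  · simp

theorem steps_tailSum (y : Fin (j + 1) → ℝ) (c : ℝ) (hy : ∑ m, y m = c) :
    steps c (tailSum y) = y := by
  funext m
  have h1 : (Fin.cons c (tailSum y) : Fin (j + 1) → ℝ) m = ∑ m', if m ≤ m' then y m' else 0 := by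
    refine Fin.cases ?_ (fun i ↦ ?_) m
    · simp [hy]
    · simp only [Fin.cons_succ, tailSum]
      refine Finset.sum_congr rfl fun m' _ ↦ ?_
      simp only [← Fin.castSucc_lt_iff_succ_le]
  have h2 : (Fin.snoc (tailSum y) 0 : Fin (j + 1) → ℝ) m = ∑ m', if m < m' then y m' else 0 := by
    refine Fin.lastCases ?_ (fun i ↦ ?_) m
    · simp [(Fin.le_last _).not_gt]
    · simp [tailSum]
  rw [steps, h1, h2, ← Finset.sum_sub_distrib, Finset.sum_eq_single m]
  · simp
  · intro b _ hb
    by_cases h : m < b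
    · simp [h, h.le]
    · have h' : ¬ m ≤ b := fun hle ↦ h (lt_of_le_of_ne hle (Ne.symm hb))
      simp [h, h']
  · simp

theorem cons_insertNth_succAbove (c s : ℝ) (p : Fin (j + 1)) (t : Fin j → ℝ) (l : Fin (j + 1)) :
    (Fin.cons c (p.insertNth s t : Fin (j + 1) → ℝ) : Fin (j + 2) → ℝ) (p.succ.succAbove l) =
      (Fin.cons c t : Fin (j + 1) → ℝ) l := by
  refine Fin.cases ?_ (fun l ↦ ?_) l
  · rw [Fin.succ_succAbove_zero]
    simp
  · rw [Fin.succ_succAbove_succ, Fin.cons_succ, Fin.cons_succ]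
    exact Fin.insertNth_apply_succAbove (α := fun _ ↦ ℝ) p s t l

theorem snoc_insertNth_succAbove (s : ℝ) (p : Fin (j + 1)) (t : Fin j → ℝ) (l : Fin (j + 1)) :
    (Fin.snoc (p.insertNth s t : Fin (j + 1) → ℝ) 0 : Fin (j + 2) → ℝ) (p.castSucc.succAbove l) =
      (Fin.snoc t 0 : Fin (j + 1) → ℝ) l := by
  refine Fin.lastCases ?_ (fun l ↦ ?_) l
  · rw [Fin.succAbove_ne_last_last (Fin.castSucc_lt_last p).ne]
    simp
  · rw [Fin.castSucc_succAbove_castSucc, Fin.snoc_castSucc, Fin.snoc_castSucc]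
    exact Fin.insertNth_apply_succAbove (α := fun _ ↦ ℝ) p s t l

theorem castSucc_succAbove_eq_of_ne {p l : Fin j} (hl : l ≠ p) :
    p.castSucc.succAbove l = p.succ.succAbove l := by
  have : (l : ℕ) ≠ p := fun h ↦ hl (Fin.ext h)
  ext
  simp only [Fin.succAbove, Fin.lt_def, Fin.val_castSucc, Fin.val_succ]
  split_ifs <;> simp <;> omega

theorem steps_insertNth_apply_castSucc (c s : ℝ) (p : Fin (j + 1)) (t : Fin j → ℝ) :
    steps c (p.insertNth s t) p.castSucc = (Fin.cons c t : Fin (j + 1) → ℝ) p - s := by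
  have h := cons_insertNth_succAbove c s p t p
  rw [Fin.succAbove_succ_self] at h
  rw [steps, h, Fin.snoc_castSucc, Fin.insertNth_apply_same]

theorem steps_insertNth_apply_succ (c s : ℝ) (p : Fin (j + 1)) (t : Fin j → ℝ) :
    steps c (p.insertNth s t) p.succ = s - (Fin.snoc t 0 : Fin (j + 1) → ℝ) p := by
  have h := snoc_insertNth_succAbove s p t p
  rw [Fin.succAbove_castSucc_self] at h
  rw [steps, h, Fin.cons_succ, Fin.insertNth_apply_same]

theorem steps_insertNth_apply_of_ne (c s : ℝ) (p : Fin (j + 1)) (t : Fin j → ℝ)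
    {l : Fin (j + 1)} (hl : l ≠ p) :
    steps c (p.insertNth s t) (p.castSucc.succAbove l) = steps c t l := by
  rw [steps, snoc_insertNth_succAbove, castSucc_succAbove_eq_of_ne hl, cons_insertNth_succAbove,
    steps]

/-- Inserting the preceding term of the sequence at position `p` gives the face opposite to the
vertex `p`. -/
theorem steps_insertNth_cons (c : ℝ) (p : Fin (j + 1)) (t : Fin j → ℝ) :
    steps c (p.insertNth ((Fin.cons c t : Fin (j + 1) → ℝ) p) t) =
      p.castSucc.insertNth 0 (steps c t) := by
  refine Fin.eq_insertNth_iff.2 ⟨?_, funext fun l ↦ ?_⟩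
  · rw [steps_insertNth_apply_castSucc, sub_self]
  · by_cases hl : l = p
    · subst hl
      simp only [Fin.removeNth]
      rw [Fin.succAbove_castSucc_self, steps_insertNth_apply_succ, steps]
    · simp only [Fin.removeNth]
      rw [steps_insertNth_apply_of_ne _ _ _ _ hl]

/-- Inserting the following term of the sequence at position `p` gives the face opposite to the
vertex `p + 1`. -/
theorem steps_insertNth_snoc (c : ℝ) (p : Fin (j + 1)) (t : Fin j → ℝ) :
    steps c (p.insertNth ((Fin.snoc t 0 : Fin (j + 1) → ℝ) p) t) =
      p.succ.insertNth 0 (steps c t) := by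
  refine Fin.eq_insertNth_iff.2 ⟨?_, funext fun l ↦ ?_⟩
  · rw [steps_insertNth_apply_succ, sub_self]
  · by_cases hl : l = p
    · subst hl
      simp only [Fin.removeNth]
      rw [Fin.succAbove_succ_self, steps_insertNth_apply_castSucc, steps]
    · simp only [Fin.removeNth]
      rw [← castSucc_succAbove_eq_of_ne hl, steps_insertNth_apply_of_ne _ _ _ _ hl]

theorem insertNth_mem_orderedSimplex_iff (s : ℝ) (p : Fin (j + 1)) (t : Fin j → ℝ) :
    (p.insertNth s t : Fin (j + 1) → ℝ) ∈ orderedSimplex (j + 1) ↔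
      t ∈ orderedSimplex j ∧
        s ∈ Icc ((Fin.snoc t 0 : Fin (j + 1) → ℝ) p) ((Fin.cons 1 t : Fin (j + 1) → ℝ) p) := by
  constructor
  · intro h
    have h1 := h p.castSucc
    have h2 := h p.succ
    rw [steps_insertNth_apply_castSucc] at h1
    rw [steps_insertNth_apply_succ] at h2
    refine ⟨fun l ↦ ?_, by linarith, by linarith⟩
    by_cases hl : l = p
    · subst hl
      rw [steps]
      linarith
    · rw [← steps_insertNth_apply_of_ne 1 s p t hl]
      exact h _
  · rintro ⟨ht, h1, h2⟩ m
    rcases Fin.eq_self_or_eq_succAbove p.castSucc m with rfl | ⟨l, rfl⟩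
    · rw [steps_insertNth_apply_castSucc]
      linarith
    · by_cases hl : l = p
      · subst hl
        rw [Fin.succAbove_castSucc_self, steps_insertNth_apply_succ]
        linarith
      · rw [steps_insertNth_apply_of_ne _ _ _ _ hl]
        exact ht l

theorem continuous_steps (c : ℝ) : Continuous (steps c : (Fin j → ℝ) → _) := by
  refine continuous_pi fun m ↦ ?_
  unfold steps
  refine Continuous.sub ?_ ?_
  · refine Fin.cases ?_ (fun i ↦ ?_) m
    · simpa using continuous_const
    · simpa using continuous_apply i
  · refine Fin.lastCases ?_ (fun i ↦ ?_) m
    · simpa using continuous_const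
    · simpa using continuous_apply i

theorem continuous_tailSum : Continuous (tailSum : (Fin (j + 1) → ℝ) → _) := by
  refine continuous_pi fun i ↦ ?_
  unfold tailSum
  refine continuous_finsetSum _ fun m _ ↦ ?_
  split_ifs
  · exact continuous_apply m
  · exact continuous_const

theorem steps_mem_stdSimplex {t : Fin j → ℝ} (ht : t ∈ orderedSimplex j) :
    steps 1 t ∈ stdSimplex ℝ (Fin (j + 1)) := ⟨ht, sum_steps 1 t⟩

theorem orderedSimplex_eq_image :
    orderedSimplex j = tailSum '' stdSimplex ℝ (Fin (j + 1)) := by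
  ext t
  constructor
  · exact fun ht ↦ ⟨_, steps_mem_stdSimplex ht, tailSum_steps 1 t⟩
  · rintro ⟨y, hy, rfl⟩ m
    rw [steps_tailSum y 1 hy.2]
    exact hy.1 m

theorem isCompact_orderedSimplex : IsCompact (orderedSimplex j) := by
  rw [orderedSimplex_eq_image]
  exact (isCompact_stdSimplex ℝ (Fin (j + 1))).image continuous_tailSum

theorem measurableSet_orderedSimplex : MeasurableSet (orderedSimplex j) :=
  isCompact_orderedSimplex.isClosed.measurableSet

theorem convex_orderedSimplex : Convex ℝ (orderedSimplex j) := by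
  intro s hs t ht a b ha hb hab m
  have : steps 1 (a • s + b • t) m = a * steps 1 s m + b * steps 1 t m := by
    unfold steps
    refine Fin.cases ?_ (fun i ↦ ?_) m
    · rcases j with - | j
      · simp [Fin.snoc, hab]
      · have : ∀ u : Fin (j + 1) → ℝ, (Fin.snoc u 0 : Fin (j + 2) → ℝ) 0 = u 0 := fun u ↦
          Fin.snoc_castSucc (α := fun _ ↦ ℝ) 0 u 0
        simp only [Fin.cons_zero, this, Pi.add_apply, Pi.smul_apply, smul_eq_mul]
        linear_combination -hab
    · have : ∀ m : Fin (j + 1), (Fin.snoc (a • s + b • t) 0 : Fin (j + 1) → ℝ) m =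
          a * (Fin.snoc s 0 : Fin (j + 1) → ℝ) m + b * (Fin.snoc t 0 : Fin (j + 1) → ℝ) m := by
        intro m
        refine Fin.lastCases ?_ (fun i ↦ ?_) m <;> simp
      simp only [Fin.cons_succ, this, Pi.add_apply, Pi.smul_apply, smul_eq_mul]
      ring
  rw [this]
  exact add_nonneg (mul_nonneg ha (hs m)) (mul_nonneg hb (ht m))

end OrderedSimplex

/-! ### Stokes' theorem on the ordered simplex -/

section OrderedSimplexStokes

variable {j : ℕ}

/-- Fubini's theorem for the ordered simplex, integrating the coordinate `p` first. -/
theorem setIntegral_orderedSimplex_succ (p : Fin (j + 1)) {f : (Fin (j + 1) → ℝ) → ℝ}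
    (hf : IntegrableOn f (orderedSimplex (j + 1))) :
    ∫ x in orderedSimplex (j + 1), f x =
      ∫ t in orderedSimplex j, ∫ s in
        Icc ((Fin.snoc t 0 : Fin (j + 1) → ℝ) p) ((Fin.cons 1 t : Fin (j + 1) → ℝ) p),
          f (p.insertNth s t) := by
  have hmp := (volume_preserving_piFinSuccAbove (fun _ : Fin (j + 1) ↦ ℝ) p).symm
  have hf' : Integrable ((orderedSimplex (j + 1)).indicator f) :=
    hf.integrable_indicator measurableSet_orderedSimplex
  rw [← integral_indicator measurableSet_orderedSimplex,
    ← integral_indicator measurableSet_orderedSimplex,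
    ← hmp.integral_comp (MeasurableEquiv.measurableEmbedding _)]
  rw [Measure.volume_eq_prod]
  refine (integral_prod_symm _
    ((hmp.integrable_comp_emb (MeasurableEquiv.measurableEmbedding _)).2 hf')).trans ?_
  simp only [Function.comp_apply]
  refine integral_congr_ae (Filter.Eventually.of_forall fun t ↦ ?_)
  have hsymm : ∀ s, (MeasurableEquiv.piFinSuccAbove (fun _ : Fin (j + 1) ↦ ℝ) p).symm (s, t) =
      p.insertNth s t := fun s ↦ rfl
  simp only [hsymm]
  by_cases ht : t ∈ orderedSimplex j
  · rw [indicator_of_mem ht, ← integral_indicator measurableSet_Icc]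
    refine integral_congr_ae (Filter.Eventually.of_forall fun s ↦ ?_)
    beta_reduce
    by_cases hs : s ∈ Icc ((Fin.snoc t 0 : Fin (j + 1) → ℝ) p) ((Fin.cons 1 t : Fin (j + 1) → ℝ) p)
    · rw [indicator_of_mem hs,
        indicator_of_mem ((insertNth_mem_orderedSimplex_iff s p t).2 ⟨ht, hs⟩)]
    · rw [indicator_of_notMem hs, indicator_of_notMem
        fun h ↦ hs ((insertNth_mem_orderedSimplex_iff s p t).1 h).2]
  · rw [indicator_of_notMem ht]
    simp only [indicator_of_notMem
      (fun h ↦ ht ((insertNth_mem_orderedSimplex_iff _ p t).1 h).1), integral_zero]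

theorem hasDerivAt_insertNth (p : Fin (j + 1)) (t : Fin j → ℝ) (s : ℝ) :
    HasDerivAt (fun s ↦ (p.insertNth s t : Fin (j + 1) → ℝ)) (Pi.single p 1) s := by
  rw [hasDerivAt_pi]
  intro m
  rcases Fin.eq_self_or_eq_succAbove p m with rfl | ⟨l, rfl⟩
  · simpa using hasDerivAt_id' s
  · simpa using hasDerivAt_const s (t l)

/-- The `i`-th face of the ordered simplex. -/
def faceMap (i : Fin (j + 2)) (t : Fin j → ℝ) : Fin (j + 1) → ℝ :=
  tailSum (i.insertNth 0 (steps 1 t))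

theorem tailSum_insertNth_add (i : Fin (j + 2)) (a b : Fin (j + 1) → ℝ) :
    tailSum (i.insertNth 0 (a + b)) = tailSum (i.insertNth 0 a) + tailSum (i.insertNth 0 b) := by
  have h : (i.insertNth 0 (a + b) : Fin (j + 2) → ℝ) = i.insertNth 0 a + i.insertNth 0 b := by
    refine (Fin.eq_insertNth_iff.2 ⟨by simp, funext fun l ↦ by simp [Fin.removeNth]⟩).symm
  rw [h]
  funext l
  simp only [tailSum, Pi.add_apply, ← Finset.sum_add_distrib]
  refine Finset.sum_congr rfl fun m _ ↦ ?_
  split_ifs <;> simp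

/-- The linear part of `faceMap`. -/
def faceLin (i : Fin (j + 2)) : (Fin j → ℝ) →ₗ[ℝ] (Fin (j + 1) → ℝ) where
  toFun v := tailSum (i.insertNth 0 (steps 0 v))
  map_add' v w := by
    have h1 : steps 0 (v + w) = steps 0 v + steps 0 w := by
      funext m
      simp only [steps, Pi.add_apply]
      have h2 : (Fin.cons 0 (v + w) : Fin (j + 1) → ℝ) m =
          (Fin.cons 0 v : Fin (j + 1) → ℝ) m + (Fin.cons 0 w : Fin (j + 1) → ℝ) m := by
        refine Fin.cases ?_ (fun i ↦ ?_) m <;> simp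
      have h3 : (Fin.snoc (v + w) 0 : Fin (j + 1) → ℝ) m =
          (Fin.snoc v 0 : Fin (j + 1) → ℝ) m + (Fin.snoc w 0 : Fin (j + 1) → ℝ) m := by
        refine Fin.lastCases ?_ (fun i ↦ ?_) m <;> simp
      rw [h2, h3]
      ring
    rw [h1, tailSum_insertNth_add]
  map_smul' c v := by
    have h1 : steps 0 (c • v) = c • steps 0 v := by
      funext m
      simp only [steps, Pi.smul_apply, smul_eq_mul]
      have h2 : (Fin.cons 0 (c • v) : Fin (j + 1) → ℝ) m =
          c * (Fin.cons 0 v : Fin (j + 1) → ℝ) m := by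
        refine Fin.cases ?_ (fun i ↦ ?_) m <;> simp
      have h3 : (Fin.snoc (c • v) 0 : Fin (j + 1) → ℝ) m =
          c * (Fin.snoc v 0 : Fin (j + 1) → ℝ) m := by
        refine Fin.lastCases ?_ (fun i ↦ ?_) m <;> simp
      rw [h2, h3]
      ring
    have h4 : (i.insertNth 0 (steps 0 (c • v)) : Fin (j + 2) → ℝ) =
        c • i.insertNth 0 (steps 0 v) := by
      rw [h1]
      refine (Fin.eq_insertNth_iff.2 ⟨by simp, funext fun l ↦ by simp [Fin.removeNth]⟩).symm
    rw [h4]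
    funext l
    simp [tailSum, Finset.mul_sum]

theorem steps_faceMap (i : Fin (j + 2)) (t : Fin j → ℝ) :
    steps 1 (faceMap i t) = i.insertNth 0 (steps 1 t) := by
  refine steps_tailSum _ _ ?_
  rw [Fin.sum_univ_succAbove _ i]
  simp [sum_steps]

theorem faceMap_mem {i : Fin (j + 2)} {t : Fin j → ℝ} (ht : t ∈ orderedSimplex j) :
    faceMap i t ∈ orderedSimplex (j + 1) := by
  intro m
  rw [steps_faceMap]
  rcases Fin.eq_self_or_eq_succAbove i m with rfl | ⟨l, rfl⟩
  · simp
  · simpa using ht l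

theorem faceMap_castSucc (p : Fin (j + 1)) (t : Fin j → ℝ) :
    faceMap p.castSucc t = p.insertNth ((Fin.cons 1 t : Fin (j + 1) → ℝ) p) t := by
  rw [faceMap, ← steps_insertNth_cons, tailSum_steps]

theorem faceMap_succ (p : Fin (j + 1)) (t : Fin j → ℝ) :
    faceMap p.succ t = p.insertNth ((Fin.snoc t 0 : Fin (j + 1) → ℝ) p) t := by
  rw [faceMap, ← steps_insertNth_snoc, tailSum_steps]

theorem faceLin_castSucc (p : Fin (j + 1)) (v : Fin j → ℝ) :
    faceLin p.castSucc v = p.insertNth ((Fin.cons 0 v : Fin (j + 1) → ℝ) p) v := by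
  change tailSum (p.castSucc.insertNth 0 (steps 0 v)) = _
  rw [← steps_insertNth_cons, tailSum_steps]

theorem faceLin_succ (p : Fin (j + 1)) (v : Fin j → ℝ) :
    faceLin p.succ v = p.insertNth ((Fin.snoc v 0 : Fin (j + 1) → ℝ) p) v := by
  change tailSum (p.succ.insertNth 0 (steps 0 v)) = _
  rw [← steps_insertNth_snoc, tailSum_steps]

theorem faceMap_eq_add (i : Fin (j + 2)) (t : Fin j → ℝ) :
    faceMap i t = faceMap i 0 + faceLin i t := by
  change tailSum _ = tailSum _ + tailSum _
  rw [← tailSum_insertNth_add, steps_eq 1 t, one_smul]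

theorem hasFDerivAt_faceMap (i : Fin (j + 2)) (t : Fin j → ℝ) :
    HasFDerivAt (faceMap i) (faceLin i).toContinuousLinearMap t := by
  have : (faceMap i : (Fin j → ℝ) → _) =
      fun t ↦ faceMap i 0 + (faceLin i).toContinuousLinearMap t := funext fun t ↦ faceMap_eq_add i t
  rw [this]
  exact ((faceLin i).toContinuousLinearMap.hasFDerivAt).const_add _

theorem continuous_faceMap (i : Fin (j + 2)) : Continuous (faceMap i : (Fin j → ℝ) → _) :=
  continuous_iff_continuousAt.2 fun t ↦ (hasFDerivAt_faceMap i t).continuousAt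

/-- The integral of a partial derivative over the ordered simplex is the difference of the
integrals over the two faces to which the coordinate direction is transversal. -/
theorem setIntegral_orderedSimplex_fderiv (p : Fin (j + 1)) {f : (Fin (j + 1) → ℝ) → ℝ}
    (hf : ∀ x ∈ orderedSimplex (j + 1), ContDiffAt ℝ 1 f x) :
    ∫ x in orderedSimplex (j + 1), fderiv ℝ f x (Pi.single p 1) =
      (∫ t in orderedSimplex j, f (faceMap p.castSucc t)) -
        ∫ t in orderedSimplex j, f (faceMap p.succ t) := by
  have hc : ContinuousOn (fun x ↦ fderiv ℝ f x (Pi.single p 1)) (orderedSimplex (j + 1)) := by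
    intro x hx
    have := ((hf x hx).fderiv_right (m := 0) (by simp)).continuousAt
    exact (this.clm_apply continuousAt_const).continuousWithinAt
  have hface : ∀ i : Fin (j + 2), IntegrableOn (fun t ↦ f (faceMap i t)) (orderedSimplex j) := by
    intro i
    refine ContinuousOn.integrableOn_compact isCompact_orderedSimplex fun t ht ↦ ?_
    exact ((hf _ (faceMap_mem ht)).continuousAt.comp
      (continuous_faceMap i).continuousAt).continuousWithinAt
  rw [setIntegral_orderedSimplex_succ p (hc.integrableOn_compact isCompact_orderedSimplex),
    ← integral_sub (hface _) (hface _)]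
  refine setIntegral_congr_fun measurableSet_orderedSimplex fun t ht ↦ ?_
  have hle : (Fin.snoc t 0 : Fin (j + 1) → ℝ) p ≤ (Fin.cons 1 t : Fin (j + 1) → ℝ) p := by
    have := ht p
    rw [steps] at this
    linarith
  have hmem : ∀ s ∈ Icc ((Fin.snoc t 0 : Fin (j + 1) → ℝ) p) ((Fin.cons 1 t : Fin (j + 1) → ℝ) p),
      (p.insertNth s t : Fin (j + 1) → ℝ) ∈ orderedSimplex (j + 1) :=
    fun s hs ↦ (insertNth_mem_orderedSimplex_iff s p t).2 ⟨ht, hs⟩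
  have hcont : Continuous fun s ↦ (p.insertNth s t : Fin (j + 1) → ℝ) :=
    continuous_iff_continuousAt.2 fun s ↦ (hasDerivAt_insertNth p t s).continuousAt
  simp only [faceMap_castSucc, faceMap_succ]
  rw [integral_Icc_eq_integral_Ioc, ← intervalIntegral.integral_of_le hle]
  refine intervalIntegral.integral_eq_sub_of_hasDerivAt
    (f := fun s ↦ f (p.insertNth s t)) (fun s hs ↦ ?_) ?_
  · rw [uIcc_of_le hle] at hs
    have h1 := ((hf _ (hmem s hs)).differentiableAt (by simp)).hasFDerivAt
    exact h1.comp_hasDerivAt s (hasDerivAt_insertNth p t s)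
  · refine ContinuousOn.intervalIntegrable ?_
    rw [uIcc_of_le hle]
    exact hc.comp hcont.continuousOn hmem

theorem faceLin_zero_single (l : Fin j) :
    faceLin 0 (Pi.single l 1) = Pi.single ((0 : Fin (j + 1)).succAbove l) (1 : ℝ) := by
  have h := faceLin_castSucc 0 (Pi.single l (1 : ℝ))
  rw [Fin.castSucc_zero, Fin.cons_zero] at h
  rw [h, Fin.insertNth_eq_iff]
  refine ⟨by simp, funext fun m ↦ ?_⟩
  simp [Fin.removeNth, Pi.single_apply]

theorem faceLin_last_single (l : Fin j) :
    faceLin (Fin.last (j + 1)) (Pi.single l 1) =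
      Pi.single ((Fin.last j).succAbove l) (1 : ℝ) := by
  have h := faceLin_succ (Fin.last j) (Pi.single l (1 : ℝ))
  rw [Fin.succ_last, Fin.snoc_last] at h
  rw [h, Fin.insertNth_eq_iff]
  refine ⟨by simp [(Fin.castSucc_lt_last l).ne'], funext fun m ↦ ?_⟩
  simp [Fin.removeNth, Pi.single_apply]

theorem faceLin_middle_single (q : Fin j) :
    (fun l ↦ faceLin q.succ.castSucc (Pi.single l 1)) =
      Function.update (fun l ↦ (Pi.single (q.succ.succAbove l) 1 : Fin (j + 1) → ℝ)) q
        (Pi.single q.succ 1 + Pi.single q.castSucc 1) := by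
  funext l
  rw [faceLin_castSucc, Fin.cons_succ, Fin.insertNth_eq_iff]
  by_cases hl : l = q
  · subst hl
    rw [Function.update_self]
    refine ⟨by simp [Fin.ext_iff], funext fun m ↦ ?_⟩
    have h1 : l.succ.succAbove m = l.castSucc ↔ m = l := by
      conv_lhs => rw [← Fin.succAbove_succ_self]
      exact Fin.succAbove_right_inj
    simp [Fin.removeNth, Pi.single_apply, Fin.succAbove_ne, h1]
  · rw [Function.update_of_ne hl]
    refine ⟨by simp [Ne.symm hl, (Fin.succAbove_ne _ _).symm], funext fun m ↦ ?_⟩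
    simp [Fin.removeNth, Pi.single_apply]

/-- Stokes' theorem for a closed form on the ordered simplex: the alternating sum of the integrals
over the faces vanishes. On the `i`-th face the edge at position `i` is the sum of two coordinate
directions, and so the integrand splits into the two coefficients of the form that belong to the
coordinates `i - 1` and `i`. -/
theorem sum_face_integrals_eq_zero
    {θ : (Fin (j + 1) → ℝ) → (Fin (j + 1) → ℝ) [⋀^Fin j]→L[ℝ] ℝ}
    (hd : ∀ x ∈ orderedSimplex (j + 1), DifferentiableAt ℝ θ x)
    (hs : ∀ v, ∀ x ∈ orderedSimplex (j + 1), ContDiffAt ℝ 1 (fun x ↦ θ x v) x)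
    (hcl : ∀ x ∈ orderedSimplex (j + 1), extDeriv θ x = 0) :
    ∑ i : Fin (j + 2), (-1 : ℝ) ^ (i : ℕ) *
      ∫ t in orderedSimplex j, θ (faceMap i t) (fun l ↦ faceLin i (Pi.single l 1)) = 0 := by
  set G : Fin (j + 1) → (Fin (j + 1) → ℝ) → ℝ :=
    fun p x ↦ θ x (fun l ↦ Pi.single (p.succAbove l) 1) with hG
  -- `A i p` is the integral over the `i`-th face of the coefficient with `p` left out
  set A : Fin (j + 2) → Fin (j + 1) → ℝ := fun i p ↦ ∫ t in orderedSimplex j, G p (faceMap i t)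
    with hA
  have hGint : ∀ i p, IntegrableOn (fun t ↦ G p (faceMap i t)) (orderedSimplex j) := by
    intro i p
    refine ContinuousOn.integrableOn_compact isCompact_orderedSimplex fun t ht ↦ ?_
    exact ((hs _ _ (faceMap_mem ht)).continuousAt.comp (f := faceMap i)
      (continuous_faceMap i).continuousAt).continuousWithinAt
  have hF : ∀ i : Fin (j + 2),
      ∫ t in orderedSimplex j, θ (faceMap i t) (fun l ↦ faceLin i (Pi.single l 1)) =
      (Fin.snoc (fun p : Fin (j + 1) ↦ A p.castSucc p) 0 : Fin (j + 2) → ℝ) i +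
      (Fin.cons 0 (fun p : Fin (j + 1) ↦ A p.succ p) : Fin (j + 2) → ℝ) i := by
    intro i
    refine Fin.cases ?_ (fun q ↦ ?_) i
    · have h1 : (Fin.snoc (fun p : Fin (j + 1) ↦ A p.castSucc p) 0 : Fin (j + 2) → ℝ) 0 = A 0 0 :=
        Fin.snoc_castSucc (α := fun _ ↦ ℝ) 0 (fun p : Fin (j + 1) ↦ A p.castSucc p) 0
      rw [h1, Fin.cons_zero, add_zero]
      simp only [faceLin_zero_single, hA, hG]
    · refine Fin.lastCases ?_ (fun q ↦ ?_) q
      · rw [Fin.cons_succ, Fin.succ_last, Fin.snoc_last, zero_add]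
        simp only [faceLin_last_single, hA, hG]
      · rw [Fin.cons_succ, Fin.succ_castSucc, Fin.snoc_castSucc, hA]
        simp only
        rw [← integral_add (hGint _ _) (hGint _ _), faceLin_middle_single]
        refine integral_congr_ae (Filter.Eventually.of_forall fun t ↦ ?_)
        simp only
        rw [ContinuousAlternatingMap.map_update_add, add_comm]
        congr 2
        · rw [Function.update_eq_self_iff, Fin.succAbove_succ_self]
        · funext l
          by_cases hl : l = q
          · subst hl
            rw [Function.update_self, Fin.succAbove_castSucc_self]
          · rw [Function.update_of_ne hl, castSucc_succAbove_eq_of_ne hl]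
  simp only [hF, mul_add, Finset.sum_add_distrib]
  rw [Fin.sum_univ_castSucc, Fin.sum_univ_succ (fun i : Fin (j + 2) ↦ (-1 : ℝ) ^ (i : ℕ) *
    (Fin.cons 0 (fun p : Fin (j + 1) ↦ A p.succ p) : Fin (j + 2) → ℝ) i)]
  simp only [Fin.snoc_castSucc, Fin.snoc_last, Fin.cons_zero, Fin.cons_succ, mul_zero, add_zero,
    zero_add, Fin.val_castSucc, Fin.val_succ, ← Finset.sum_add_distrib]
  have hstokes : ∀ p : Fin (j + 1), (-1 : ℝ) ^ (p : ℕ) * A p.castSucc p +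
      (-1 : ℝ) ^ ((p : ℕ) + 1) * A p.succ p =
      ∫ x in orderedSimplex (j + 1), (-1 : ℝ) ^ (p : ℕ) * fderiv ℝ (G p) x (Pi.single p 1) := by
    intro p
    rw [integral_const_mul, setIntegral_orderedSimplex_fderiv p (hs _)]
    ring
  simp only [hstokes]
  rw [← integral_finsetSum]
  · refine setIntegral_eq_zero_of_forall_eq_zero fun x hx ↦ ?_
    have h := extDeriv_apply (hd x hx) (fun i : Fin (j + 1) ↦ Pi.single i (1 : ℝ))
    rw [hcl x hx] at h
    refine Eq.trans ?_ h.symm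
    refine Finset.sum_congr rfl fun p _ ↦ ?_
    have hface : (p.removeNth fun i : Fin (j + 1) ↦ (Pi.single i 1 : Fin (j + 1) → ℝ)) =
        fun l ↦ Pi.single (p.succAbove l) 1 := rfl
    rw [hface]
    simp [hG]
  · intro p _
    refine Integrable.const_mul (IntegrableOn.integrable (ContinuousOn.integrableOn_compact
      isCompact_orderedSimplex fun x hx ↦ ?_)) _
    have := ((hs (fun l ↦ Pi.single (p.succAbove l) 1) x hx).fderiv_right (m := 0)
      (by simp)).continuousAt
    exact (this.clm_apply continuousAt_const).continuousWithinAt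

end OrderedSimplexStokes

/-! ### Integration over smooth chains -/

section SimplexIntegral

variable {m j : ℕ} {X : Type*} [TopologicalSpace X] [ChartedSpace (EuclideanSpace ℝ (Fin m)) X]

theorem contDiff_steps (c : ℝ) : ContDiff ℝ ∞ (steps c : (Fin j → ℝ) → _) := by
  refine contDiff_pi.2 fun m ↦ ?_
  unfold steps
  refine ContDiff.sub ?_ ?_
  · refine Fin.cases ?_ (fun i ↦ ?_) m
    · simpa using contDiff_const
    · simpa using contDiff_apply ℝ ℝ i
  · refine Fin.lastCases ?_ (fun i ↦ ?_) m
    · simpa using contDiff_const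
    · simpa using contDiff_apply ℝ ℝ i

/-- A smooth simplex in the coordinates of the ordered simplex; outside the ordered simplex it is
given by an arbitrary smooth extension. -/
noncomputable def SmoothSimplex.param (σ : SmoothSimplex m X j) : (Fin j → ℝ) → X :=
  σ.smooth'.choose_spec.choose ∘ steps 1

theorem SmoothSimplex.param_apply (σ : SmoothSimplex m X j) {t : Fin j → ℝ}
    (ht : t ∈ orderedSimplex j) : σ.param t = σ.toFun ⟨steps 1 t, steps_mem_stdSimplex ht⟩ :=
  σ.smooth'.choose_spec.choose_spec.2.2.2 ⟨steps 1 t, steps_mem_stdSimplex ht⟩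

theorem SmoothSimplex.exists_param_contMDiffOn (σ : SmoothSimplex m X j) :
    ∃ U : Set (Fin j → ℝ), IsOpen U ∧ orderedSimplex j ⊆ U ∧
      ContMDiffOn 𝓘(ℝ, Fin j → ℝ) (𝓡 m) ∞ σ.param U := by
  obtain ⟨hU, hsub, hs, -⟩ := σ.smooth'.choose_spec.choose_spec
  refine ⟨steps 1 ⁻¹' σ.smooth'.choose, hU.preimage (continuous_steps 1),
    fun t ht ↦ hsub (steps_mem_stdSimplex ht), ?_⟩
  exact hs.comp (contDiff_steps 1).contMDiff.contMDiffOn fun t ht ↦ ht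

/-- The integral over a smooth simplex of a field of alternating forms. -/
noncomputable def simplexIntegral (θ : ∀ x : X, TangentSpace (𝓡 m) x [⋀^Fin j]→L[ℝ] ℝ)
    (σ : SmoothSimplex m X j) : ℝ :=
  ∫ t in orderedSimplex j, pullback θ σ.param t (fun l ↦ Pi.single l 1)

theorem ae_mem_interior_orderedSimplex :
    ∀ᵐ t ∂(volume.restrict (orderedSimplex j)), t ∈ interior (orderedSimplex j) := by
  have h0 := (convex_orderedSimplex (j := j)).addHaar_frontier volume
  have h1 : ∀ᵐ t ∂(volume.restrict (orderedSimplex j)), t ∉ frontier (orderedSimplex j) :=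
    ae_restrict_of_ae (measure_eq_zero_iff_ae_notMem.1 h0)
  filter_upwards [h1, ae_restrict_mem measurableSet_orderedSimplex] with t h2 h3
  by_contra h4
  exact h2 ⟨subset_closure h3, h4⟩

/-- The integral over a simplex may be computed with any parametrization that agrees with the
simplex on the ordered simplex, as the boundary of a convex set is a null set. -/
theorem simplexIntegral_eq (θ : ∀ x : X, TangentSpace (𝓡 m) x [⋀^Fin j]→L[ℝ] ℝ)
    (σ : SmoothSimplex m X j) {s : (Fin j → ℝ) → X} (hs : EqOn s σ.param (orderedSimplex j)) :
    simplexIntegral θ σ =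
      ∫ t in orderedSimplex j, pullback θ s t (fun l ↦ Pi.single l 1) := by
  refine integral_congr_ae ?_
  filter_upwards [ae_mem_interior_orderedSimplex] with t ht
  rw [pullback_congr_of_eventuallyEq θ]
  filter_upwards [isOpen_interior.mem_nhds ht] with u hu
  exact (hs (interior_subset hu)).symm

theorem stdSimplex_map_succAbove (i : Fin (j + 2)) (y : stdSimplex ℝ (Fin (j + 1))) :
    ⇑(stdSimplex.map i.succAbove y) = (i.insertNth 0 (y : Fin (j + 1) → ℝ) : Fin (j + 2) → ℝ) := by
  rw [stdSimplex.map_coe]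
  refine Fin.eq_insertNth_iff.2 ⟨?_, funext fun l ↦ ?_⟩
  · rw [FunOnFinite.linearMap_apply_apply]
    refine Finset.sum_eq_zero fun a ha ↦ ?_
    exact absurd (Finset.mem_filter.1 ha).2 (Fin.succAbove_ne i a)
  · rw [Fin.removeNth, FunOnFinite.linearMap_apply_apply, Finset.sum_eq_single l]
    · intro b hb hbl
      exact absurd (Fin.succAbove_right_inj.1 (Finset.mem_filter.1 hb).2) hbl
    · intro h
      simp at h

theorem SmoothSimplex.param_face (σ : SmoothSimplex m X (j + 1)) (i : Fin (j + 2)) :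
    EqOn (σ.param ∘ faceMap i) (σ.face i).param (orderedSimplex j) := by
  intro t ht
  rw [SmoothSimplex.param_apply _ ht, Function.comp_apply, SmoothSimplex.param_apply _
    (faceMap_mem ht)]
  refine congrArg σ.toFun (Subtype.ext ?_)
  have h := stdSimplex_map_succAbove i ⟨steps 1 t, steps_mem_stdSimplex ht⟩
  exact (steps_faceMap i t).trans h.symm

/-- The integral of a field of alternating forms over a chain. -/
noncomputable def chainIntegral (θ : ∀ x : X, TangentSpace (𝓡 m) x [⋀^Fin j]→L[ℝ] ℝ) :
    Chain m X j →ₗ[ℝ] ℝ :=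
  Finsupp.linearCombination ℝ (simplexIntegral θ)

variable {m' : ℕ} {Y : Type*} [TopologicalSpace Y] [ChartedSpace (EuclideanSpace ℝ (Fin m')) Y]

theorem simplexIntegral_map (θ : ∀ y : Y, TangentSpace (𝓡 m') y [⋀^Fin j]→L[ℝ] ℝ) (f : X → Y)
    (hf : ContMDiff (𝓡 m) (𝓡 m') ∞ f) (σ : SmoothSimplex m X j) :
    simplexIntegral θ (σ.map f hf) = simplexIntegral
      (fun x ↦ (θ (f x)).compContinuousLinearMap (mfderiv (𝓡 m) (𝓡 m') f x)) σ := by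
  have heq : EqOn (f ∘ σ.param) (σ.map f hf).param (orderedSimplex j) := by
    intro t ht
    rw [SmoothSimplex.param_apply _ ht, Function.comp_apply, SmoothSimplex.param_apply _ ht]
    rfl
  obtain ⟨U, hU, hsub, hσ⟩ := σ.exists_param_contMDiffOn
  rw [simplexIntegral_eq θ _ heq]
  refine setIntegral_congr_fun measurableSet_orderedSimplex fun t ht ↦ ?_
  have h := mfderiv_comp t (hf.mdifferentiableAt (x := σ.param t) (by simp))
    (mdifferentiableAt_of_contMDiffOn hU hσ (hsub ht))
  simp only [pullback, h]
  rfl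

theorem chainIntegral_pushChain (θ : ∀ y : Y, TangentSpace (𝓡 m') y [⋀^Fin j]→L[ℝ] ℝ) (f : X → Y)
    (hf : ContMDiff (𝓡 m) (𝓡 m') ∞ f) (z : Chain m X j) :
    chainIntegral θ (pushChain f hf z) = chainIntegral
      (fun x ↦ (θ (f x)).compContinuousLinearMap (mfderiv (𝓡 m) (𝓡 m') f x)) z := by
  have : (chainIntegral θ).comp (pushChain f hf) = (chainIntegral
      (fun x ↦ (θ (f x)).compContinuousLinearMap (mfderiv (𝓡 m) (𝓡 m') f x)) :
      Chain m X j →ₗ[ℝ] ℝ) := by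
    refine Finsupp.lhom_ext fun σ a ↦ ?_
    simp only [LinearMap.comp_apply, pushChain, Finsupp.lmapDomain_apply,
      Finsupp.mapDomain_single, chainIntegral, Finsupp.linearCombination_single]
    rw [simplexIntegral_map]
  exact congrArg (fun L ↦ L z) this

variable [IsManifold (𝓡 m) ∞ X]

/-- Stokes' theorem for a closed form on a smooth simplex. -/
theorem sum_simplexIntegral_face (θ : DiffForm m j X) (hθ : θ.IsClosed)
    (σ : SmoothSimplex m X (j + 1)) :
    ∑ i : Fin (j + 2), (-1 : ℝ) ^ (i : ℕ) * simplexIntegral θ.toFun (σ.face i) = 0 := by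
  obtain ⟨U, hU, hsub, hσ⟩ := σ.exists_param_contMDiffOn
  rw [← sum_face_integrals_eq_zero (θ := pullback θ.toFun σ.param)
    (fun x hx ↦ differentiableAt_pullback θ hU hσ (hsub hx))
    (fun v x hx ↦ (contDiffAt_pullback_apply θ hU hσ (hsub hx) v).of_le
      (WithTop.coe_le_coe.2 le_top))
    (fun x hx ↦ extDeriv_pullback_eq_zero θ hθ hU hσ (hsub hx))]
  refine Finset.sum_congr rfl fun i _ ↦ ?_
  rw [simplexIntegral_eq θ.toFun _ (σ.param_face i)]
  congr 1
  refine setIntegral_congr_fun measurableSet_orderedSimplex fun t ht ↦ ?_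
  have hd := hasFDerivAt_faceMap i t
  rw [pullback_comp θ.toFun (mdifferentiableAt_of_contMDiffOn hU hσ (hsub (faceMap_mem ht)))
    hd.differentiableAt, hd.fderiv]
  rfl

theorem chainIntegral_boundary (θ : DiffForm m j X) (hθ : θ.IsClosed) (c : Chain m X (j + 1)) :
    chainIntegral θ.toFun (boundary c) = 0 := by
  have : (chainIntegral θ.toFun).comp boundary = (0 : Chain m X (j + 1) →ₗ[ℝ] ℝ) := by
    refine Finsupp.lhom_ext fun σ a ↦ ?_
    simp only [LinearMap.comp_apply, boundary, Finsupp.linearCombination_single, map_smul, map_sum,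
      LinearMap.zero_apply, chainIntegral]
    have h := sum_simplexIntegral_face θ hθ σ
    simp only [smul_eq_mul]
    rw [h, mul_zero]
  exact congrArg (fun L ↦ L c) this

end SimplexIntegral

/-! ### Densities relative to the orientation form -/

section TopForms

variable {k : ℕ}

/-- The standard frame of `ℝᵏ`. -/
noncomputable def stdFrame (k : ℕ) (i : Fin k) : EuclideanSpace ℝ (Fin k) :=
  EuclideanSpace.single i (1 : ℝ)

theorem sum_smul_stdFrame (w : EuclideanSpace ℝ (Fin k)) : ∑ i, w i • stdFrame k i = w := by
  ext j
  simp [stdFrame, Finset.sum_apply, Pi.single_apply]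

/-- The coordinate matrix of a family of vectors. -/
def coordMatrix (w : Fin k → EuclideanSpace ℝ (Fin k)) : Matrix (Fin k) (Fin k) ℝ :=
  Matrix.of fun i j ↦ w i j

theorem sum_coordMatrix_smul (w : Fin k → EuclideanSpace ℝ (Fin k)) :
    (fun i ↦ ∑ j, coordMatrix w i j • stdFrame k j) = w :=
  funext fun i ↦ sum_smul_stdFrame (w i)

/-- A form of top degree is determined by its value on the standard frame. -/
theorem topForm_apply (α : EuclideanSpace ℝ (Fin k) [⋀^Fin k]→L[ℝ] ℝ)
    (w : Fin k → EuclideanSpace ℝ (Fin k)) :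
    α w = (coordMatrix w).det * α (stdFrame k) := by
  have h := alternating_map_matrix_sum α.toAlternatingMap (coordMatrix w) (stdFrame k)
  rw [sum_coordMatrix_smul] at h
  exact h

theorem topForm_ne_zero {α : EuclideanSpace ℝ (Fin k) [⋀^Fin k]→L[ℝ] ℝ} (hα : α ≠ 0) :
    α (stdFrame k) ≠ 0 := by
  intro h
  refine hα (ContinuousAlternatingMap.ext fun w ↦ ?_)
  rw [topForm_apply, h, mul_zero]
  rfl

theorem det_coordMatrix (L : EuclideanSpace ℝ (Fin k) →L[ℝ] EuclideanSpace ℝ (Fin k)) :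
    (coordMatrix fun i ↦ L (stdFrame k i)).det = L.det := by
  rw [← Matrix.det_transpose]
  have : (coordMatrix fun i ↦ L (stdFrame k i)).transpose = LinearMap.toMatrix
      (EuclideanSpace.basisFun (Fin k) ℝ).toBasis (EuclideanSpace.basisFun (Fin k) ℝ).toBasis
      (L : EuclideanSpace ℝ (Fin k) →ₗ[ℝ] EuclideanSpace ℝ (Fin k)) := by
    ext i j
    simp [coordMatrix, LinearMap.toMatrix_apply, stdFrame]
  rw [this, LinearMap.det_toMatrix]

theorem topForm_comp (α : EuclideanSpace ℝ (Fin k) [⋀^Fin k]→L[ℝ] ℝ)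
    (L : EuclideanSpace ℝ (Fin k) →L[ℝ] EuclideanSpace ℝ (Fin k)) :
    α.compContinuousLinearMap L (stdFrame k) = L.det * α (stdFrame k) := by
  rw [← det_coordMatrix, ← topForm_apply]
  rfl

end TopForms

section Densities

variable {n k : ℕ} {M : Type*} [TopologicalSpace M] [ChartedSpace (EuclideanSpace ℝ (Fin n)) M]
  {N : Type*} [TopologicalSpace N] [ChartedSpace (EuclideanSpace ℝ (Fin k)) N]

/-- The pullback under `f : N → M` of a field of `k`-forms, as a multiple of the orientation
form. The quotient may be computed on any frame. -/
noncomputable def relForm (η : ∀ x : M, TangentSpace (𝓡 n) x [⋀^Fin k]→L[ℝ] ℝ)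
    (o : OrientationForm k N) (f : N → M) (p : N) : ℝ :=
  η (f p) (fun i ↦ mfderiv (𝓡 k) (𝓡 n) f p (stdFrame k i)) / o.toFun p (stdFrame k)

theorem OrientationForm.apply_stdFrame_ne_zero (o : OrientationForm k N) (p : N) :
    o.toFun p (stdFrame k) ≠ 0 :=
  topForm_ne_zero (α := o.toFun p) (o.ne_zero' p)

theorem pullback_eq_relForm_mul (η : ∀ x : M, TangentSpace (𝓡 n) x [⋀^Fin k]→L[ℝ] ℝ)
    (o : OrientationForm k N) (f : N → M) (p : N) (w : Fin k → TangentSpace (𝓡 k) p) :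
    η (f p) (fun i ↦ mfderiv (𝓡 k) (𝓡 n) f p (w i)) = relForm η o f p * o.toFun p w := by
  have h := topForm_apply ((η (f p)).compContinuousLinearMap (mfderiv (𝓡 k) (𝓡 n) f p)) w
  have h2 : o.toFun p w = (coordMatrix w).det * o.toFun p (stdFrame k) :=
    topForm_apply (o.toFun p) w
  rw [h2, relForm]
  have := o.apply_stdFrame_ne_zero p
  field_simp
  exact h.trans (mul_comm _ _)

/-- The coefficient of the orientation form in the preferred chart at `q`. -/
noncomputable def OrientationForm.coeff (o : OrientationForm k N) (q : N)
    (y : EuclideanSpace ℝ (Fin k)) : ℝ :=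
  chartRep o.toFun q y (stdFrame k)

theorem OrientationForm.contDiffOn_coeff (o : OrientationForm k N) (q : N) :
    ContDiffOn ℝ ∞ (o.coeff q) (chartAt (EuclideanSpace ℝ (Fin k)) q).target :=
  (ContinuousAlternatingMap.apply ℝ (EuclideanSpace ℝ (Fin k)) ℝ
    (stdFrame k)).contDiff.comp_contDiffOn (o.smooth' q)

section Charts

variable [IsManifold (𝓡 k) ∞ N]

theorem mdifferentiableAt_chart_symm (q : N) {y : EuclideanSpace ℝ (Fin k)}
    (hy : y ∈ (chartAt (EuclideanSpace ℝ (Fin k)) q).target) :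
    MDifferentiableAt (𝓡 k) (𝓡 k) (chartAt (EuclideanSpace ℝ (Fin k)) q).symm y :=
  mdifferentiableAt_atlas_symm (I := 𝓡 k) (chart_mem_atlas _ q) hy

theorem pullback_chart_symm_eq (η : ∀ x : M, TangentSpace (𝓡 n) x [⋀^Fin k]→L[ℝ] ℝ)
    (o : OrientationForm k N) {f : N → M} (q : N)
    {y : EuclideanSpace ℝ (Fin k)} (hy : y ∈ (chartAt (EuclideanSpace ℝ (Fin k)) q).target)
    (hf : MDifferentiableAt (𝓡 k) (𝓡 n) f ((chartAt (EuclideanSpace ℝ (Fin k)) q).symm y)) :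
    pullback η (f ∘ (chartAt (EuclideanSpace ℝ (Fin k)) q).symm) y (stdFrame k) =
      relForm η o f ((chartAt (EuclideanSpace ℝ (Fin k)) q).symm y) * o.coeff q y := by
  have h := mfderiv_comp y hf (mdifferentiableAt_chart_symm q hy)
  have h2 := pullback_eq_relForm_mul η o f ((chartAt (EuclideanSpace ℝ (Fin k)) q).symm y)
    (fun i ↦ mfderiv (𝓡 k) (𝓡 k) (chartAt (EuclideanSpace ℝ (Fin k)) q).symm y (stdFrame k i))
  rw [pullback]
  erw [h]
  exact h2

theorem OrientationForm.coeff_ne_zero (o : OrientationForm k N) (q : N)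
    {y : EuclideanSpace ℝ (Fin k)} (hy : y ∈ (chartAt (EuclideanSpace ℝ (Fin k)) q).target) :
    o.coeff q y ≠ 0 := by
  set φ := chartAt (EuclideanSpace ℝ (Fin k)) q
  set A := mfderiv (𝓡 k) (𝓡 k) φ.symm y
  set B := mfderiv (𝓡 k) (𝓡 k) φ (φ.symm y)
  have hB : MDifferentiableAt (𝓡 k) (𝓡 k) φ (φ.symm y) :=
    mdifferentiableAt_atlas (I := 𝓡 k) (chart_mem_atlas _ q) (φ.map_target hy)
  have hid : φ.symm ∘ φ =ᶠ[𝓝 (φ.symm y)] id := by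
    filter_upwards [φ.open_source.mem_nhds (φ.map_target hy)] with x hx
    exact φ.left_inv hx
  have hA : MDifferentiableAt (𝓡 k) (𝓡 k) φ.symm (φ (φ.symm y)) := by
    rw [φ.right_inv hy]
    exact mdifferentiableAt_chart_symm q hy
  have hAB := (mfderiv_comp (φ.symm y) hA hB).symm.trans (hid.mfderiv_eq.trans mfderiv_id)
  intro h0
  have h1 : chartRep o.toFun q y = 0 := by
    by_contra h
    exact topForm_ne_zero h h0
  refine o.ne_zero' (φ.symm y) (ContinuousAlternatingMap.ext fun w ↦ ?_)
  have h2 := congrArg (fun α ↦ α fun i ↦ B (w i)) h1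
  refine Eq.trans ?_ h2
  refine congrArg (o.toFun (φ.symm y)) (funext fun i ↦ ?_)
  have h3 := congrArg (fun L ↦ L (w i)) hAB
  rw [φ.right_inv hy] at h3
  exact h3.symm

end Charts

variable [IsManifold (𝓡 n) ∞ M]

/-- The volume density of `f : N → M` relative to the orientation form: the quotient of the volume
of the parallelepiped spanned by the image of a frame and of the absolute value of the orientation
form on that frame, which does not depend on the frame. -/
noncomputable def relDensity (g : Metric n M) (o : OrientationForm k N) (f : N → M) (p : N) : ℝ :=
  √(gram (g.inner (f p)) fun i ↦ mfderiv (𝓡 k) (𝓡 n) f p (stdFrame k i)).det /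
    |o.toFun p (stdFrame k)|

theorem sqrt_det_gram_eq (g : Metric n M) (o : OrientationForm k N) (f : N → M) (p : N)
    (w : Fin k → TangentSpace (𝓡 k) p) :
    √(gram (g.inner (f p)) fun i ↦ mfderiv (𝓡 k) (𝓡 n) f p (w i)).det =
      relDensity g o f p * |o.toFun p w| := by
  have h1 : (fun i ↦ mfderiv (𝓡 k) (𝓡 n) f p (w i)) = fun i ↦ ∑ j, coordMatrix w i j •
      mfderiv (𝓡 k) (𝓡 n) f p (stdFrame k j) := by
    funext i
    let L : EuclideanSpace ℝ (Fin k) →L[ℝ] TangentSpace (𝓡 n) (f p) := mfderiv (𝓡 k) (𝓡 n) f p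
    have hL : L (w i) = ∑ j, coordMatrix w i j • L (stdFrame k j) := by
      conv_lhs => rw [← congrFun (sum_coordMatrix_smul w) i]
      simp only [map_sum, map_smul]
    exact hL
  have h2 : o.toFun p w = (coordMatrix w).det * o.toFun p (stdFrame k) :=
    topForm_apply (o.toFun p) w
  rw [h1, det_gram_matrix_sum, Real.sqrt_mul (sq_nonneg _), Real.sqrt_sq_eq_abs, relDensity,
    h2, abs_mul]
  have := abs_pos.2 (o.apply_stdFrame_ne_zero p)
  field_simp

theorem relDensity_nonneg (g : Metric n M) (o : OrientationForm k N) (f : N → M) (p : N) :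
    0 ≤ relDensity g o f p := div_nonneg (Real.sqrt_nonneg _) (abs_nonneg _)

theorem abs_relForm_le (g : Metric n M) (η : ∀ x : M, TangentSpace (𝓡 n) x [⋀^Fin k]→L[ℝ] ℝ)
    (hη : ∀ (x : M) (e : Fin k → TangentSpace (𝓡 n) x),
      (∀ i, g.inner x (e i) (e i) = 1) → |η x e| ≤ 1)
    (o : OrientationForm k N) (f : N → M) (p : N) :
    |relForm η o f p| ≤ relDensity g o f p := by
  rw [relForm, relDensity, abs_div]
  gcongr
  exact abs_le_sqrt_det_gram (g.inner (f p)) (g.symm (f p)) (g.pos (f p))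
    (η (f p)).toAlternatingMap (hη (f p)) _

/-- On a calibrated submanifold the form restricts to the volume form. -/
theorem relForm_eq_relDensity (g : Metric n M) (η : DiffForm n k M) (o : OrientationForm k N)
    {ι : N → M} (hcal : IsCalibrated g η o ι) (p : N) :
    relForm η.toFun o ι p = relDensity g o ι p ∧ 0 < relDensity g o ι p := by
  obtain ⟨e, ho, hortho, hη⟩ := hcal p
  have h1 := pullback_eq_relForm_mul η.toFun o ι p e
  have h2 := sqrt_det_gram_eq g o ι p e
  have h3 : (gram (g.inner (ι p)) fun i ↦ mfderiv (𝓡 k) (𝓡 n) ι p (e i)) = 1 := by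
    ext i j
    rw [gram, Matrix.of_apply, hortho, Matrix.one_apply]
  rw [h3, Matrix.det_one, Real.sqrt_one, abs_of_pos ho] at h2
  rw [hη] at h1
  have h4 : relForm η.toFun o ι p = relDensity g o ι p :=
    mul_right_cancel₀ ho.ne' (h1.symm.trans h2)
  refine ⟨h4, ?_⟩
  by_contra hneg
  have : relDensity g o ι p * o.toFun p e ≤ 0 :=
    mul_nonpos_of_nonpos_of_nonneg (not_lt.1 hneg) ho.le
  linarith

theorem volDensity_eq [IsManifold (𝓡 k) ∞ N] (g : Metric n M) (o : OrientationForm k N)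
    {f : N → M} (q : N)
    {y : EuclideanSpace ℝ (Fin k)} (hy : y ∈ (chartAt (EuclideanSpace ℝ (Fin k)) q).target)
    (hf : MDifferentiableAt (𝓡 k) (𝓡 n) f ((chartAt (EuclideanSpace ℝ (Fin k)) q).symm y)) :
    volDensity g f q y =
      relDensity g o f ((chartAt (EuclideanSpace ℝ (Fin k)) q).symm y) * |o.coeff q y| := by
  have h := mfderiv_comp y hf (mdifferentiableAt_chart_symm q hy)
  have h2 := sqrt_det_gram_eq g o f ((chartAt (EuclideanSpace ℝ (Fin k)) q).symm y)
    (fun i ↦ mfderiv (𝓡 k) (𝓡 k) (chartAt (EuclideanSpace ℝ (Fin k)) q).symm y (stdFrame k i))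
  rw [volDensity, h]
  exact h2

end Densities

/-! ### Smoothness of the densities -/

section Regularity

variable {n k : ℕ} {M : Type*} [TopologicalSpace M] [ChartedSpace (EuclideanSpace ℝ (Fin n)) M]
  {N : Type*} [TopologicalSpace N] [ChartedSpace (EuclideanSpace ℝ (Fin k)) N]
  [IsManifold (𝓡 k) ∞ N]

/-- A smooth family of maps, with time given by a smooth function, in a chart. -/
theorem contMDiffOn_family_chart {F : ℝ → N → M} {I : Set ℝ} (hI : IsOpen I)
    (hF : ContMDiffOn ((𝓡 k).prod 𝓘(ℝ, ℝ)) (𝓡 n) ∞ (fun q : N × ℝ ↦ F q.2 q.1) (univ ×ˢ I))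
    (q : N) {τ : EuclideanSpace ℝ (Fin k) × ℝ → ℝ}
    (hτ : ContDiffOn ℝ ∞ τ ((chartAt (EuclideanSpace ℝ (Fin k)) q).target ×ˢ univ)) :
    IsOpen (((chartAt (EuclideanSpace ℝ (Fin k)) q).target ×ˢ univ) ∩ τ ⁻¹' I) ∧
    ContMDiffOn 𝓘(ℝ, EuclideanSpace ℝ (Fin k) × ℝ) (𝓡 n) ∞
      (fun z ↦ F (τ z) ((chartAt (EuclideanSpace ℝ (Fin k)) q).symm z.1))
      (((chartAt (EuclideanSpace ℝ (Fin k)) q).target ×ˢ univ) ∩ τ ⁻¹' I) := by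
  set φ := chartAt (EuclideanSpace ℝ (Fin k)) q
  refine ⟨hτ.continuousOn.isOpen_inter_preimage (φ.open_target.prod isOpen_univ) hI, ?_⟩
  have h1 : ContMDiffOn 𝓘(ℝ, EuclideanSpace ℝ (Fin k) × ℝ) (𝓡 k) ∞
      (fun z : EuclideanSpace ℝ (Fin k) × ℝ ↦ φ.symm z.1)
      ((φ.target ×ˢ univ) ∩ τ ⁻¹' I) :=
    (contMDiffOn_chart_symm (I := 𝓡 k) (n := ∞) (x := q)).comp
      (contDiff_fst.contMDiff.contMDiffOn) fun z hz ↦ hz.1.1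
  have h2 : ContMDiffOn 𝓘(ℝ, EuclideanSpace ℝ (Fin k) × ℝ) 𝓘(ℝ, ℝ) ∞ τ
      ((φ.target ×ˢ univ) ∩ τ ⁻¹' I) := (hτ.mono inter_subset_left).contMDiffOn
  exact hF.comp (h1.prodMk h2) fun z hz ↦ ⟨mem_univ _, hz.2⟩

variable [IsManifold (𝓡 n) ∞ M]

theorem contDiffAt_det_gram_mfderiv {E : Type*} [NormedAddCommGroup E] [NormedSpace ℝ E]
    (g : Metric n M) {G : E → M} {U : Set E} (hU : IsOpen U)
    (hG : ContMDiffOn 𝓘(ℝ, E) (𝓡 n) ∞ G U) {z : E} (hz : z ∈ U) (v : Fin k → E) :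
    ContDiffAt ℝ ∞
      (fun z ↦ (gram (g.inner (G z)) fun i ↦ mfderiv 𝓘(ℝ, E) (𝓡 n) G z (v i)).det) z := by
  simp only [Matrix.det_apply, gram, Matrix.of_apply]
  refine ContDiffAt.sum fun σ _ ↦ ?_
  refine ContDiffAt.const_smul (Equiv.Perm.sign σ) (contDiffAt_prod fun i _ ↦ ?_)
  exact contDiffAt_metric_mfderiv g hU hG hz _ _

/-- The relative density of a smooth family of maps is in charts the square root of a smooth
function. -/
theorem exists_relDensity_eq_sqrt (g : Metric n M) (o : OrientationForm k N) {F : ℝ → N → M}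
    {I : Set ℝ} (hI : IsOpen I)
    (hF : ContMDiffOn ((𝓡 k).prod 𝓘(ℝ, ℝ)) (𝓡 n) ∞ (fun q : N × ℝ ↦ F q.2 q.1) (univ ×ˢ I))
    (q : N) : ∃ Q : EuclideanSpace ℝ (Fin k) × ℝ → ℝ,
      (∀ y ∈ (chartAt (EuclideanSpace ℝ (Fin k)) q).target, ∀ t ∈ I, ContDiffAt ℝ ∞ Q (y, t)) ∧
      ∀ p ∈ (chartAt (EuclideanSpace ℝ (Fin k)) q).source, ∀ t ∈ I,
        relDensity g o (F t) p = √(Q (chartAt (EuclideanSpace ℝ (Fin k)) q p, t)) := by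
  set φ := chartAt (EuclideanSpace ℝ (Fin k)) q with hφ
  obtain ⟨hopen, hG⟩ := contMDiffOn_family_chart hI hF q (τ := Prod.snd) contDiff_snd.contDiffOn
  set G : EuclideanSpace ℝ (Fin k) × ℝ → M := fun z ↦ F z.2 (φ.symm z.1) with hGdef
  refine ⟨fun z ↦ (gram (g.inner (G z)) fun i ↦
      mfderiv 𝓘(ℝ, EuclideanSpace ℝ (Fin k) × ℝ) (𝓡 n) G z (stdFrame k i, 0)).det /
      o.coeff q z.1 ^ 2, fun y hy t ht ↦ ?_, fun p hp t ht ↦ ?_⟩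
  · refine (contDiffAt_det_gram_mfderiv g hopen hG (z := (y, t)) ⟨⟨hy, mem_univ _⟩, ht⟩ _).div ?_
      (pow_ne_zero 2 (o.coeff_ne_zero q hy))
    refine ContDiffAt.pow ?_ 2
    exact ((o.contDiffOn_coeff q).contDiffAt (φ.open_target.mem_nhds hy)).comp (y, t)
      (f := Prod.fst) contDiffAt_fst
  · have hy : φ p ∈ φ.target := φ.map_source hp
    have hz : (φ p, t) ∈ (φ.target ×ˢ univ) ∩ Prod.snd ⁻¹' I := ⟨⟨hy, mem_univ _⟩, ht⟩
    have hFt : MDifferentiableAt (𝓡 k) (𝓡 n) (F t) (φ.symm (φ p)) := by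
      have h1 : ContMDiff (𝓡 k) ((𝓡 k).prod 𝓘(ℝ, ℝ)) ∞ (fun p : N ↦ (p, t)) :=
        contMDiff_id.prodMk contMDiff_const
      have h2 : ContMDiffOn (𝓡 k) (𝓡 n) ∞ (F t) univ :=
        hF.comp h1.contMDiffOn fun p _ ↦ ⟨mem_univ _, ht⟩
      exact mdifferentiableAt_of_contMDiffOn isOpen_univ h2 (mem_univ _)
    have hvol := volDensity_eq g o q hy hFt
    have hpair : HasFDerivAt (fun y : EuclideanSpace ℝ (Fin k) ↦ (y, t))
        ((ContinuousLinearMap.id ℝ _).prod 0) (φ p) :=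
      (hasFDerivAt_id (φ p)).prodMk (hasFDerivAt_const t (φ p))
    have hchain := mfderiv_comp (φ p) (g := G) (f := fun y : EuclideanSpace ℝ (Fin k) ↦ (y, t))
      (mdifferentiableAt_of_contMDiffOn hopen hG hz) hpair.differentiableAt.mdifferentiableAt
    rw [mfderiv_eq_fderiv, hpair.fderiv] at hchain
    have hcoeff := abs_pos.2 (o.coeff_ne_zero q hy)
    have hsqrt : volDensity g (F t) q (φ p) =
        √(gram (g.inner (G (φ p, t))) fun i ↦
          mfderiv 𝓘(ℝ, EuclideanSpace ℝ (Fin k) × ℝ) (𝓡 n) G (φ p, t) (stdFrame k i, 0)).det := by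
      have hcomp : F t ∘ φ.symm = G ∘ fun y : EuclideanSpace ℝ (Fin k) ↦ (y, t) := rfl
      rw [volDensity, ← hφ, hcomp, hchain]
      rfl
    rw [Real.sqrt_div' _ (sq_nonneg _), Real.sqrt_sq_eq_abs, ← hsqrt, hvol, ← hφ, φ.left_inv hp]
    field_simp

theorem continuous_relDensity (g : Metric n M) (o : OrientationForm k N) {f : N → M}
    (hf : ContMDiff (𝓡 k) (𝓡 n) ∞ f) : Continuous (relDensity g o f) := by
  refine continuous_iff_continuousAt.2 fun p ↦ ?_
  have hF : ContMDiffOn ((𝓡 k).prod 𝓘(ℝ, ℝ)) (𝓡 n) ∞ (fun q : N × ℝ ↦ (fun _ ↦ f) q.2 q.1)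
      (univ ×ˢ (univ : Set ℝ)) := (hf.comp contMDiff_fst).contMDiffOn
  obtain ⟨Q, hQ, heq⟩ := exists_relDensity_eq_sqrt g o (F := fun _ ↦ f) isOpen_univ hF p
  have hp := mem_chart_source (EuclideanSpace ℝ (Fin k)) p
  set φ := chartAt (EuclideanSpace ℝ (Fin k)) p
  have h1 : ContinuousAt (fun x : N ↦ √(Q (φ x, 0))) p := by
    refine ContinuousAt.sqrt ?_
    exact (hQ _ (φ.map_source hp) 0 (mem_univ _)).continuousAt.comp
      (f := fun x : N ↦ (φ x, (0 : ℝ)))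
      ((φ.continuousAt hp).prodMk continuousAt_const)
  refine h1.congr ?_
  filter_upwards [φ.open_source.mem_nhds hp] with x hx
  exact (heq x hx 0 (mem_univ _)).symm

/-- Where the density does not vanish, it is locally Lipschitz in the time of a smooth family. -/
theorem exists_lipschitz_relDensity (g : Metric n M) (o : OrientationForm k N) {F : ℝ → N → M}
    {I : Set ℝ} (hI : IsOpen I)
    (hF : ContMDiffOn ((𝓡 k).prod 𝓘(ℝ, ℝ)) (𝓡 n) ∞ (fun q : N × ℝ ↦ F q.2 q.1) (univ ×ˢ I))
    {t₀ : ℝ} (ht₀ : t₀ ∈ I) {p₀ : N} (hpos : 0 < relDensity g o (F t₀) p₀) :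
    ∃ V ∈ 𝓝 p₀, ∃ δ > 0, ∃ K : NNReal, ∀ p ∈ V,
      DifferentiableAt ℝ (fun t ↦ relDensity g o (F t) p) t₀ ∧
      LipschitzOnWith K (fun t ↦ relDensity g o (F t) p) (Metric.ball t₀ δ) := by
  obtain ⟨Q, hQ, heq⟩ := exists_relDensity_eq_sqrt g o hI hF p₀
  have hp := mem_chart_source (EuclideanSpace ℝ (Fin k)) p₀
  set φ := chartAt (EuclideanSpace ℝ (Fin k)) p₀
  have hy : φ p₀ ∈ φ.target := φ.map_source hp
  have hQ0 : Q (φ p₀, t₀) ≠ 0 := by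
    intro h
    rw [heq p₀ hp t₀ ht₀, h, Real.sqrt_zero] at hpos
    exact lt_irrefl _ hpos
  have hs : ContDiffAt ℝ 1 (fun z ↦ √(Q z)) (φ p₀, t₀) :=
    ((hQ _ hy t₀ ht₀).sqrt hQ0).of_le (WithTop.coe_le_coe.2 le_top)
  obtain ⟨K, W, hW, hlip⟩ := hs.exists_lipschitzOnWith
  have hdiff : ∀ᶠ z in 𝓝 (φ p₀, t₀), DifferentiableAt ℝ (fun z ↦ √(Q z)) z :=
    (hs.eventually (by simp)).mono fun z hz ↦ hz.differentiableAt (by simp)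
  obtain ⟨A, hA, B, hB, hAB⟩ := mem_nhds_prod_iff.1 (Filter.inter_mem hW hdiff)
  obtain ⟨δ, hδ, hδB⟩ := Metric.mem_nhds_iff.1 (Filter.inter_mem hB (hI.mem_nhds ht₀))
  refine ⟨φ.source ∩ φ ⁻¹' A, Filter.inter_mem (φ.open_source.mem_nhds hp)
    ((φ.continuousAt hp).preimage_mem_nhds hA), δ, hδ, K, fun p hpV ↦ ⟨?_, ?_⟩⟩
  · have h1 : DifferentiableAt ℝ (fun t ↦ √(Q (φ p, t))) t₀ :=
      DifferentiableAt.comp t₀ (g := fun z ↦ √(Q z)) (f := fun t ↦ (φ p, t))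
        (hAB (mk_mem_prod hpV.2 (mem_of_mem_nhds hB))).2 (by fun_prop)
    refine h1.congr_of_eventuallyEq ?_
    filter_upwards [hI.mem_nhds ht₀] with t ht
    exact heq p hpV.1 t ht
  · intro s hs' t ht
    have hs1 := hδB hs'
    have ht1 := hδB ht
    have h := hlip (hAB (mk_mem_prod hpV.2 hs1.1)).1 (hAB (mk_mem_prod hpV.2 ht1.1)).1
    beta_reduce
    rw [heq p hpV.1 s hs1.2, heq p hpV.1 t ht1.2]
    refine h.trans_eq ?_
    rw [Prod.edist_eq]
    simp

theorem contMDiff_relForm (η : DiffForm n k M) (o : OrientationForm k N) {f : N → M}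
    (hf : ContMDiff (𝓡 k) (𝓡 n) ∞ f) : ContMDiff (𝓡 k) 𝓘(ℝ, ℝ) ∞ (relForm η.toFun o f) := by
  intro p
  have hp := mem_chart_source (EuclideanSpace ℝ (Fin k)) p
  set φ := chartAt (EuclideanSpace ℝ (Fin k)) p with hφ
  have hy : φ p ∈ φ.target := φ.map_source hp
  have hG : ContMDiffOn 𝓘(ℝ, EuclideanSpace ℝ (Fin k)) (𝓡 n) ∞ (f ∘ φ.symm) φ.target :=
    hf.comp_contMDiffOn (contMDiffOn_chart_symm (I := 𝓡 k) (n := ∞) (x := p))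
  have h1 : ContDiffAt ℝ ∞ (fun y ↦ pullback η.toFun (f ∘ φ.symm) y (stdFrame k) / o.coeff p y)
      (φ p) := (contDiffAt_pullback_apply η φ.open_target hG hy _).div
    ((o.contDiffOn_coeff p).contDiffAt (φ.open_target.mem_nhds hy)) (o.coeff_ne_zero p hy)
  refine (h1.contMDiffAt.comp p ((contMDiffOn_chart (I := 𝓡 k) (n := ∞) (x := p)).contMDiffAt
    (φ.open_source.mem_nhds hp))).congr_of_eventuallyEq ?_
  filter_upwards [φ.open_source.mem_nhds hp] with x hx
  have h2 := pullback_chart_symm_eq η.toFun o p (φ.map_source hx)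
    (hf.mdifferentiableAt (f := f) (x := φ.symm (φ x)) (by simp))
  have h3 := o.coeff_ne_zero p (φ.map_source hx)
  rw [← hφ, φ.left_inv hx] at h2
  rw [Function.comp_apply, h2, mul_div_assoc, div_self h3, mul_one]

end Regularity

/-! ### The measure of an orientation form -/

section ChartPartition

variable {k : ℕ} {N : Type*} [TopologicalSpace N] [ChartedSpace (EuclideanSpace ℝ (Fin k)) N]
  [IsManifold (𝓡 k) ∞ N] [T2Space N] [SigmaCompactSpace N]

theorem chartPartition_subordinate (q : N) :
    tsupport (chartPartition k N q) ⊆ (chartAt (EuclideanSpace ℝ (Fin k)) q).source :=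
  (SmoothPartitionOfUnity.exists_isSubordinate_chartAt_source (𝓡 k) N).choose_spec q

theorem countable_chartPartition : {q : N | chartPartition k N q ≠ 0}.Countable := by
  have hlf : LocallyFinite fun q : {q : N | chartPartition k N q ≠ 0} ↦
      Function.support (chartPartition k N q) :=
    (chartPartition k N).locallyFinite.comp_injective Subtype.val_injective
  have := hlf.countable_univ fun q ↦ by
    by_contra h
    rw [not_nonempty_iff_eq_empty, Function.support_eq_empty_iff] at h
    exact q.2 (DFunLike.coe_injective h)
  exact countable_coe_iff.1 (countable_univ_iff.1 this)

theorem tsum_ofReal_chartPartition (p : N) :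
    ∑' q, ENNReal.ofReal (chartPartition k N q p) = 1 := by
  have hfin := (chartPartition k N).toPartitionOfUnity.locallyFinite.point_finite p
  have hsum := (chartPartition k N).sum_eq_one (mem_univ p)
  rw [tsum_eq_sum (s := hfin.toFinset) fun q hq ↦ ?_, ← ENNReal.ofReal_sum_of_nonneg
    fun q _ ↦ (chartPartition k N).nonneg q p, ← ENNReal.ofReal_one, ← hsum]
  · congr 1
    refine (finsum_eq_sum_of_support_subset _ fun q hq ↦ ?_).symm
    simpa using hq
  · have : chartPartition k N q p = 0 := by
      by_contra h
      exact hq (by simpa using h)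
    rw [this, ENNReal.ofReal_zero]

end ChartPartition

section ChartMeasure

theorem measurableSet_inter_preimage_of_continuousOn {X Y : Type*} [TopologicalSpace X]
    [MeasurableSpace X] [BorelSpace X] [TopologicalSpace Y] [MeasurableSpace Y] [BorelSpace Y]
    {f : X → Y} {s : Set X} (hf : ContinuousOn f s) (hs : MeasurableSet s) {t : Set Y}
    (ht : MeasurableSet t) : MeasurableSet (s ∩ f ⁻¹' t) := by
  have h : s ∩ f ⁻¹' t = Subtype.val '' (s.domRestrict f ⁻¹' t) := by
    ext x
    simp [and_comm]
  rw [h]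
  exact hs.subtype_image ((continuousOn_iff_continuous_domRestrict.1 hf).measurable ht)

variable {k : ℕ} {N : Type*} [TopologicalSpace N] [ChartedSpace (EuclideanSpace ℝ (Fin k)) N]

theorem aemeasurable_coeff (o : OrientationForm k N) (q : N) :
    AEMeasurable (fun y ↦ ENNReal.ofReal |o.coeff q y|)
      (volume.restrict (chartAt (EuclideanSpace ℝ (Fin k)) q).target) :=
  ((o.contDiffOn_coeff q).continuousOn.aemeasurable
    (chartAt (EuclideanSpace ℝ (Fin k)) q).open_target.measurableSet).abs.ennreal_ofReal

/-- The derivative of a chart transition relates the coefficients of the orientation form. -/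
theorem OrientationForm.exists_hasFDerivAt_transition [IsManifold (𝓡 k) ∞ N]
    (o : OrientationForm k N) (p q : N)
    {y : EuclideanSpace ℝ (Fin k)} (hy : y ∈ (chartAt (EuclideanSpace ℝ (Fin k)) p).target)
    (hyq : (chartAt (EuclideanSpace ℝ (Fin k)) p).symm y ∈
      (chartAt (EuclideanSpace ℝ (Fin k)) q).source) :
    ∃ L : EuclideanSpace ℝ (Fin k) →L[ℝ] EuclideanSpace ℝ (Fin k),
      HasFDerivAt (chartAt (EuclideanSpace ℝ (Fin k)) q ∘
        (chartAt (EuclideanSpace ℝ (Fin k)) p).symm) L y ∧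
      o.coeff p y = L.det * o.coeff q (chartAt (EuclideanSpace ℝ (Fin k)) q
        ((chartAt (EuclideanSpace ℝ (Fin k)) p).symm y)) := by
  set φ := chartAt (EuclideanSpace ℝ (Fin k)) p with hφ
  set ψ := chartAt (EuclideanSpace ℝ (Fin k)) q with hψ
  have hG : ContMDiffOn 𝓘(ℝ, EuclideanSpace ℝ (Fin k)) (𝓡 k) ∞ φ.symm φ.target :=
    contMDiffOn_chart_symm (I := 𝓡 k) (n := ∞) (x := p)
  have hd := contDiffAt_chart_comp φ.open_target hG q hy hyq
  refine ⟨_, (hd.differentiableAt (by simp)).hasFDerivAt, ?_⟩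
  have h := (pullback_eventuallyEq o.toFun φ.open_target hG q hy hyq).self_of_nhds
  rw [OrientationForm.coeff, chartRep_eq_pullback, ← hφ, h, topForm_comp]
  rfl

variable [MeasurableSpace N] [BorelSpace N]

/-- The measure that the orientation form defines on the domain of a chart. -/
noncomputable def chartMeasure (o : OrientationForm k N) (q : N) : Measure N :=
  ((volume.restrict (chartAt (EuclideanSpace ℝ (Fin k)) q).target).withDensity
    fun y ↦ ENNReal.ofReal |o.coeff q y|).map (chartAt (EuclideanSpace ℝ (Fin k)) q).symm

theorem aemeasurable_chart_symm (q : N) :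
    AEMeasurable (chartAt (EuclideanSpace ℝ (Fin k)) q).symm
      (volume.restrict (chartAt (EuclideanSpace ℝ (Fin k)) q).target) :=
  (chartAt (EuclideanSpace ℝ (Fin k)) q).continuousOn_symm.aemeasurable
    (chartAt (EuclideanSpace ℝ (Fin k)) q).open_target.measurableSet

theorem lintegral_chartMeasure (o : OrientationForm k N) (q : N) {u : N → ENNReal}
    (hu : Measurable u) :
    ∫⁻ p, u p ∂(chartMeasure o q) =
      ∫⁻ y in (chartAt (EuclideanSpace ℝ (Fin k)) q).target,
        ENNReal.ofReal |o.coeff q y| * u ((chartAt (EuclideanSpace ℝ (Fin k)) q).symm y) := by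
  rw [chartMeasure, lintegral_map' hu.aemeasurable
    ((aemeasurable_chart_symm q).mono_ac (withDensity_absolutelyContinuous _ _)),
    ← Function.comp_def u, lintegral_withDensity_eq_lintegral_mul₀ (aemeasurable_coeff o q)
      (hu.comp_aemeasurable (aemeasurable_chart_symm q))]
  rfl

theorem chartMeasure_apply (o : OrientationForm k N) (q : N) {A : Set N} (hA : MeasurableSet A) :
    chartMeasure o q A = ∫⁻ y in (chartAt (EuclideanSpace ℝ (Fin k)) q).target ∩
      (chartAt (EuclideanSpace ℝ (Fin k)) q).symm ⁻¹' A, ENNReal.ofReal |o.coeff q y| := by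
  have hm := (chartAt (EuclideanSpace ℝ (Fin k)) q).open_target.measurableSet
  rw [chartMeasure, Measure.map_apply_of_aemeasurable
    ((aemeasurable_chart_symm q).mono_ac (withDensity_absolutelyContinuous _ _)) hA,
    withDensity_apply', Measure.restrict_restrict' hm, inter_comm]

variable [IsManifold (𝓡 k) ∞ N]

/-- The measures belonging to two charts agree on the overlap: change of variables. -/
theorem chartMeasure_inter_source (o : OrientationForm k N) (p q : N) {A : Set N}
    (hA : MeasurableSet A) :
    chartMeasure o p (A ∩ (chartAt (EuclideanSpace ℝ (Fin k)) q).source) =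
      chartMeasure o q (A ∩ (chartAt (EuclideanSpace ℝ (Fin k)) p).source) := by
  set φ := chartAt (EuclideanSpace ℝ (Fin k)) p with hφ
  set ψ := chartAt (EuclideanSpace ℝ (Fin k)) q with hψ
  rw [chartMeasure_apply o p (hA.inter ψ.open_source.measurableSet),
    chartMeasure_apply o q (hA.inter φ.open_source.measurableSet), ← hφ, ← hψ]
  set S := φ.target ∩ φ.symm ⁻¹' (A ∩ ψ.source) with hS
  have hSm : MeasurableSet S := measurableSet_inter_preimage_of_continuousOn φ.continuousOn_symm
    φ.open_target.measurableSet (hA.inter ψ.open_source.measurableSet)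
  have himage : (ψ ∘ φ.symm) '' S = ψ.target ∩ ψ.symm ⁻¹' (A ∩ φ.source) := by
    ext z
    constructor
    · rintro ⟨y, ⟨hy, hyA, hyψ⟩, rfl⟩
      refine ⟨ψ.map_source hyψ, ?_⟩
      rw [mem_preimage, Function.comp_apply, ψ.left_inv hyψ]
      exact ⟨hyA, φ.map_target hy⟩
    · rintro ⟨hz, hzA, hzφ⟩
      refine ⟨φ (ψ.symm z), ⟨φ.map_source hzφ, ?_⟩, ?_⟩
      · rw [mem_preimage, φ.left_inv hzφ]
        exact ⟨hzA, ψ.map_target hz⟩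
      · rw [Function.comp_apply, φ.left_inv hzφ, ψ.right_inv hz]
  have hinj : InjOn (ψ ∘ φ.symm) S := by
    intro y hy z hz h
    have := ψ.injOn hy.2.2 hz.2.2 h
    exact φ.symm.injOn hy.1 hz.1 this
  have hL : ∀ y ∈ S, _ := fun y hy ↦ o.exists_hasFDerivAt_transition p q hy.1 hy.2.2
  choose! L hL1 hL2 using hL
  rw [← himage, lintegral_image_eq_lintegral_abs_det_fderiv_mul volume hSm
    (fun y hy ↦ (hL1 y hy).hasFDerivWithinAt) hinj]
  refine setLIntegral_congr_fun hSm fun y hy ↦ ?_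
  rw [← ENNReal.ofReal_mul (abs_nonneg _), ← abs_mul, hL2 y hy]
  rfl

theorem chartMeasure_restrict_source (o : OrientationForm k N) (p q : N) :
    (chartMeasure o p).restrict (chartAt (EuclideanSpace ℝ (Fin k)) q).source =
      (chartMeasure o q).restrict (chartAt (EuclideanSpace ℝ (Fin k)) p).source := by
  ext A hA
  rw [Measure.restrict_apply hA, Measure.restrict_apply hA, chartMeasure_inter_source o p q hA]

end ChartMeasure

section OrientationMeasure

variable {k : ℕ} {N : Type*} [TopologicalSpace N] [ChartedSpace (EuclideanSpace ℝ (Fin k)) N]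
  [IsManifold (𝓡 k) ∞ N] [MeasurableSpace N] [BorelSpace N] [T2Space N] [SigmaCompactSpace N]

/-- The measure on `N` defined by the absolute value of the orientation form, put together from the
charts by the partition of unity that enters the definition of the volume. -/
noncomputable def orientMeasure (o : OrientationForm k N) : Measure N :=
  Measure.sum fun q ↦ (chartMeasure o q).withDensity
    fun p ↦ ENNReal.ofReal (chartPartition k N q p)

theorem lintegral_tsum_chartPartition (ν : Measure N) :
    ∑' q, ∫⁻ p, ENNReal.ofReal (chartPartition k N q p) ∂ν = ν univ := by
  have h0 : ∀ q ∉ {q : N | chartPartition k N q ≠ 0}, ∀ p, chartPartition k N q p = 0 := by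
    intro q hq p
    rw [not_not.1 hq]
    rfl
  have hcount : Countable {q : N | chartPartition k N q ≠ 0} :=
    countable_coe_iff.2 countable_chartPartition
  rw [← tsum_subtype_eq_of_support_subset (s := {q : N | chartPartition k N q ≠ 0}) ?_,
    ← lintegral_tsum]
  · have : ∀ p, ∑' q : {q : N | chartPartition k N q ≠ 0},
        ENNReal.ofReal (chartPartition k N q p) = 1 := by
      intro p
      rw [← tsum_ofReal_chartPartition (k := k) p]
      refine tsum_subtype_eq_of_support_subset
        (f := fun q ↦ ENNReal.ofReal (chartPartition k N q p)) fun q hq ↦ ?_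
      by_contra h
      exact hq (by simp [h0 q h p])
    simp [this]
  · intro q
    exact ((chartPartition k N q).contMDiff.continuous.measurable.ennreal_ofReal).aemeasurable
  · intro q hq
    by_contra h
    exact hq (by simp [h0 q h])

/-- On the domain of a chart the measure is the one that the chart defines. -/
theorem orientMeasure_restrict_source (o : OrientationForm k N) (q : N) :
    (orientMeasure o).restrict (chartAt (EuclideanSpace ℝ (Fin k)) q).source =
      chartMeasure o q := by
  have hsm : ∀ q : N, MeasurableSet (chartAt (EuclideanSpace ℝ (Fin k)) q).source :=
    fun q ↦ (chartAt (EuclideanSpace ℝ (Fin k)) q).open_source.measurableSet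
  ext A hA
  rw [Measure.restrict_apply hA, orientMeasure, Measure.sum_apply _ (hA.inter (hsm q))]
  have hzero : ∀ p x, x ∉ (chartAt (EuclideanSpace ℝ (Fin k)) p).source →
      ENNReal.ofReal (chartPartition k N p x) = 0 := by
    intro p x hx
    rw [image_eq_zero_of_notMem_tsupport fun h ↦ hx (chartPartition_subordinate p h),
      ENNReal.ofReal_zero]
  have hterm : ∀ p, ((chartMeasure o p).withDensity fun x ↦
      ENNReal.ofReal (chartPartition k N p x)) (A ∩ (chartAt (EuclideanSpace ℝ (Fin k)) q).source) =
      ∫⁻ x, ENNReal.ofReal (chartPartition k N p x) ∂((chartMeasure o q).restrict A) := by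
    intro p
    rw [withDensity_apply _ (hA.inter (hsm q)), ← Measure.restrict_restrict hA,
      chartMeasure_restrict_source, Measure.restrict_restrict hA, inter_comm,
      ← Measure.restrict_restrict (hsm p)]
    refine setLIntegral_eq_of_support_subset fun x hx ↦ ?_
    by_contra h
    exact hx (hzero p x h)
  simp only [hterm]
  rw [lintegral_tsum_chartPartition, Measure.restrict_apply_univ]

end OrientationMeasure

section OrientationIntegral

variable {n k : ℕ} {M : Type*} [TopologicalSpace M] [ChartedSpace (EuclideanSpace ℝ (Fin n)) M]
  {N : Type*} [TopologicalSpace N] [ChartedSpace (EuclideanSpace ℝ (Fin k)) N]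
  [IsManifold (𝓡 k) ∞ N] [MeasurableSpace N] [BorelSpace N] [T2Space N] [SigmaCompactSpace N]

/-- The volume is the integral of the relative density. The terms of the two sums over charts agree,
as the density in a chart is the relative density times the absolute value of the coefficient of the
orientation form. -/
theorem vol_eq_lintegral [IsManifold (𝓡 n) ∞ M] (g : Metric n M) (o : OrientationForm k N)
    {f : N → M} (hf : ContMDiff (𝓡 k) (𝓡 n) ∞ f) {A : Set N} (hA : MeasurableSet A) :
    vol k g f A = ∫⁻ p in A, ENNReal.ofReal (relDensity g o f p) ∂(orientMeasure o) := by
  have hD : Measurable fun p ↦ ENNReal.ofReal (relDensity g o f p) :=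
    (continuous_relDensity g o hf).measurable.ennreal_ofReal
  have hρ : ∀ q : N, Measurable fun p ↦ ENNReal.ofReal (chartPartition k N q p) :=
    fun q ↦ (chartPartition k N q).contMDiff.continuous.measurable.ennreal_ofReal
  rw [← lintegral_indicator hA, orientMeasure, lintegral_sum_measure, vol]
  refine tsum_congr fun q ↦ ?_
  have hm : MeasurableSet (chartAt (EuclideanSpace ℝ (Fin k)) q).target :=
    (chartAt (EuclideanSpace ℝ (Fin k)) q).open_target.measurableSet
  rw [lintegral_withDensity_eq_lintegral_mul _ (hρ q) (hD.indicator hA),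
    lintegral_chartMeasure o q ((hρ q).mul (hD.indicator hA))]
  have hset : MeasurableSet ((chartAt (EuclideanSpace ℝ (Fin k)) q).target ∩
      (chartAt (EuclideanSpace ℝ (Fin k)) q).symm ⁻¹' A) :=
    measurableSet_inter_preimage_of_continuousOn
      (chartAt (EuclideanSpace ℝ (Fin k)) q).continuousOn_symm hm hA
  rw [← lintegral_indicator hset, ← lintegral_indicator hm]
  refine lintegral_congr fun y ↦ ?_
  by_cases hy : y ∈ (chartAt (EuclideanSpace ℝ (Fin k)) q).target
  · rw [indicator_of_mem hy]
    by_cases hyA : (chartAt (EuclideanSpace ℝ (Fin k)) q).symm y ∈ A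
    · rw [indicator_of_mem (show y ∈ _ ∩ _ from ⟨hy, hyA⟩), Pi.mul_apply, indicator_of_mem hyA,
        volDensity_eq g o q hy (hf.mdifferentiableAt (by simp)),
        ENNReal.ofReal_mul (relDensity_nonneg g o f _)]
      ring
    · have hyS : y ∉ (chartAt (EuclideanSpace ℝ (Fin k)) q).target ∩
          (chartAt (EuclideanSpace ℝ (Fin k)) q).symm ⁻¹' A := fun h ↦ hyA h.2
      rw [indicator_of_notMem hyS, Pi.mul_apply, indicator_of_notMem hyA]
      simp
  · have hyS : y ∉ (chartAt (EuclideanSpace ℝ (Fin k)) q).target ∩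
        (chartAt (EuclideanSpace ℝ (Fin k)) q).symm ⁻¹' A := fun h ↦ hy h.1
    rw [indicator_of_notMem hy, indicator_of_notMem hyS]

/-- The integral of a function that vanishes outside the domain of a chart. -/
theorem integral_orientMeasure_eq (o : OrientationForm k N) (q : N) {u : N → ℝ}
    (hu : Measurable u)
    (hu0 : ∀ p, p ∉ (chartAt (EuclideanSpace ℝ (Fin k)) q).source → u p = 0) :
    ∫ p, u p ∂(orientMeasure o) = ∫ y in (chartAt (EuclideanSpace ℝ (Fin k)) q).target,
      |o.coeff q y| * u ((chartAt (EuclideanSpace ℝ (Fin k)) q).symm y) := by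
  rw [← setIntegral_eq_integral_of_forall_compl_eq_zero hu0, orientMeasure_restrict_source,
    chartMeasure, integral_map
      ((aemeasurable_chart_symm q).mono_ac (withDensity_absolutelyContinuous _ _))
      hu.aestronglyMeasurable,
    integral_withDensity_eq_integral_toReal_smul₀ (aemeasurable_coeff o q)
      (Filter.Eventually.of_forall fun _ ↦ ENNReal.ofReal_lt_top)]
  simp only [ENNReal.toReal_ofReal (abs_nonneg _), smul_eq_mul]

theorem orientMeasure_inter_source_eq_zero (o : OrientationForm k N) (q : N) {A : Set N}
    (hA : MeasurableSet A)
    (h : volume ((chartAt (EuclideanSpace ℝ (Fin k)) q).target ∩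
      (chartAt (EuclideanSpace ℝ (Fin k)) q).symm ⁻¹' A) = 0) :
    orientMeasure o (A ∩ (chartAt (EuclideanSpace ℝ (Fin k)) q).source) = 0 := by
  rw [← Measure.restrict_apply hA, orientMeasure_restrict_source, chartMeasure_apply o q hA,
    Measure.restrict_eq_zero.2 h]
  simp

instance isLocallyFiniteMeasure_orientMeasure (o : OrientationForm k N) :
    IsLocallyFiniteMeasure (orientMeasure o) := by
  refine ⟨fun q ↦ ?_⟩
  have hq := mem_chart_source (EuclideanSpace ℝ (Fin k)) q
  set φ := chartAt (EuclideanSpace ℝ (Fin k)) q with hφ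
  have hy : φ q ∈ φ.target := φ.map_source hq
  obtain ⟨K, hK, hKt, hKc⟩ := local_compact_nhds (φ.open_target.mem_nhds hy)
  refine ⟨φ.source ∩ φ ⁻¹' (interior K), Filter.inter_mem (φ.open_source.mem_nhds hq)
    ((φ.continuousAt hq).preimage_mem_nhds (interior_mem_nhds.2 hK)), ?_⟩
  have hmeas : MeasurableSet (φ.source ∩ φ ⁻¹' (interior K)) :=
    (φ.continuousOn.isOpen_inter_preimage φ.open_source isOpen_interior).measurableSet
  have h1 : orientMeasure o (φ.source ∩ φ ⁻¹' (interior K)) =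
      chartMeasure o q (φ.source ∩ φ ⁻¹' (interior K)) := by
    rw [← orientMeasure_restrict_source, Measure.restrict_apply hmeas, ← hφ]
    congr 1
    ext x
    simp only [mem_inter_iff]
    tauto
  rw [h1, chartMeasure_apply o q hmeas]
  have hsub : (chartAt (EuclideanSpace ℝ (Fin k)) q).target ∩
      (chartAt (EuclideanSpace ℝ (Fin k)) q).symm ⁻¹' (φ.source ∩ φ ⁻¹' (interior K)) ⊆ K := by
    rintro y ⟨hyt, -, hyK⟩
    rw [mem_preimage, ← hφ, φ.right_inv hyt] at hyK
    exact interior_subset hyK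
  refine (lintegral_mono_set hsub).trans_lt ?_
  have hc : ContinuousOn (fun y ↦ |o.coeff q y|) K :=
    ((o.contDiffOn_coeff q).continuousOn.mono hKt).abs
  exact (hc.integrableOn_compact hKc).setLIntegral_lt_top

end OrientationIntegral

/-! ### Integrals of closed forms along homotopies -/

section Homotopy

variable {n k : ℕ} {M : Type*} [TopologicalSpace M] [ChartedSpace (EuclideanSpace ℝ (Fin n)) M]
  {N : Type*} [TopologicalSpace N] [ChartedSpace (EuclideanSpace ℝ (Fin k)) N]

theorem relForm_congr_of_eventuallyEq (η : ∀ x : M, TangentSpace (𝓡 n) x [⋀^Fin k]→L[ℝ] ℝ)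
    (o : OrientationForm k N) {f f' : N → M} {p : N} (h : f =ᶠ[𝓝 p] f') :
    relForm η o f p = relForm η o f' p := by
  have hp : f p = f' p := h.self_of_nhds
  have hd : mfderiv (𝓡 k) (𝓡 n) f p = mfderiv (𝓡 k) (𝓡 n) f' p := h.mfderiv_eq
  unfold relForm
  rw [hd, hp]

/-- A form pulled back from the first factor of `E × ℝ` vanishes on the direction of the second. -/
theorem pullback_comp_fst_eq_zero {E : Type*} [NormedAddCommGroup E] [NormedSpace ℝ E]
    (θ : ∀ x : M, TangentSpace (𝓡 n) x [⋀^Fin k]→L[ℝ] ℝ) {H : E → M} {z : E × ℝ}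
    (hH : MDifferentiableAt 𝓘(ℝ, E) (𝓡 n) H z.1) {v : Fin k → E × ℝ} {i : Fin k}
    (hi : v i = (0, 1)) : pullback θ (fun z : E × ℝ ↦ H z.1) z v = 0 := by
  have h := pullback_comp θ (L := Prod.fst) (z := z) hH differentiableAt_fst
  change pullback θ (H ∘ Prod.fst) z v = 0
  rw [h, fderiv_fst]
  refine (ContinuousAlternatingMap.compContinuousLinearMap_apply _ _ _).trans
    (ContinuousAlternatingMap.map_coord_zero _ i ?_)
  simp [hi]

theorem pullback_slice {E : Type*} [NormedAddCommGroup E] [NormedSpace ℝ E]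
    (θ : ∀ x : M, TangentSpace (𝓡 n) x [⋀^Fin k]→L[ℝ] ℝ) {G : E × ℝ → M} {y : E} {s : ℝ}
    (hG : MDifferentiableAt 𝓘(ℝ, E × ℝ) (𝓡 n) G (y, s)) (e : Fin k → E) :
    pullback θ (fun y ↦ G (y, s)) y e = pullback θ G (y, s) (fun i ↦ (e i, 0)) := by
  have hL : HasFDerivAt (fun y : E ↦ (y, s)) ((ContinuousLinearMap.id ℝ _).prod 0) y :=
    (hasFDerivAt_id y).prodMk (hasFDerivAt_const s y)
  have h := pullback_comp θ (L := fun y : E ↦ (y, s)) (z := y) hG hL.differentiableAt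
  change pullback θ (G ∘ fun y : E ↦ (y, s)) y e = _
  rw [h, hL.fderiv]
  rfl

theorem contMDiff_family_comp {F : ℝ → N → M} {I : Set ℝ}
    (hF : ContMDiffOn ((𝓡 k).prod 𝓘(ℝ, ℝ)) (𝓡 n) ∞ (fun q : N × ℝ ↦ F q.2 q.1) (univ ×ˢ I))
    {σ : N → ℝ} (hσ : ContMDiff (𝓡 k) 𝓘(ℝ, ℝ) ∞ σ) (hσI : ∀ p, σ p ∈ I) :
    ContMDiff (𝓡 k) (𝓡 n) ∞ fun p ↦ F (σ p) p := by
  have h1 : ContMDiff (𝓡 k) ((𝓡 k).prod 𝓘(ℝ, ℝ)) ∞ (fun p : N ↦ (p, σ p)) :=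
    contMDiff_id.prodMk hσ
  exact contMDiffOn_univ.1 (hF.comp h1.contMDiffOn fun p _ ↦ ⟨mem_univ _, hσI p⟩)

variable [IsManifold (𝓡 n) ∞ M] [IsManifold (𝓡 k) ∞ N] [MeasurableSpace N] [BorelSpace N]
  [T2Space N] [SigmaCompactSpace N]

/-- The integral of a closed form does not change under a compactly supported homotopy that moves
points only inside the domain of a chart. -/
theorem integral_relForm_sub_eq_zero (η : DiffForm n k M) (hη : η.IsClosed)
    (o : OrientationForm k N) {F : ℝ → N → M} {I : Set ℝ} (hI : IsOpen I)
    (hF : ContMDiffOn ((𝓡 k).prod 𝓘(ℝ, ℝ)) (𝓡 n) ∞ (fun q : N × ℝ ↦ F q.2 q.1) (univ ×ˢ I))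
    {K : Set N} (hK : IsCompact K) (hFK : ∀ p ∉ K, ∀ t ∈ I, ∀ t' ∈ I, F t p = F t' p)
    {σ ρ : N → ℝ} (hσ : ContMDiff (𝓡 k) 𝓘(ℝ, ℝ) ∞ σ) (hρ : ContMDiff (𝓡 k) 𝓘(ℝ, ℝ) ∞ ρ)
    (hσρ : ∀ p, ∀ s ∈ Icc (0 : ℝ) 1, σ p + s * ρ p ∈ I) {q : N}
    (hq : tsupport ρ ⊆ (chartAt (EuclideanSpace ℝ (Fin k)) q).source) :
    Integrable (fun p ↦ relForm η.toFun o (fun p ↦ F (σ p + ρ p) p) p -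
      relForm η.toFun o (fun p ↦ F (σ p) p) p) (orientMeasure o) ∧
    ∫ p, (relForm η.toFun o (fun p ↦ F (σ p + ρ p) p) p -
      relForm η.toFun o (fun p ↦ F (σ p) p) p) ∂(orientMeasure o) = 0 := by
  set φ := chartAt (EuclideanSpace ℝ (Fin k)) q with hφ
  set u : N → ℝ := fun p ↦ relForm η.toFun o (fun p ↦ F (σ p + ρ p) p) p -
      relForm η.toFun o (fun p ↦ F (σ p) p) p with hu
  have hσ0 : ∀ p, σ p ∈ I := fun p ↦ by simpa using hσρ p 0 (by simp)
  have hσ1 : ∀ p, σ p + ρ p ∈ I := fun p ↦ by simpa using hσρ p 1 (by simp)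
  have hΦ0 : ContMDiff (𝓡 k) (𝓡 n) ∞ fun p ↦ F (σ p) p := contMDiff_family_comp hF hσ hσ0
  have hΦ1 : ContMDiff (𝓡 k) (𝓡 n) ∞ fun p ↦ F (σ p + ρ p) p :=
    contMDiff_family_comp hF (hσ.add hρ) hσ1
  set C' := K ∩ tsupport ρ with hC'
  have hC'c : IsCompact C' := hK.inter_right (isClosed_tsupport ρ)
  have hu0 : ∀ p ∉ C', u p = 0 := by
    intro p hp
    refine sub_eq_zero.2 (relForm_congr_of_eventuallyEq _ _ ?_)
    by_cases hpK : p ∈ K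
    · filter_upwards [(isClosed_tsupport ρ).isOpen_compl.mem_nhds fun h ↦ hp ⟨hpK, h⟩] with x hx
      rw [image_eq_zero_of_notMem_tsupport hx, add_zero]
    · filter_upwards [hK.isClosed.isOpen_compl.mem_nhds hpK] with x hx
      exact hFK x hx _ (hσ1 x) _ (hσ0 x)
  have huc : Continuous u := (contMDiff_relForm η o hΦ1).continuous.sub
    (contMDiff_relForm η o hΦ0).continuous
  refine ⟨huc.integrable_of_hasCompactSupport (HasCompactSupport.intro hC'c hu0), ?_⟩
  rw [integral_orientMeasure_eq o q huc.measurable fun p hp ↦ hu0 p fun h ↦ hp (hq h.2), ← hφ]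
  have hC's : C' ⊆ φ.source := inter_subset_right.trans hq
  set C := φ '' C' with hC
  have hCc : IsCompact C := hC'c.image_of_continuousOn (φ.continuousOn.mono hC's)
  have hCt : C ⊆ φ.target := by
    rintro _ ⟨p, hp, rfl⟩
    exact φ.map_source (hC's hp)
  have hnotC : ∀ y ∈ φ.target, y ∉ C → φ.symm y ∉ C' :=
    fun y hy hyC h ↦ hyC ⟨_, h, φ.right_inv hy⟩
  rw [setIntegral_eq_of_subset_of_forall_sdiff_eq_zero φ.open_target.measurableSet hCt
    fun y hy ↦ by rw [hu0 _ (hnotC y hy.1 hy.2), mul_zero]]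
  -- the homotopy in the chart
  set τ : EuclideanSpace ℝ (Fin k) × ℝ → ℝ := fun z ↦ σ (φ.symm z.1) + z.2 * ρ (φ.symm z.1) with hτ
  have hsymm : ContMDiffOn 𝓘(ℝ, EuclideanSpace ℝ (Fin k) × ℝ) (𝓡 k) ∞
      (fun z : EuclideanSpace ℝ (Fin k) × ℝ ↦ φ.symm z.1) (φ.target ×ˢ univ) :=
    (contMDiffOn_chart_symm (I := 𝓡 k) (n := ∞) (x := q)).comp
      (contDiff_fst.contMDiff.contMDiffOn) fun z hz ↦ hz.1
  have hτs : ContDiffOn ℝ ∞ τ (φ.target ×ˢ univ) :=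
    (hσ.comp_contMDiffOn hsymm).contDiffOn.add
      (contDiff_snd.contDiffOn.mul (hρ.comp_contMDiffOn hsymm).contDiffOn)
  obtain ⟨hΩ, hG⟩ := contMDiffOn_family_chart hI hF q hτs
  rw [← hφ] at hΩ hG
  set Ω := (φ.target ×ˢ (univ : Set ℝ)) ∩ τ ⁻¹' I with hΩdef
  set G : EuclideanSpace ℝ (Fin k) × ℝ → M := fun z ↦ F (τ z) (φ.symm z.1) with hGdef
  have hCΩ : C ×ˢ Icc (0 : ℝ) 1 ⊆ Ω := fun z hz ↦ ⟨⟨hCt hz.1, mem_univ _⟩, hσρ _ _ hz.2⟩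
  -- the sign makes up for the absolute value of the coefficient of the orientation form
  set θ : EuclideanSpace ℝ (Fin k) × ℝ → (EuclideanSpace ℝ (Fin k) × ℝ) [⋀^Fin k]→L[ℝ] ℝ :=
    fun z ↦ Real.sign (o.coeff q z.1) • pullback η.toFun G z with hθ
  have hloc : ∀ z ∈ Ω, θ =ᶠ[𝓝 z] Real.sign (o.coeff q z.1) • pullback η.toFun G := by
    intro z hz
    have hc : ContinuousAt (fun z : EuclideanSpace ℝ (Fin k) × ℝ ↦ o.coeff q z.1) z :=
      ((o.contDiffOn_coeff q).continuousOn.continuousAt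
        (φ.open_target.mem_nhds hz.1.1)).comp (f := Prod.fst) continuousAt_fst
    rcases (o.coeff_ne_zero q hz.1.1).lt_or_gt with h | h
    · filter_upwards [hc.eventually_lt continuousAt_const h] with x hx
      simp only [hθ, Pi.smul_apply, Real.sign_of_neg h, Real.sign_of_neg hx]
    · filter_upwards [continuousAt_const.eventually_lt hc h] with x hx
      simp only [hθ, Pi.smul_apply, Real.sign_of_pos h, Real.sign_of_pos hx]
  have hs : ∀ v, ∀ z ∈ Ω, ContDiffAt ℝ 1 (fun z ↦ θ z v) z := by
    intro v z hz
    refine ContDiffAt.congr_of_eventuallyEq (f := fun x ↦ Real.sign (o.coeff q z.1) *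
      pullback η.toFun G x v) ?_ ((hloc z hz).mono fun x hx ↦ congrArg (fun α ↦ α v) hx)
    exact contDiffAt_const.mul
      ((contDiffAt_pullback_apply η hΩ hG hz v).of_le (WithTop.coe_le_coe.2 le_top))
  have key := setIntegral_eq_of_closed_homotopy (volume : Measure (EuclideanSpace ℝ (Fin k)))
    (stdFrame k) hΩ hCc hCΩ (θ := θ)
    (fun z hz ↦ ((differentiableAt_pullback η hΩ hG hz).const_smul _).congr_of_eventuallyEq
      (hloc z hz)) hs
    (fun z hz ↦ by
      rw [(hloc z hz).extDeriv_eq, extDeriv_smul,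
        extDeriv_pullback_eq_zero η hη hΩ hG hz, smul_zero])
    (fun z hz hzC v hv ↦ by
      obtain ⟨i, hi⟩ := hv
      have hzn := hnotC z.1 hz.1.1 hzC
      suffices h : pullback η.toFun G z v = 0 by
        simp only [hθ, ContinuousAlternatingMap.smul_apply, h, smul_zero]
      have hsymm1 : ContinuousAt (fun z : EuclideanSpace ℝ (Fin k) × ℝ ↦ φ.symm z.1) z :=
        (φ.continuousAt_symm hz.1.1).comp (f := Prod.fst) continuousAt_fst
      by_cases hzK : φ.symm z.1 ∈ K
      · rw [pullback_congr_of_eventuallyEq (G' := fun z : EuclideanSpace ℝ (Fin k) × ℝ ↦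
          ((fun p ↦ F (σ p) p) ∘ φ.symm) z.1)]
        · exact pullback_comp_fst_eq_zero _ ((hΦ0.mdifferentiableAt (by simp)).comp _
            (mdifferentiableAt_chart_symm q hz.1.1)) hi
        · filter_upwards [hsymm1.preimage_mem_nhds
            ((isClosed_tsupport ρ).isOpen_compl.mem_nhds fun h ↦ hzn ⟨hzK, h⟩)] with x hx
          simp only [hGdef, hτ, Function.comp_apply, image_eq_zero_of_notMem_tsupport hx,
            mul_zero, add_zero]
      · rw [pullback_congr_of_eventuallyEq (G' := fun z : EuclideanSpace ℝ (Fin k) × ℝ ↦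
          ((fun p ↦ F (σ p) p) ∘ φ.symm) z.1)]
        · exact pullback_comp_fst_eq_zero _ ((hΦ0.mdifferentiableAt (by simp)).comp _
            (mdifferentiableAt_chart_symm q hz.1.1)) hi
        · filter_upwards [hsymm1.preimage_mem_nhds (hK.isClosed.isOpen_compl.mem_nhds hzK),
            hΩ.mem_nhds hz] with x hx hxΩ
          exact hFK _ hx _ hxΩ.2 _ (hσ0 _))
  have hslice : ∀ s ∈ Icc (0 : ℝ) 1, ∀ y ∈ C, ∀ f : N → M, ContMDiff (𝓡 k) (𝓡 n) ∞ f →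
      (∀ p, f p = F (σ p + s * ρ p) p) → θ (y, s) (fun i ↦ (stdFrame k i, 0)) =
        |o.coeff q y| * relForm η.toFun o f (φ.symm y) := by
    intro s hs y hy f hf hfeq
    have h1 := pullback_slice η.toFun (e := stdFrame k)
      (mdifferentiableAt_of_contMDiffOn hΩ hG (hCΩ (mk_mem_prod hy hs)))
    have h2 := pullback_chart_symm_eq η.toFun o q (hCt hy) (hf.mdifferentiableAt (by simp))
    have h3 : (fun y ↦ G (y, s)) = f ∘ φ.symm := funext fun y ↦ (hfeq _).symm
    rw [h3] at h1
    rw [← hφ] at h2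
    simp only [hθ, ContinuousAlternatingMap.smul_apply, ← h1, h2, smul_eq_mul]
    rcases (o.coeff_ne_zero q (hCt hy)).lt_or_gt with h | h
    · rw [Real.sign_of_neg h, abs_of_neg h]; ring
    · rw [Real.sign_of_pos h, abs_of_pos h]; ring
  have hint : ∀ s ∈ Icc (0 : ℝ) 1,
      IntegrableOn (fun y ↦ θ (y, s) (fun i ↦ (stdFrame k i, 0))) C := by
    intro s hs'
    refine ContinuousOn.integrableOn_compact hCc fun y hy ↦ ?_
    exact ((hs _ (y, s) (hCΩ (mk_mem_prod hy hs'))).continuousAt.comp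
      (f := fun y ↦ (y, s)) (by fun_prop)).continuousWithinAt
  rw [← sub_eq_zero, ← integral_sub (hint 1 (by simp)) (hint 0 (by simp))] at key
  rw [← key]
  refine setIntegral_congr_fun hCc.measurableSet fun y hy ↦ ?_
  simp only [hu]
  rw [hslice 1 (by simp) y hy _ hΦ1 fun p ↦ by rw [one_mul],
    hslice 0 (by simp) y hy _ hΦ0 fun p ↦ by rw [zero_mul, add_zero], mul_sub]

/-- The integral of a closed form does not change under a compactly supported homotopy. The homotopy
is cut by a partition of unity into finitely many steps that each take place in a chart. -/
theorem integral_relForm_family_sub_eq_zero (η : DiffForm n k M) (hη : η.IsClosed)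
    (o : OrientationForm k N) {F : ℝ → N → M} {ε : ℝ}
    (hF : ContMDiffOn ((𝓡 k).prod 𝓘(ℝ, ℝ)) (𝓡 n) ∞ (fun q : N × ℝ ↦ F q.2 q.1)
      (univ ×ˢ Ioo (-ε) ε))
    {K : Set N} (hK : IsCompact K)
    (hFK : ∀ p ∉ K, ∀ t ∈ Ioo (-ε) ε, ∀ t' ∈ Ioo (-ε) ε, F t p = F t' p)
    {t : ℝ} (ht : t ∈ Ioo (-ε) ε) :
    Integrable (fun p ↦ relForm η.toFun o (F t) p - relForm η.toFun o (F 0) p) (orientMeasure o) ∧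
    ∫ p, (relForm η.toFun o (F t) p - relForm η.toFun o (F 0) p) ∂(orientMeasure o) = 0 := by
  classical
  have hpart : ∀ (J : Finset N) (p : N), ∑ j ∈ J, chartPartition k N j p ∈ Icc (0 : ℝ) 1 := by
    refine fun J p ↦ ⟨Finset.sum_nonneg fun j _ ↦ (chartPartition k N).nonneg j p, ?_⟩
    rw [← (chartPartition k N).sum_finsupport' p (mem_univ p)
      (Finset.subset_union_right (s₁ := J))]
    exact Finset.sum_le_sum_of_subset_of_nonneg Finset.subset_union_left
      fun j _ _ ↦ (chartPartition k N).nonneg j p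
  have hconv : ∀ s ∈ Icc (0 : ℝ) 1, t * s ∈ Ioo (-ε) ε := by
    intro s hs
    rw [mem_Ioo, ← abs_lt] at ht ⊢
    rw [abs_mul, abs_of_nonneg hs.1]
    exact (mul_le_of_le_one_right (abs_nonneg t) hs.2).trans_lt ht
  have hstep : ∀ J : Finset N,
      Integrable (fun p ↦ relForm η.toFun o (fun p ↦ F (t * ∑ j ∈ J, chartPartition k N j p) p) p -
        relForm η.toFun o (F 0) p) (orientMeasure o) ∧
      ∫ p, (relForm η.toFun o (fun p ↦ F (t * ∑ j ∈ J, chartPartition k N j p) p) p -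
        relForm η.toFun o (F 0) p) ∂(orientMeasure o) = 0 := by
    intro J
    induction J using Finset.induction_on with
    | empty => simp
    | insert q J hqJ ih =>
      have h := integral_relForm_sub_eq_zero η hη o isOpen_Ioo hF hK hFK
        (σ := fun p ↦ t * ∑ j ∈ J, chartPartition k N j p)
        (ρ := fun p ↦ t * chartPartition k N q p) (q := q)
        (contMDiff_const.mul (contMDiff_finsetSum fun j _ ↦ (chartPartition k N j).contMDiff))
        (contMDiff_const.mul (chartPartition k N q).contMDiff)
        (fun p s hs ↦ by
          have h0 := hpart J p
          have h1 := hpart (insert q J) p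
          rw [Finset.sum_insert hqJ] at h1
          have h2 := (chartPartition k N).nonneg q p
          have h3 : t * ∑ j ∈ J, chartPartition k N j p + s * (t * chartPartition k N q p) =
              t * (∑ j ∈ J, chartPartition k N j p + s * chartPartition k N q p) := by ring
          rw [h3]
          exact hconv _ ⟨add_nonneg h0.1 (mul_nonneg hs.1 h2),
            by linarith [h1.2, mul_le_of_le_one_left h2 hs.2]⟩)
        ((tsupport_mul_subset_right (f := fun _ ↦ t)).trans (chartPartition_subordinate q))
      simp only [← mul_add, add_comm _ (chartPartition k N q _)] at h
      have h4 := h.1.add ih.1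
      have h5 := integral_add h.1 ih.1
      simp only [sub_add_sub_cancel, h.2, ih.2, add_zero] at h5
      simp only [Finset.sum_insert hqJ]
      exact ⟨h4.congr (Filter.Eventually.of_forall fun p ↦ by simp), h5⟩
  have hfin := (chartPartition k N).locallyFinite.finite_nonempty_inter_compact hK
  have hJ : (fun p ↦ F (t * ∑ j ∈ hfin.toFinset, chartPartition k N j p) p) = F t := by
    funext p
    by_cases hp : p ∈ K
    · rw [(chartPartition k N).sum_finsupport' p (mem_univ p) fun j hj ↦ ?_, mul_one]
      rw [Finite.mem_toFinset]
      exact ⟨p, (SmoothPartitionOfUnity.mem_finsupport _ _).1 hj, hp⟩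
    · exact hFK p hp _ (hconv _ (hpart _ p)) _ ht
  have h := hstep hfin.toFinset
  rwa [hJ] at h

end Homotopy

/-! ### Maps that agree on a set -/

section Agreement

/-- Two maps that agree on a set have the same derivative at almost every point of the set. -/
theorem ae_eq_of_hasFDerivAt_of_eqOn {k n : ℕ}
    {f g : EuclideanSpace ℝ (Fin k) → EuclideanSpace ℝ (Fin n)}
    {f' g' : EuclideanSpace ℝ (Fin k) → EuclideanSpace ℝ (Fin k) →L[ℝ] EuclideanSpace ℝ (Fin n)}
    {A : Set (EuclideanSpace ℝ (Fin k))} (hA : MeasurableSet A)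
    (hf : ∀ x ∈ A, HasFDerivAt f (f' x) x) (hg : ∀ x ∈ A, HasFDerivAt g (g' x) x)
    (h : EqOn f g A) : ∀ᵐ x ∂(volume.restrict A), f' x = g' x := by
  rcases subsingleton_or_nontrivial (EuclideanSpace ℝ (Fin k)) with hE | hE
  · exact Filter.Eventually.of_forall fun x ↦ ContinuousLinearMap.ext fun v ↦ by
      rw [Subsingleton.elim v 0, map_zero, map_zero]
  obtain ⟨e, he⟩ := exists_ne (0 : EuclideanSpace ℝ (Fin k))
  -- a coordinate of `f - g` times a fixed vector is a map into the same space that vanishes on `A`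
  have hj : ∀ j : Fin n, ∀ᵐ x ∂(volume.restrict A), ∀ v, f' x v j = g' x v j := by
    intro j
    set u : EuclideanSpace ℝ (Fin k) → EuclideanSpace ℝ (Fin k) := fun x ↦ (f x j - g x j) • e
    set P : EuclideanSpace ℝ (Fin n) →L[ℝ] ℝ := EuclideanSpace.proj j
    have hu : ∀ x ∈ A, HasFDerivAt u ((P ∘L f' x - P ∘L g' x).smulRight e) x := by
      intro x hx
      exact ((P.hasFDerivAt.comp x (hf x hx)).sub (P.hasFDerivAt.comp x (hg x hx))).smul_const e
    have happ : ApproximatesLinearOn u (0 : EuclideanSpace ℝ (Fin k) →L[ℝ] _) A 0 := by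
      intro x hx y hy
      simp [u, h hx, h hy]
    filter_upwards [happ.norm_fderiv_sub_le volume hA _
      fun x hx ↦ (hu x hx).hasFDerivWithinAt] with x hx v
    rw [sub_zero] at hx
    have h0 : (P ∘L f' x - P ∘L g' x).smulRight e = 0 :=
      nnnorm_eq_zero.1 (le_antisymm hx zero_le)
    have h1 := congrArg (fun L : EuclideanSpace ℝ (Fin k) →L[ℝ] EuclideanSpace ℝ (Fin k) ↦ L v) h0
    have h2 : (f' x v j - g' x v j) • e = 0 := h1
    exact sub_eq_zero.1 ((smul_eq_zero.1 h2).resolve_right he)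
  filter_upwards [ae_all_iff.2 hj] with x hx
  ext v j
  exact hx j v

variable {n k : ℕ} {M : Type*} [TopologicalSpace M] [ChartedSpace (EuclideanSpace ℝ (Fin n)) M]
  [IsManifold (𝓡 n) ∞ M]
  {N : Type*} [TopologicalSpace N] [ChartedSpace (EuclideanSpace ℝ (Fin k)) N]
  [IsManifold (𝓡 k) ∞ N] [MeasurableSpace N] [BorelSpace N] [T2Space N] [SigmaCompactSpace N]

/-- Maps that agree on a set pull back a form to the same form at almost every point of the set. -/
theorem ae_relForm_eq_of_eqOn (η : DiffForm n k M) (o : OrientationForm k N) {f f' : N → M}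
    (hf : ContMDiff (𝓡 k) (𝓡 n) ∞ f) (hf' : ContMDiff (𝓡 k) (𝓡 n) ∞ f') {A : Set N}
    (hA : MeasurableSet A) (h : EqOn f f' A) :
    ∀ᵐ p ∂(orientMeasure o), p ∈ A → relForm η.toFun o f p = relForm η.toFun o f' p := by
  have : SecondCountableTopology N :=
    ChartedSpace.secondCountable_of_sigmaCompact (EuclideanSpace ℝ (Fin k)) N
  set B := {p | p ∈ A ∧ relForm η.toFun o f p ≠ relForm η.toFun o f' p} with hB
  have hBm : MeasurableSet B := hA.inter (isClosed_eq (contMDiff_relForm η o hf).continuous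
    (contMDiff_relForm η o hf').continuous).isOpen_compl.measurableSet
  have hB0 : orientMeasure o B = 0 := by
    refine measure_null_of_locally_null B fun p₀ hp₀ ↦ ?_
    set φ := chartAt (EuclideanSpace ℝ (Fin k)) p₀ with hφ
    set ψ := chartAt (EuclideanSpace ℝ (Fin n)) (f p₀) with hψ
    set U := f ⁻¹' ψ.source ∩ f' ⁻¹' ψ.source with hU
    have hUo : IsOpen U := (ψ.open_source.preimage hf.continuous).inter
      (ψ.open_source.preimage hf'.continuous)
    have hpU : p₀ ∈ U := by
      refine ⟨mem_chart_source _ _, ?_⟩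
      rw [mem_preimage, ← h hp₀.1]
      exact mem_chart_source _ _
    refine ⟨(B ∩ U) ∩ φ.source, ?_, ?_⟩
    · rw [inter_assoc]
      exact Filter.inter_mem self_mem_nhdsWithin (mem_nhdsWithin_of_mem_nhds
        ((hUo.inter φ.open_source).mem_nhds ⟨hpU, mem_chart_source _ _⟩))
    · refine orientMeasure_inter_source_eq_zero o p₀ (hBm.inter hUo.measurableSet) ?_
      rw [← hφ]
      have hG : ContMDiffOn 𝓘(ℝ, EuclideanSpace ℝ (Fin k)) (𝓡 n) ∞ (f ∘ φ.symm) φ.target :=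
        hf.comp_contMDiffOn (contMDiffOn_chart_symm (I := 𝓡 k) (n := ∞) (x := p₀))
      have hG' : ContMDiffOn 𝓘(ℝ, EuclideanSpace ℝ (Fin k)) (𝓡 n) ∞ (f' ∘ φ.symm) φ.target :=
        hf'.comp_contMDiffOn (contMDiffOn_chart_symm (I := 𝓡 k) (n := ∞) (x := p₀))
      have hAm : MeasurableSet (φ.target ∩ φ.symm ⁻¹' (A ∩ U)) :=
        measurableSet_inter_preimage_of_continuousOn φ.continuousOn_symm
          φ.open_target.measurableSet (hA.inter hUo.measurableSet)
      have hae := ae_eq_of_hasFDerivAt_of_eqOn hAm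
        (fun y hy ↦ ((contDiffAt_chart_comp φ.open_target hG (f p₀) hy.1
          hy.2.2.1).differentiableAt (by simp)).hasFDerivAt)
        (fun y hy ↦ ((contDiffAt_chart_comp φ.open_target hG' (f p₀) hy.1
          hy.2.2.2).differentiableAt (by simp)).hasFDerivAt)
        (fun y hy ↦ congrArg ψ (h hy.2.1))
      rw [ae_restrict_iff' hAm] at hae
      refine measure_mono_null (fun y hy ↦ ?_) (ae_iff.1 hae)
      rw [mem_ofPred_eq, Classical.not_imp]
      refine ⟨⟨hy.1, hy.2.1.1, hy.2.2⟩, fun hd ↦ hy.2.1.2 ?_⟩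
      have h1 := (pullback_eventuallyEq η.toFun φ.open_target hG (f p₀) hy.1
        hy.2.2.1).self_of_nhds
      have h2 := (pullback_eventuallyEq η.toFun φ.open_target hG' (f p₀) hy.1
        hy.2.2.2).self_of_nhds
      have h3 : (f ∘ φ.symm) y = (f' ∘ φ.symm) y := h hy.2.1.1
      have h4 : pullback η.toFun (f ∘ φ.symm) y = pullback η.toFun (f' ∘ φ.symm) y := by
        rw [h1, h2]
        beta_reduce
        rw [hd, Function.comp_apply, h3]
        rfl
      refine mul_right_cancel₀ (o.coeff_ne_zero p₀ hy.1) ?_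
      rw [← pullback_chart_symm_eq η.toFun o p₀ hy.1 (hf.mdifferentiableAt (by simp)),
        ← pullback_chart_symm_eq η.toFun o p₀ hy.1 (hf'.mdifferentiableAt (by simp)), ← hφ, h4]
  filter_upwards [measure_eq_zero_iff_ae_notMem.1 hB0] with p hp hpA
  by_contra hne
  exact hp ⟨hpA, hne⟩

end Agreement

/-! ### Variations -/

section Variations

variable {n k : ℕ} {M : Type*} [TopologicalSpace M] [ChartedSpace (EuclideanSpace ℝ (Fin n)) M]
  [IsManifold (𝓡 n) ∞ M]
  {N : Type*} [TopologicalSpace N] [ChartedSpace (EuclideanSpace ℝ (Fin k)) N]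
  [IsManifold (𝓡 k) ∞ N] [T2Space N] [SigmaCompactSpace N]
  {g : Metric n M} {ι : N → M} {ε : ℝ} {F : ℝ → N → M} {S : Set N}

theorem IsVariation.contMDiff (hF : IsVariation k g ι ε F S) {t : ℝ} (ht : t ∈ Ioo (-ε) ε) :
    ContMDiff (𝓡 k) (𝓡 n) ∞ (F t) :=
  contMDiff_family_comp hF.smooth (contMDiff_const (c := t)) fun _ ↦ ht

theorem IsVariation.zero_mem (hF : IsVariation k g ι ε F S) : (0 : ℝ) ∈ Ioo (-ε) ε :=
  ⟨neg_neg_of_pos hF.pos, hF.pos⟩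

theorem IsVariation.zero_eq (hF : IsVariation k g ι ε F S) : F 0 = ι := funext hF.zero

/-- The density is Lipschitz in time, uniformly on the support of a variation. -/
theorem IsVariation.exists_lipschitz (hF : IsVariation k g ι ε F S) (o : OrientationForm k N)
    (hpos : ∀ p, 0 < relDensity g o ι p) : ∃ δ > 0, ∃ K : NNReal, ∀ p ∈ closure S,
      DifferentiableAt ℝ (fun t ↦ relDensity g o (F t) p) 0 ∧
      LipschitzOnWith K (fun t ↦ relDensity g o (F t) p) (Metric.ball 0 δ) := by
  refine hF.isCompact.induction_on (p := fun A ↦ ∃ δ > 0, ∃ K : NNReal, ∀ p ∈ A,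
      DifferentiableAt ℝ (fun t ↦ relDensity g o (F t) p) 0 ∧
      LipschitzOnWith K (fun t ↦ relDensity g o (F t) p) (Metric.ball 0 δ)) ?_ ?_ ?_ ?_
  · exact ⟨1, one_pos, 0, fun p hp ↦ hp.elim⟩
  · rintro A B hAB ⟨δ, hδ, K, h⟩
    exact ⟨δ, hδ, K, fun p hp ↦ h p (hAB hp)⟩
  · rintro A B ⟨δ, hδ, K, h⟩ ⟨δ', hδ', K', h'⟩
    refine ⟨min δ δ', lt_min hδ hδ', max K K', fun p hp ↦ ?_⟩
    rcases hp with hp | hp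
    · exact ⟨(h p hp).1, ((h p hp).2.mono (Metric.ball_subset_ball (min_le_left _ _))).weaken
        (le_max_left _ _)⟩
    · exact ⟨(h' p hp).1, ((h' p hp).2.mono (Metric.ball_subset_ball (min_le_right _ _))).weaken
        (le_max_right _ _)⟩
  · intro p _
    obtain ⟨V, hV, δ, hδ, K, h⟩ := exists_lipschitz_relDensity g o isOpen_Ioo hF.smooth hF.zero_mem
      (p₀ := p) (by rw [hF.zero_eq]; exact hpos p)
    exact ⟨V, mem_nhdsWithin_of_mem_nhds hV, δ, hδ, K, h⟩

variable [MeasurableSpace N] [BorelSpace N]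

theorem IsVariation.integrableOn (hF : IsVariation k g ι ε F S) (o : OrientationForm k N)
    {u : N → ℝ} (hu : Continuous u) : IntegrableOn u S (orientMeasure o) :=
  (hu.continuousOn.integrableOn_compact hF.isCompact).mono_set subset_closure

theorem IsVariation.vol_eq_integral (hF : IsVariation k g ι ε F S) (o : OrientationForm k N)
    {t : ℝ} (ht : t ∈ Ioo (-ε) ε) : vol k g (F t) S =
      ENNReal.ofReal (∫ p in S, relDensity g o (F t) p ∂(orientMeasure o)) := by
  rw [vol_eq_lintegral g o (hF.contMDiff ht) hF.isOpen.measurableSet,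
    ofReal_integral_eq_lintegral_ofReal
      (hF.integrableOn o (continuous_relDensity g o (hF.contMDiff ht)))
      (Filter.Eventually.of_forall fun p ↦ relDensity_nonneg g o (F t) p)]

variable [T2Space M]

/-- Since the density of the immersion is positive, a set without volume is a null set. -/
theorem IsVariation.ae_frontier_eq (hF : IsVariation k g ι ε F S) (o : OrientationForm k N)
    (hpos : ∀ p, 0 < relDensity g o ι p) {t : ℝ} (ht : t ∈ Ioo (-ε) ε) :
    ∀ᵐ p ∂(orientMeasure o), p ∈ frontier S → F t p = ι p := by
  have hι : ContMDiff (𝓡 k) (𝓡 n) ∞ ι := hF.zero_eq ▸ hF.contMDiff hF.zero_mem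
  set Z := {p ∈ frontier S | ∃ t ∈ Ioo (-ε) ε, F t p ≠ ι p} with hZ
  have hZm : MeasurableSet Z := by
    have : Z = frontier S ∩ ⋃ t ∈ Ioo (-ε) ε, {p | F t p ≠ ι p} := by
      ext p
      simp [hZ]
    rw [this]
    refine measurableSet_frontier.inter (isOpen_biUnion fun s hs ↦ ?_).measurableSet
    exact (isClosed_eq (hF.contMDiff hs).continuous hι.continuous).isOpen_compl
  have h0 := hF.eq_frontier
  rw [vol_eq_lintegral g o hι hZm, lintegral_eq_zero_iff
    (continuous_relDensity g o hι).measurable.ennreal_ofReal] at h0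
  have hnull : ∀ᵐ p ∂((orientMeasure o).restrict Z), False := by
    filter_upwards [h0] with p hp
    exact (ENNReal.ofReal_pos.2 (hpos p)).ne' hp
  rw [Filter.eventually_false_iff_eq_bot, ae_eq_bot, Measure.restrict_eq_zero] at hnull
  filter_upwards [measure_eq_zero_iff_ae_notMem.1 hnull] with p hp hpS
  by_contra hne
  exact hp ⟨hpS, t, ht, hne⟩

/-- The integral of a closed form over `S` is constant along a variation: it is so over all of `N`,
and outside `S` the integrand changes only on a null set. -/
theorem IsVariation.setIntegral_relForm_eq (hF : IsVariation k g ι ε F S) (η : DiffForm n k M)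
    (hη : η.IsClosed) (o : OrientationForm k N) (hpos : ∀ p, 0 < relDensity g o ι p) {t : ℝ}
    (ht : t ∈ Ioo (-ε) ε) :
    ∫ p in S, relForm η.toFun o (F t) p ∂(orientMeasure o) =
      ∫ p in S, relForm η.toFun o ι p ∂(orientMeasure o) := by
  have hι : ContMDiff (𝓡 k) (𝓡 n) ∞ ι := hF.zero_eq ▸ hF.contMDiff hF.zero_mem
  obtain ⟨-, h0⟩ := integral_relForm_family_sub_eq_zero η hη o hF.smooth hF.isCompact
    (fun p hp s hs s' hs' ↦ (hF.eq_outside s hs p hp).trans (hF.eq_outside s' hs' p hp).symm) ht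
  rw [hF.zero_eq, ← setIntegral_eq_integral_of_ae_compl_eq_zero (s := S), integral_sub
    (hF.integrableOn o (contMDiff_relForm η o (hF.contMDiff ht)).continuous)
    (hF.integrableOn o (contMDiff_relForm η o hι).continuous), sub_eq_zero] at h0
  · exact h0
  · filter_upwards [hF.ae_frontier_eq o hpos ht, ae_relForm_eq_of_eqOn η o (hF.contMDiff ht) hι
      (isClosed_eq (hF.contMDiff ht).continuous hι.continuous).measurableSet
      fun p hp ↦ hp] with p h1 h2 hpS
    rw [sub_eq_zero]
    by_cases hp : p ∈ closure S
    · refine h2 (h1 ?_)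
      rw [hF.isOpen.frontier_eq]
      exact ⟨hp, hpS⟩
    · refine relForm_congr_of_eventuallyEq _ _ ?_
      filter_upwards [isClosed_closure.isOpen_compl.mem_nhds hp] with x hx
      exact hF.eq_outside t ht x hx

/-- A closed form that is bounded by the volume density, and equal to it on a submanifold, bounds
the volume of the variations of the submanifold from below. -/
theorem IsVariation.integral_relDensity_le (hF : IsVariation k g ι ε F S) (η : DiffForm n k M)
    (hη : η.IsClosed)
    (hle : ∀ (x : M) (e : Fin k → TangentSpace (𝓡 n) x),
      (∀ i, g.inner x (e i) (e i) = 1) → |η.toFun x e| ≤ 1)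
    (o : OrientationForm k N) (hcal : IsCalibrated g η o ι) {t : ℝ} (ht : t ∈ Ioo (-ε) ε) :
    ∫ p in S, relDensity g o ι p ∂(orientMeasure o) ≤
      ∫ p in S, relDensity g o (F t) p ∂(orientMeasure o) := by
  have h := hF.setIntegral_relForm_eq η hη o
    (fun p ↦ (relForm_eq_relDensity g η o hcal p).2) ht
  simp only [fun p ↦ (relForm_eq_relDensity g η o hcal p).1] at h
  rw [← h]
  exact setIntegral_mono (hF.integrableOn o (contMDiff_relForm η o (hF.contMDiff ht)).continuous)
    (hF.integrableOn o (continuous_relDensity g o (hF.contMDiff ht)))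
    fun p ↦ (le_abs_self _).trans (abs_relForm_le g η.toFun hle o (F t) p)

theorem IsVariation.vol_le (hF : IsVariation k g ι ε F S) (η : DiffForm n k M)
    (hη : η.IsClosed)
    (hle : ∀ (x : M) (e : Fin k → TangentSpace (𝓡 n) x),
      (∀ i, g.inner x (e i) (e i) = 1) → |η.toFun x e| ≤ 1)
    (o : OrientationForm k N) (hcal : IsCalibrated g η o ι) {t : ℝ} (ht : t ∈ Ioo (-ε) ε) :
    vol k g ι S ≤ vol k g (F t) S := by
  have h0 := hF.vol_eq_integral o hF.zero_mem
  rw [hF.zero_eq] at h0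
  rw [h0, hF.vol_eq_integral o ht]
  exact ENNReal.ofReal_le_ofReal (hF.integral_relDensity_le η hη hle o hcal ht)

/-- The volume of a variation is differentiable at time zero, by differentiation under the integral
sign. The derivative vanishes as the volume has a minimum there. -/
theorem IsVariation.hasDerivAt_vol (hF : IsVariation k g ι ε F S) (η : DiffForm n k M)
    (hη : η.IsClosed)
    (hle : ∀ (x : M) (e : Fin k → TangentSpace (𝓡 n) x),
      (∀ i, g.inner x (e i) (e i) = 1) → |η.toFun x e| ≤ 1)
    (o : OrientationForm k N) (hcal : IsCalibrated g η o ι) :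
    HasDerivAt (fun t ↦ (vol k g (F t) S).toReal) 0 0 := by
  have hpos := fun p ↦ (relForm_eq_relDensity g η o hcal p).2
  obtain ⟨δ, hδ, K, hK⟩ := hF.exists_lipschitz o hpos
  have hI : Ioo (-ε) ε ∈ 𝓝 (0 : ℝ) := isOpen_Ioo.mem_nhds hF.zero_mem
  have hfin : orientMeasure o S ≠ ⊤ :=
    ((measure_mono subset_closure).trans_lt hF.isCompact.measure_lt_top).ne
  have hd := hasDerivAt_integral_of_dominated_loc_of_lip (μ := (orientMeasure o).restrict S)
    (F := fun t p ↦ relDensity g o (F t) p) (x₀ := (0 : ℝ)) (s := Metric.ball 0 δ)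
    (bound := fun _ ↦ (K : ℝ)) (F' := fun p ↦ deriv (fun t ↦ relDensity g o (F t) p) 0)
    (Metric.ball_mem_nhds 0 hδ)
    (Filter.eventually_of_mem hI fun t ht ↦
      (continuous_relDensity g o (hF.contMDiff ht)).aestronglyMeasurable)
    (hF.integrableOn o (continuous_relDensity g o (hF.contMDiff hF.zero_mem)))
    ?_ ?_ ?_ ?_
  · have hloc : IsLocalMin (fun t ↦ ∫ p in S, relDensity g o (F t) p ∂(orientMeasure o)) 0 := by
      filter_upwards [hI] with t ht
      rw [hF.zero_eq]
      exact hF.integral_relDensity_le η hη hle o hcal ht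
    have hd0 := hd.2
    rw [hloc.hasDerivAt_eq_zero hd0] at hd0
    refine hd0.congr_of_eventuallyEq ?_
    filter_upwards [hI] with t ht
    rw [hF.vol_eq_integral o ht, ENNReal.toReal_ofReal
      (integral_nonneg fun p ↦ relDensity_nonneg g o (F t) p)]
  · -- the derivative is measurable as a limit of difference quotients
    set r : ℕ → ℝ := fun m ↦ ε * (1 / ((m : ℝ) + 1 + 1)) with hr
    have hrpos : ∀ m, 0 < r m := fun m ↦ mul_pos hF.pos (by positivity)
    have hrI : ∀ m, r m ∈ Ioo (-ε) ε := by
      refine fun m ↦ ⟨(neg_neg_of_pos hF.pos).trans (hrpos m), ?_⟩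
      refine mul_lt_of_lt_one_right hF.pos ?_
      rw [div_lt_one (by positivity)]
      have : (0 : ℝ) ≤ m := m.cast_nonneg
      linarith
    have hr0 : Filter.Tendsto r Filter.atTop (𝓝[≠] 0) := by
      refine tendsto_nhdsWithin_iff.2 ⟨?_, Filter.Eventually.of_forall fun m ↦ (hrpos m).ne'⟩
      have h1 := (Filter.tendsto_add_atTop_iff_nat 1).2
        (tendsto_one_div_add_atTop_nhds_zero_nat (𝕜 := ℝ))
      have h2 := h1.const_mul ε
      rw [mul_zero] at h2
      refine h2.congr fun m ↦ ?_
      simp [hr]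
    refine aestronglyMeasurable_of_tendsto_ae Filter.atTop
      (f := fun m p ↦ slope (fun t ↦ relDensity g o (F t) p) 0 (r m)) (fun m ↦ ?_) ?_
    · have : Continuous fun p ↦ slope (fun t ↦ relDensity g o (F t) p) 0 (r m) := by
        simp only [slope_def_field]
        exact ((continuous_relDensity g o (hF.contMDiff (hrI m))).sub
          (continuous_relDensity g o (hF.contMDiff hF.zero_mem))).div_const _
      exact this.aestronglyMeasurable
    · filter_upwards [ae_restrict_mem hF.isOpen.measurableSet] with p hp
      exact (hasDerivAt_iff_tendsto_slope.1
        (hK p (subset_closure hp)).1.hasDerivAt).comp hr0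
  · filter_upwards [ae_restrict_mem hF.isOpen.measurableSet] with p hp
    have hnn : Real.nnabs (K : ℝ) = K := NNReal.eq (abs_of_nonneg K.2)
    rw [hnn]
    exact (hK p (subset_closure hp)).2
  · exact integrableOn_const hfin
  · filter_upwards [ae_restrict_mem hF.isOpen.measurableSet] with p hp
    exact (hK p (subset_closure hp)).1.hasDerivAt

end Variations

/-! ### Bounds on both sides for a calibration -/

section TwoSided

variable {n : ℕ} {M : Type*} [TopologicalSpace M] [ChartedSpace (EuclideanSpace ℝ (Fin n)) M]

/-- The constant function one, as a form of degree zero. -/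
noncomputable def DiffForm.one : DiffForm n 0 M where
  toFun _ := ContinuousAlternatingMap.constOfIsEmpty ℝ _ (Fin 0) 1
  smooth' _ := contDiffOn_const (c := ContinuousAlternatingMap.constOfIsEmpty ℝ _ (Fin 0) 1)

theorem DiffForm.isClosed_one : (DiffForm.one : DiffForm n 0 M).IsClosed := by
  intro x₀ y _
  have h : chartRep (DiffForm.one : DiffForm n 0 M).toFun x₀ =
    fun _ ↦ ContinuousAlternatingMap.constOfIsEmpty ℝ _ (Fin 0) 1 := rfl
  rw [h, extDeriv, fderiv_const_apply]
  ext v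
  simp [ContinuousAlternatingMap.alternatizeUncurryFin_apply]

variable [IsManifold (𝓡 n) ∞ M] {k : ℕ}
  {N : Type*} [TopologicalSpace N] [ChartedSpace (EuclideanSpace ℝ (Fin k)) N]

/-- A submanifold that is calibrated by `η` is calibrated by a closed form that is bounded in
absolute value by one on unit vectors. In positive degree this bound holds for `η` itself, as can be
seen by changing the sign of one of the vectors; in degree zero, where nothing bounds `η` from
below, the constant one will do in its place. -/
theorem exists_abs_le_one_isCalibrated {g : Metric n M} {η : DiffForm n k M}
    (hη : IsCalibration g η) {o : OrientationForm k N} {ι : N → M} (hcal : IsCalibrated g η o ι) :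
    ∃ η' : DiffForm n k M, η'.IsClosed ∧
      (∀ (x : M) (e : Fin k → TangentSpace (𝓡 n) x),
        (∀ i, g.inner x (e i) (e i) = 1) → |η'.toFun x e| ≤ 1) ∧
      IsCalibrated g η' o ι := by
  cases k with
  | zero =>
    refine ⟨DiffForm.one, DiffForm.isClosed_one, fun x e _ ↦ ?_, fun p ↦ ?_⟩
    · exact (abs_one (α := ℝ)).le
    · obtain ⟨e, ho, he, -⟩ := hcal p
      exact ⟨e, ho, he, rfl⟩
  | succ k =>
    refine ⟨η, hη.closed, fun x e he ↦ abs_le.2 ⟨?_, hη.le_one x e he⟩, hcal⟩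
    have h := hη.le_one x (Function.update e 0 (-e 0)) fun i ↦ by
      rcases eq_or_ne i 0 with rfl | hi
      · simp [he]
      · simp [hi, he]
    have h1 := (η.toFun x).toMultilinearMap.map_update_neg e 0 (e 0)
    rw [Function.update_eq_self] at h1
    have h2 : η.toFun x (Function.update e 0 (-e 0)) = -η.toFun x e := h1
    linarith

end TwoSided

/-! ### Multiples of the orientation form -/

section TopDegree

variable {k : ℕ} {N : Type*} [TopologicalSpace N] [ChartedSpace (EuclideanSpace ℝ (Fin k)) N]

theorem SmoothSimplex.isCompact_range_toFun (σ : SmoothSimplex k N k) :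
    IsCompact (range σ.toFun) := by
  obtain ⟨U, s, hU, hsub, hs, heq⟩ := σ.smooth'
  have hc : Continuous σ.toFun := by
    have h1 : σ.toFun = fun y : stdSimplex ℝ (Fin (k + 1)) ↦ s y := funext fun y ↦ (heq y).symm
    rw [h1]
    exact (hs.continuousOn.mono hsub).comp_continuous continuous_subtype_val fun y ↦ y.2
  have := isCompact_iff_compactSpace.1 (isCompact_stdSimplex ℝ (Fin (k + 1)))
  exact isCompact_range hc

theorem simplexIntegral_smul_eq_zero (o : OrientationForm k N) {u : N → ℝ}
    {σ : SmoothSimplex k N k} (h : ∀ p ∈ range σ.toFun, u p = 0) :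
    simplexIntegral (fun p ↦ u p • o.toFun p) σ = 0 := by
  refine (setIntegral_congr_fun (g := fun _ ↦ (0 : ℝ)) measurableSet_orderedSimplex
    fun t ht ↦ ?_).trans (by simp)
  have h0 : u (σ.param t) = 0 := by
    rw [SmoothSimplex.param_apply _ ht]
    exact h _ (mem_range_self _)
  have h1 : pullback (fun p ↦ u p • o.toFun p) σ.param t (fun l ↦ Pi.single l 1) =
    u (σ.param t) * pullback o.toFun σ.param t (fun l ↦ Pi.single l 1) := rfl
  rw [h1, h0, zero_mul]

variable [IsManifold (𝓡 k) ∞ N]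

/-- The product of a smooth function and the orientation form. -/
noncomputable def OrientationForm.smul (o : OrientationForm k N) (u : N → ℝ)
    (hu : ContMDiff (𝓡 k) 𝓘(ℝ, ℝ) ∞ u) : DiffForm k k N where
  toFun p := u p • o.toFun p
  smooth' q := by
    have h : ContDiffOn ℝ ∞ (u ∘ (chartAt (EuclideanSpace ℝ (Fin k)) q).symm)
        (chartAt (EuclideanSpace ℝ (Fin k)) q).target :=
      (hu.comp_contMDiffOn (contMDiffOn_chart_symm (I := 𝓡 k) (n := ∞) (x := q))).contDiffOn
    exact h.smul (o.smooth' q)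

theorem extDeriv_top_eq_zero (θ : EuclideanSpace ℝ (Fin k) →
    EuclideanSpace ℝ (Fin k) [⋀^Fin k]→L[ℝ] ℝ) (y : EuclideanSpace ℝ (Fin k)) :
    extDeriv θ y = 0 := by
  ext v
  refine (extDeriv θ y).toAlternatingMap.map_linearDependent v fun h ↦ ?_
  have := h.fintype_card_le_finrank
  simp at this

theorem OrientationForm.isClosed_smul (o : OrientationForm k N) (u : N → ℝ)
    (hu : ContMDiff (𝓡 k) 𝓘(ℝ, ℝ) ∞ u) : (o.smul u hu).IsClosed :=
  fun _ _ _ ↦ extDeriv_top_eq_zero _ _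

/-- The integral over a simplex of a multiple of the orientation form is linear in the factor. -/
theorem simplexIntegral_sum_smul (o : OrientationForm k N) {α : Type*} (s : Finset α)
    {u : α → N → ℝ} (hu : ∀ a, ContMDiff (𝓡 k) 𝓘(ℝ, ℝ) ∞ (u a)) (σ : SmoothSimplex k N k) :
    simplexIntegral (fun p ↦ (∑ a ∈ s, u a p) • o.toFun p) σ =
      ∑ a ∈ s, simplexIntegral (fun p ↦ u a p • o.toFun p) σ := by
  obtain ⟨U, hU, hsub, hσ⟩ := σ.exists_param_contMDiffOn
  unfold simplexIntegral
  rw [← integral_finsetSum]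
  · refine integral_congr_ae (Filter.Eventually.of_forall fun t ↦ ?_)
    exact Finset.sum_mul s (fun a ↦ u a (σ.param t)) _
  · intro a _
    refine ContinuousOn.integrableOn_compact isCompact_orderedSimplex fun t ht ↦ ?_
    exact (contDiffAt_pullback_apply (o.smul (u a) (hu a)) hU hσ
      (hsub ht) _).continuousAt.continuousWithinAt

theorem chainIntegral_sum_smul (o : OrientationForm k N) {α : Type*} (s : Finset α)
    {u : α → N → ℝ} (hu : ∀ a, ContMDiff (𝓡 k) 𝓘(ℝ, ℝ) ∞ (u a)) (z : Chain k N k) :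
    chainIntegral (fun p ↦ (∑ a ∈ s, u a p) • o.toFun p) z =
      ∑ a ∈ s, chainIntegral (fun p ↦ u a p • o.toFun p) z := by
  simp only [chainIntegral, Finsupp.linearCombination_apply, Finsupp.sum,
    simplexIntegral_sum_smul o s hu, smul_eq_mul, Finset.mul_sum]
  exact Finset.sum_comm

end TopDegree

/-! ### Affine simplices -/

section Affine

variable {k : ℕ} {E : Type*} [AddCommGroup E] [Module ℝ E]

/-- The edges that join consecutive vertices. -/
def edges (v : Fin (k + 1) → E) (l : Fin k) : E := v l.succ - v l.castSucc

theorem sum_steps_smul (v : Fin (k + 1) → E) (t : Fin k → ℝ) :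
    ∑ i, steps 1 t i • v i = v 0 + ∑ l, t l • edges v l := by
  simp only [steps, sub_smul, Finset.sum_sub_distrib, edges, smul_sub]
  rw [Fin.sum_univ_succ, Fin.sum_univ_castSucc (fun i ↦ (Fin.snoc t 0 : Fin (k + 1) → ℝ) i • v i)]
  simp only [Fin.cons_zero, one_smul, Fin.cons_succ, Fin.snoc_castSucc, Fin.snoc_last, zero_smul,
    add_zero]
  abel

theorem sum_edges_eq (v : Fin (k + 1) → E) (i : Fin k) :
    ∑ l, (if l ≤ i then (1 : ℝ) else 0) • edges v l = v i.succ - v 0 := by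
  induction k with
  | zero => exact i.elim0
  | succ k ih =>
    rw [Fin.sum_univ_succ]
    refine Fin.cases ?_ (fun i ↦ ?_) i
    · rw [Finset.sum_eq_zero fun l _ ↦ by rw [if_neg (Fin.not_le.2 l.succ_pos), zero_smul]]
      simp [edges]
    · have h := ih (fun m ↦ v m.succ) i
      have h1 : ∀ l : Fin k, edges v l.succ = edges (fun m ↦ v m.succ) l := fun l ↦ rfl
      simp only [Fin.succ_le_succ_iff, h1, h]
      simp [edges]

/-- The edges at the first vertex and the edges that join consecutive vertices span the same
oriented parallelepiped. -/
theorem alternating_map_sub_first (α : E [⋀^Fin k]→ₗ[ℝ] ℝ) (v : Fin (k + 1) → E) :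
    α (fun i ↦ v i.succ - v 0) = α (edges v) := by
  have h := alternating_map_matrix_sum α (Matrix.of fun i l ↦ if l ≤ i then (1 : ℝ) else 0)
    (edges v)
  have htri : (Matrix.of fun i l : Fin k ↦ if l ≤ i then (1 : ℝ) else 0).IsLowerTriangular :=
    fun i l hil ↦ if_neg (not_le.2 hil)
  rw [Matrix.det_of_isLowerTriangular _ htri] at h
  simp only [Matrix.of_apply, sum_edges_eq, le_refl, if_true, Finset.prod_const_one, one_mul] at h
  exact h

theorem image_orderedSimplex (v : Fin (k + 1) → E) :
    (fun t ↦ v 0 + ∑ l, t l • edges v l) '' orderedSimplex k = convexHull ℝ (range v) := by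
  have h : Fintype.linearCombination ℝ v '' stdSimplex ℝ (Fin (k + 1)) =
      convexHull ℝ (range v) := by
    rw [← convexHull_basis_eq_stdSimplex, LinearMap.image_convexHull, ← range_comp]
    congr 2
    funext i
    simp [Fintype.linearCombination_apply]
  rw [← h, orderedSimplex_eq_image, image_image]
  refine image_congr fun y hy ↦ ?_
  rw [← sum_steps_smul, steps_tailSum y 1 hy.2, Fintype.linearCombination_apply]

end Affine

section AffineIntegral

variable {k : ℕ}

theorem setIntegral_convexHull_range (v : Fin (k + 1) → EuclideanSpace ℝ (Fin k))
    (f : EuclideanSpace ℝ (Fin k) → ℝ) :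
    ∫ y in convexHull ℝ (range v), f y =
      ∫ t in orderedSimplex k, |(coordMatrix (edges v)).det| * f (v 0 + ∑ l, t l • edges v l) := by
  set A : EuclideanSpace ℝ (Fin k) →L[ℝ] EuclideanSpace ℝ (Fin k) :=
    ∑ l, (EuclideanSpace.proj l : EuclideanSpace ℝ (Fin k) →L[ℝ] ℝ).smulRight (edges v l) with hA
  have hAx : ∀ x, A x = ∑ l, x l • edges v l := fun x ↦ by simp [hA, sum_apply]
  have hdet : A.det = (coordMatrix (edges v)).det := by
    rw [← det_coordMatrix]
    congr 2
    funext i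
    rw [hAx, Finset.sum_eq_single i (fun l _ hl ↦ by simp [stdFrame, hl]) (by simp)]
    simp [stdFrame]
  set O : Set (EuclideanSpace ℝ (Fin k)) := WithLp.ofLp ⁻¹' orderedSimplex k with hO
  have hOm : MeasurableSet O :=
    measurableSet_orderedSimplex.preimage (PiLp.volume_preserving_ofLp (Fin k)).measurable
  have himage : (fun x ↦ v 0 + A x) '' O = convexHull ℝ (range v) := by
    rw [← image_orderedSimplex v]
    ext y
    constructor
    · rintro ⟨x, hx, rfl⟩
      exact ⟨WithLp.ofLp x, hx, by simp only [hAx]⟩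
    · rintro ⟨t, ht, rfl⟩
      exact ⟨WithLp.toLp 2 t, ht, by simp only [hAx]⟩
  have hd : ∀ x ∈ O, HasFDerivWithinAt (fun x ↦ v 0 + A x) A O x :=
    fun x _ ↦ (A.hasFDerivAt.const_add (v 0)).hasFDerivWithinAt
  have htransfer := (PiLp.volume_preserving_toLp (Fin k)).setIntegral_preimage_emb
    (MeasurableEquiv.toLp 2 _).measurableEmbedding
    (fun x ↦ |(coordMatrix (edges v)).det| * f (v 0 + A x)) O
  simp only [hAx] at htransfer
  refine Eq.trans ?_ htransfer.symm
  simp only [← hAx]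
  by_cases h0 : A.det = 0
  · rw [← hdet, h0, abs_zero]
    have : volume (convexHull ℝ (range v)) = 0 := by
      rw [← himage]
      exact addHaar_image_eq_zero_of_det_fderivWithin_eq_zero volume hd fun _ _ ↦ h0
    rw [Measure.restrict_eq_zero.2 this]
    simp
  · have hinj : Function.Injective A :=
      (A.toContinuousLinearEquivOfDetNeZero h0).injective
    rw [← himage, integral_image_eq_integral_abs_det_fderiv_smul volume hOm hd
      (fun x _ y _ h ↦ hinj (add_left_cancel h))]
    simp only [hdet, smul_eq_mul]

variable {N : Type*} [TopologicalSpace N] [ChartedSpace (EuclideanSpace ℝ (Fin k)) N]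

theorem sign_eq_of_isPreconnected {X : Type*} [TopologicalSpace X] {s : Set X}
    (hs : IsPreconnected s) {f : X → ℝ} (hf : ContinuousOn f s) (h0 : ∀ x ∈ s, f x ≠ 0) {a b : X}
    (ha : a ∈ s) (hb : b ∈ s) : Real.sign (f a) = Real.sign (f b) := by
  rcases (h0 a ha).lt_or_gt with h1 | h1 <;> rcases (h0 b hb).lt_or_gt with h2 | h2
  · rw [Real.sign_of_neg h1, Real.sign_of_neg h2]
  · obtain ⟨c, hc, hc0⟩ := hs.intermediate_value ha hb hf ⟨h1.le, h2.le⟩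
    exact absurd hc0 (h0 c hc)
  · obtain ⟨c, hc, hc0⟩ := hs.intermediate_value hb ha hf ⟨h2.le, h1.le⟩
    exact absurd hc0 (h0 c hc)
  · rw [Real.sign_of_pos h1, Real.sign_of_pos h2]

variable [IsManifold (𝓡 k) ∞ N]

/-- The integral over an affine simplex of a multiple of the orientation form. -/
theorem sign_mul_simplexIntegral_affineSimplex (o : OrientationForm k N) (u : N → ℝ) (p : N)
    (v : Fin (k + 1) → EuclideanSpace ℝ (Fin k))
    (hv : convexHull ℝ (range v) ⊆ (chartAt (EuclideanSpace ℝ (Fin k)) p).target)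
    (hp : chartAt (EuclideanSpace ℝ (Fin k)) p p ∈ convexHull ℝ (range v)) :
    Real.sign (chartRep o.toFun p (chartAt (EuclideanSpace ℝ (Fin k)) p p)
        (fun i : Fin k ↦ v i.succ - v 0)) *
      simplexIntegral (fun x ↦ u x • o.toFun x) (affineSimplex p v hv) =
    ∫ y in convexHull ℝ (range v),
      |o.coeff p y| * u ((chartAt (EuclideanSpace ℝ (Fin k)) p).symm y) := by
  set φ := chartAt (EuclideanSpace ℝ (Fin k)) p with hφ
  set d := (coordMatrix (edges v)).det with hd
  have hL : ∀ t ∈ orderedSimplex k, v 0 + ∑ l, t l • edges v l ∈ convexHull ℝ (range v) :=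
    fun t ht ↦ image_orderedSimplex v ▸ mem_image_of_mem _ ht
  have hsign : ∀ y ∈ convexHull ℝ (range v), Real.sign (chartRep o.toFun p (φ p)
      (fun i : Fin k ↦ v i.succ - v 0)) * (d * o.coeff p y) = |d| * |o.coeff p y| := by
    intro y hy
    have h1 : chartRep o.toFun p (φ p) (fun i : Fin k ↦ v i.succ - v 0) = d * o.coeff p (φ p) :=
      (alternating_map_sub_first (chartRep o.toFun p (φ p)).toAlternatingMap v).trans
        (topForm_apply _ _)
    have h2 : Real.sign (d * o.coeff p (φ p)) = Real.sign (d * o.coeff p y) := by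
      by_cases hd0 : d = 0
      · rw [hd0, zero_mul, zero_mul]
      · exact sign_eq_of_isPreconnected (convex_convexHull ℝ (range v)).isPreconnected
          (f := fun y ↦ d * o.coeff p y)
          (continuousOn_const.mul ((o.contDiffOn_coeff p).continuousOn.mono hv))
          (fun x hx ↦ mul_ne_zero hd0 (o.coeff_ne_zero p (hv hx))) hp hy
    rw [h1, h2, ← abs_mul]
    rcases lt_trichotomy (d * o.coeff p y) 0 with h | h | h
    · rw [Real.sign_of_neg h, abs_of_neg h]; ring
    · rw [h, mul_zero, abs_zero]
    · rw [Real.sign_of_pos h, abs_of_pos h, one_mul]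
  have heq : EqOn (φ.symm ∘ fun t ↦ v 0 + ∑ l, t l • edges v l) (affineSimplex p v hv).param
      (orderedSimplex k) := by
    intro t ht
    rw [SmoothSimplex.param_apply _ ht, Function.comp_apply, ← sum_steps_smul]
    rfl
  rw [simplexIntegral_eq _ _ heq, setIntegral_convexHull_range, ← integral_const_mul]
  refine setIntegral_congr_fun measurableSet_orderedSimplex fun t ht ↦ ?_
  have hy := hL t ht
  set T : (Fin k → ℝ) →L[ℝ] EuclideanSpace ℝ (Fin k) :=
    ∑ l, (ContinuousLinearMap.proj l : (Fin k → ℝ) →L[ℝ] ℝ).smulRight (edges v l) with hT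
  have hTd : HasFDerivAt (fun t : Fin k → ℝ ↦ v 0 + ∑ l, t l • edges v l) T t := by
    refine (T.hasFDerivAt.const_add (v 0)).congr_of_eventuallyEq
      (Filter.Eventually.of_forall fun s ↦ ?_)
    simp [hT, sum_apply]
  have hTe : (fun l ↦ T (Pi.single l 1)) = edges v := by
    funext i
    simp only [hT, sum_apply, ContinuousLinearMap.smulRight_apply, ContinuousLinearMap.proj_apply]
    rw [Finset.sum_eq_single i (fun l _ hl ↦ by simp [hl]) (by simp)]
    simp
  have h3 : pullback (fun x ↦ u x • o.toFun x) (φ.symm ∘ fun t ↦ v 0 + ∑ l, t l • edges v l) t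
      (fun l ↦ Pi.single l 1) = u (φ.symm (v 0 + ∑ l, t l • edges v l)) *
        chartRep o.toFun p (v 0 + ∑ l, t l • edges v l) (edges v) := by
    have h5 : MDifferentiableAt 𝓘(ℝ, EuclideanSpace ℝ (Fin k)) (𝓡 k) φ.symm
        ((fun t ↦ v 0 + ∑ l, t l • edges v l) t) := mdifferentiableAt_chart_symm p (hv hy)
    have h6 := pullback_comp (fun x ↦ u x • o.toFun x)
      (L := fun t : Fin k → ℝ ↦ v 0 + ∑ l, t l • edges v l) (z := t) h5 hTd.differentiableAt
    rw [hTd.fderiv] at h6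
    rw [h6, ← hTe]
    rfl
  beta_reduce
  rw [h3, topForm_apply _ (edges v), ← hd]
  have h4 := hsign _ hy
  rw [OrientationForm.coeff] at h4 ⊢
  linear_combination u (φ.symm (v 0 + ∑ l, t l • edges v l)) * h4

end AffineIntegral

/-! ### Integration over the fundamental class -/

section FundamentalClass

variable {k : ℕ} {N : Type*} [TopologicalSpace N] [ChartedSpace (EuclideanSpace ℝ (Fin k)) N]
  [IsManifold (𝓡 k) ∞ N] [T2Space N] [SigmaCompactSpace N] [MeasurableSpace N] [BorelSpace N]

/-- For functions with support near `p`, integration over a fundamental cycle is integration with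
respect to the measure of the orientation form: the boundary term drops out by Stokes' theorem, and
the simplices that avoid `p` also avoid the support. -/
theorem IsFundamentalCycle.exists_chainIntegral_eq {o : OrientationForm k N} {z : Chain k N k}
    (hz : IsFundamentalCycle o z) (p : N) : ∃ U : Set N, IsOpen U ∧ p ∈ U ∧
      ∀ u : N → ℝ, ContMDiff (𝓡 k) 𝓘(ℝ, ℝ) ∞ u → tsupport u ⊆ U →
        chainIntegral (fun x ↦ u x • o.toFun x) z = ∫ x, u x ∂(orientMeasure o) := by
  obtain ⟨v, hv, c, w, hp, hw, rfl⟩ := hz.2 p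
  have hps := mem_chart_source (EuclideanSpace ℝ (Fin k)) p
  set φ := chartAt (EuclideanSpace ℝ (Fin k)) p with hφ
  have hclosed : IsClosed (⋃ σ ∈ w.support, range σ.toFun) :=
    isClosed_biUnion_finset fun σ _ ↦ σ.isCompact_range_toFun.isClosed
  refine ⟨(⋃ σ ∈ w.support, range σ.toFun)ᶜ ∩ (φ.source ∩ φ ⁻¹' interior (convexHull ℝ (range v))),
    hclosed.isOpen_compl.inter (φ.continuousOn.isOpen_inter_preimage φ.open_source isOpen_interior),
    ⟨?_, hps, hp⟩, fun u hu hsupp ↦ ?_⟩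
  · simpa using hw
  have h0 : ∀ x, u x ≠ 0 → x ∈ (⋃ σ ∈ w.support, range σ.toFun)ᶜ ∩
      (φ.source ∩ φ ⁻¹' interior (convexHull ℝ (range v))) :=
    fun x hx ↦ hsupp (subset_tsupport u hx)
  have hw0 : chainIntegral (fun x ↦ u x • o.toFun x) w = 0 := by
    rw [chainIntegral, Finsupp.linearCombination_apply]
    refine Finset.sum_eq_zero fun σ hσ ↦ ?_
    suffices h : simplexIntegral (fun x ↦ u x • o.toFun x) σ = 0 from
      (congrArg (fun a ↦ w σ • a) h).trans (smul_zero _)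
    refine simplexIntegral_smul_eq_zero o fun x hx ↦ ?_
    by_contra hne
    exact (h0 x hne).1 (mem_biUnion hσ hx)
  have hc0 : chainIntegral (fun x ↦ u x • o.toFun x) (boundary c) = 0 :=
    chainIntegral_boundary (o.smul u hu) (o.isClosed_smul u hu) c
  rw [map_add, map_add, hw0, hc0, add_zero, add_zero, chainIntegral,
    Finsupp.linearCombination_single, smul_eq_mul,
    sign_mul_simplexIntegral_affineSimplex o u p v hv (interior_subset hp),
    integral_orientMeasure_eq o p hu.continuous.measurable fun x hx ↦ by
      by_contra hne
      exact hx (h0 x hne).2.1]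
  refine (setIntegral_eq_of_subset_of_forall_sdiff_eq_zero φ.open_target.measurableSet hv
    fun y hy ↦ ?_).symm
  by_contra hne
  have h1 := (h0 _ (right_ne_zero_of_mul hne)).2.2
  rw [mem_preimage, φ.right_inv hy.1] at h1
  exact hy.2 (interior_subset h1)

/-- Integration over a fundamental cycle is integration with respect to the measure of the
orientation form. -/
theorem IsFundamentalCycle.chainIntegral_eq [CompactSpace N] {o : OrientationForm k N}
    {z : Chain k N k} (hz : IsFundamentalCycle o z) {u : N → ℝ}
    (hu : ContMDiff (𝓡 k) 𝓘(ℝ, ℝ) ∞ u) :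
    chainIntegral (fun x ↦ u x • o.toFun x) z = ∫ x, u x ∂(orientMeasure o) := by
  choose U hU hpU hloc using hz.exists_chainIntegral_eq
  obtain ⟨f, hf⟩ := SmoothPartitionOfUnity.exists_isSubordinate (𝓡 k) isClosed_univ U hU
    fun p _ ↦ mem_iUnion.2 ⟨p, hpU p⟩
  have hfin := f.locallyFinite.finite_nonempty_inter_compact isCompact_univ
  have hsum : ∀ x, u x = ∑ p ∈ hfin.toFinset, f p x * u x := by
    intro x
    rw [← Finset.sum_mul, f.sum_finsupport' x (mem_univ x) fun p hp ↦ ?_, one_mul]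
    rw [Finite.mem_toFinset]
    exact ⟨x, (SmoothPartitionOfUnity.mem_finsupport _ _).1 hp, mem_univ x⟩
  have hsm : ∀ p, ContMDiff (𝓡 k) 𝓘(ℝ, ℝ) ∞ fun x ↦ f p x * u x :=
    fun p ↦ (f p).contMDiff.mul hu
  calc chainIntegral (fun x ↦ u x • o.toFun x) z
      = chainIntegral (fun x ↦ (∑ p ∈ hfin.toFinset, f p x * u x) • o.toFun x) z := by
        simp only [← hsum]
    _ = ∑ p ∈ hfin.toFinset, ∫ x, f p x * u x ∂(orientMeasure o) := by
        rw [chainIntegral_sum_smul o _ hsm]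
        refine Finset.sum_congr rfl fun p _ ↦ hloc p _ (hsm p) ?_
        exact (tsupport_mul_subset_left (f := f p)).trans (hf p)
    _ = ∫ x, u x ∂(orientMeasure o) := by
        rw [← integral_finsetSum _ fun p _ ↦
          (hsm p).continuous.integrable_of_hasCompactSupport (HasCompactSupport.of_compactSpace _)]
        simp only [← hsum]

variable {n : ℕ} {M : Type*} [TopologicalSpace M] [ChartedSpace (EuclideanSpace ℝ (Fin n)) M]
  [IsManifold (𝓡 n) ∞ M]

theorem IsFundamentalCycle.chainIntegral_pushChain_eq [CompactSpace N] {o : OrientationForm k N}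
    {z : Chain k N k} (hz : IsFundamentalCycle o z) (η : DiffForm n k M) (f : N → M)
    (hf : ContMDiff (𝓡 k) (𝓡 n) ∞ f) :
    chainIntegral η.toFun (pushChain f hf z) =
      ∫ p, relForm η.toFun o f p ∂(orientMeasure o) := by
  rw [← hz.chainIntegral_eq (contMDiff_relForm η o hf), chainIntegral_pushChain]
  congr 2
  funext p
  ext w
  exact pullback_eq_relForm_mul η.toFun o f p w

theorem vol_univ_eq_integral [CompactSpace N] (g : Metric n M) (o : OrientationForm k N)
    {f : N → M} (hf : ContMDiff (𝓡 k) (𝓡 n) ∞ f) :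
    vol k g f univ = ENNReal.ofReal (∫ p, relDensity g o f p ∂(orientMeasure o)) := by
  rw [vol_eq_lintegral g o hf MeasurableSet.univ, Measure.restrict_univ,
    ofReal_integral_eq_lintegral_ofReal
      ((continuous_relDensity g o hf).integrable_of_hasCompactSupport
        (HasCompactSupport.of_compactSpace _))
      (Filter.Eventually.of_forall fun p ↦ relDensity_nonneg g o f p)]

end FundamentalClass

section HomologyClass

variable {n k : ℕ} {M : Type*} [TopologicalSpace M] [ChartedSpace (EuclideanSpace ℝ (Fin n)) M]
  [IsManifold (𝓡 n) ∞ M]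
  {N : Type*} [TopologicalSpace N] [ChartedSpace (EuclideanSpace ℝ (Fin k)) N]
  [IsManifold (𝓡 k) ∞ N] [T2Space N] [CompactSpace N] [MeasurableSpace N] [BorelSpace N]
  {N' : Type*} [TopologicalSpace N'] [ChartedSpace (EuclideanSpace ℝ (Fin k)) N']
  [IsManifold (𝓡 k) ∞ N'] [T2Space N'] [CompactSpace N'] [MeasurableSpace N'] [BorelSpace N']

/-- The integrals of a closed form over homologous maps agree. -/
theorem Homologous.integral_relForm_eq {o : OrientationForm k N} {f : N → M}
    {hf : ContMDiff (𝓡 k) (𝓡 n) ∞ f} {o' : OrientationForm k N'} {f' : N' → M}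
    {hf' : ContMDiff (𝓡 k) (𝓡 n) ∞ f'} (h : Homologous o f hf o' f' hf') (η : DiffForm n k M)
    (hη : η.IsClosed) :
    ∫ p, relForm η.toFun o f p ∂(orientMeasure o) =
      ∫ p, relForm η.toFun o' f' p ∂(orientMeasure o') := by
  obtain ⟨z, z', c, hz, hz', hc⟩ := h
  have h1 := chainIntegral_boundary η hη c
  rw [hc, map_sub, hz.chainIntegral_pushChain_eq, hz'.chainIntegral_pushChain_eq, sub_eq_zero] at h1
  exact h1.symm

theorem Homologous.vol_le {g : Metric n M} {η : DiffForm n k M} (hη : η.IsClosed)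
    (hle : ∀ (x : M) (e : Fin k → TangentSpace (𝓡 n) x),
      (∀ i, g.inner x (e i) (e i) = 1) → |η.toFun x e| ≤ 1)
    {o : OrientationForm k N} {f : N → M}
    {hf : ContMDiff (𝓡 k) (𝓡 n) ∞ f} (hcal : IsCalibrated g η o f)
    {o' : OrientationForm k N'} {f' : N' → M}
    {hf' : ContMDiff (𝓡 k) (𝓡 n) ∞ f'} (h : Homologous o f hf o' f' hf') :
    vol k g f univ ≤ vol k g f' univ := by
  have h1 := h.integral_relForm_eq η hη
  simp only [fun p ↦ (relForm_eq_relDensity g η o hcal p).1] at h1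
  rw [vol_univ_eq_integral g o hf, vol_univ_eq_integral g o' hf', h1]
  refine ENNReal.ofReal_le_ofReal (integral_mono
    ((contMDiff_relForm η o' hf').continuous.integrable_of_hasCompactSupport
      (HasCompactSupport.of_compactSpace _))
    ((continuous_relDensity g o' hf').integrable_of_hasCompactSupport
      (HasCompactSupport.of_compactSpace _)) fun p ↦ ?_)
  exact (le_abs_self _).trans (abs_relForm_le g η.toFun hle o' f' p)

end HomologyClass

end Calibration

theorem mainTheorem1 {n k : ℕ} {M : Type*} [TopologicalSpace M]
    [ChartedSpace (EuclideanSpace ℝ (Fin n)) M] [IsManifold (𝓡 n) ∞ M]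
    [T2Space M] [SigmaCompactSpace M]
    (g : Calibration.Metric n M) (η : Calibration.DiffForm n k M)
    (hη : Calibration.IsCalibration g η)
    {N : Type*} [TopologicalSpace N] [ChartedSpace (EuclideanSpace ℝ (Fin k)) N]
    [IsManifold (𝓡 k) ∞ N] [T2Space N] [SigmaCompactSpace N]
    (o : Calibration.OrientationForm k N)
    (ι : N → M) (hι : Manifold.IsImmersion (𝓡 k) (𝓡 n) ∞ ι)
    (hcal : Calibration.IsCalibrated g η o ι) :
    Calibration.IsMinimal k g ι ∧
    (∀ (ε : ℝ) (F : ℝ → N → M) (S : Set N), Calibration.IsVariation k g ι ε F S →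
      ∀ t ∈ Set.Ioo (-ε) ε, Calibration.vol k g ι S ≤ Calibration.vol k g (F t) S) ∧
    (CompactSpace N →
      ∀ {N' : Type*} [TopologicalSpace N'] [ChartedSpace (EuclideanSpace ℝ (Fin k)) N']
        [IsManifold (𝓡 k) ∞ N'] [T2Space N'] [CompactSpace N']
        (o' : Calibration.OrientationForm k N')
        (f' : N' → M) (hf' : ContMDiff (𝓡 k) (𝓡 n) ∞ f'),
        Calibration.Homologous o ι hι.contMDiff o' f' hf' →
        Calibration.vol k g ι Set.univ ≤ Calibration.vol k g f' Set.univ) := by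
  -- integration over `N` uses the Borel sets, which the statement does not mention
  let _ : MeasurableSpace N := borel N
  have : BorelSpace N := ⟨rfl⟩
  obtain ⟨θ, hθ, hle, hcalθ⟩ := Calibration.exists_abs_le_one_isCalibrated hη hcal
  refine ⟨fun ε F S hF ↦ ⟨fun t ht ↦ ?_, hF.hasDerivAt_vol θ hθ hle o hcalθ⟩,
    fun ε F S hF t ht ↦ hF.vol_le θ hθ hle o hcalθ ht, ?_⟩
  · rw [hF.vol_eq_integral o ht]
    exact ENNReal.ofReal_ne_top
  · intro _ N' _ _ _ _ _ o' f' hf' h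
    let _ : MeasurableSpace N' := borel N'
    have : BorelSpace N' := ⟨rfl⟩
    exact h.vol_le hθ hle hcalθ
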